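/- Let $\Bbbk$ be an algebraically closed field of characteristic $0$. Let $G$ be a finite abelian group, $\Gamma=\mathrm{Hom}(G,\Bbbk^\times)$, $\chi\in\Gamma$, $a\in G$, $\alpha\in\Bbbk$, $\rho=\chi(a)$, let $n$ be the order of $\rho$, and assume that $\chi^n=1$ or $\alpha(a^n-1)=0$ in $\Bbbk G$. The datum $\mathcal D=(G,\chi,a,\alpha)$ is of nilpotent type if $\alpha(a^n-1)=0$ and of non-nilpotent type otherwise; in the non-nilpotent case assume $\alpha=1$. Let $H_{\mathcal D}$ be the Hopf algebra generated by $G$ and $x$ with the relations of $G$, $x^n=\alpha(a^n-1)$ and $xg=\chi(g)gx$ $(g\in G)$, with $\Delta(g)=g\otimes g$, $\Delta(x)=x\otimes a+1\otimes x$; it has the basis $\{gx^j\mid g\in G,\,0\le j\le n-1\}$. Let $D(H_{\mathcal D})=H_{\mathcal D}^{*\mathrm{cop}}\bowtie H_{\mathcal D}$ be its Drinfeld double: it contains $H_{\mathcal D}^*$ (with the convolution product) and $H_{\mathcal D}$ as subalgebras, which generate it subject to $\sum h_{(1)}(p\leftharpoonup h_{(2)})=\sum (h_{(1)}\rightharpoonup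 p)h_{(2)}$ for $h\in H_{\mathcal D}$, $p\in H_{\mathcal D}^*$, where $(h\rightharpoonup p)(y)=p(yh)$ and $(p\leftharpoonup h)(y)=p(hy)$. Regard $\xi$ and $\gamma\in\Gamma$ as the elements of $H_{\mathcal D}^*$ with $\xi(gx^j)=\delta_{j,1}$ and $\gamma(gx^j)=\delta_{j,0}\gamma(g)$ for $g\in G$, $0\le j\le n-1$. Then $D(H_{\mathcal D})$ is generated as an algebra by $G$, $\Gamma$, $x$ and $\xi$. For a character $\lambda$ of $G\times\Gamma$ write $\lambda(g\gamma)=\lambda(g,\gamma)$, and let $Z(\lambda)$ be the quotient of $D(H_{\mathcal D})$ by the left ideal generated by $\xi$ and all $g\gamma-\lambda(g\gamma)$ (the module induced from the one-dimensional module $\Bbbk_\lambda$ of the subalgebra generated by $H_{\mathcal D}^*$ and $G$), and $L(\lambda)=Z(\lambda)/\mathrm{rad}\,Z(\lambda)$. Let $\phi(g\gamma)=\chi^{-1}(g)\gamma(a)$, $(i)_\rho=1+\rho+\dots+\rho^{i-1}$, $(i)!_\rho=(1)_\rho\cdots(i)_\rho$. Fix $1\le l\le n-1$ and $\lambda\in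 I_l$, that is, $\lambda(a\chi^{-1})=\rho^{l-1}$; then $L(\lambda)$ is the simple module $V(l,\lambda)$. Put $\sigma(\lambda)=\lambda\phi^{l}$, $\sigma^{-1}(\lambda)=\lambda\phi^{l-n}$, $\alpha_i(\mu)=(i)_\rho\bigl(\mu(\chi)-\mu(a)\rho^{1-i}\bigr)$ for a character $\mu$ of $G\times\Gamma$, and $$y=\frac{\rho^{1-l}\lambda(a)-\rho^{l}\lambda(\chi)}{(n-1)!_\rho},\qquad z=\frac{\rho\lambda(a)-\lambda(\chi)}{(n-1)!_\rho}.$$ Let $P(l,\lambda)$ be the vector space with basis $v_0,\dots,v_{n-1},u_0,\dots,u_{n-1}$ and the following action, for $0\le i\le n-1$, $g\in G$, $\gamma\in\Gamma$. Nilpotent type: $(g\gamma)v_i=(\phi^i\lambda)(g\gamma)v_i$, $(g\gamma)u_i=(\phi^{i-n+l}\lambda)(g\gamma)u_i$; $xv_i=v_{i+1}$, $xu_i=u_{i+1}$ for $i\le n-2$, $xv_{n-1}=xu_{n-1}=0$; $$\xi v_i=\begin{cases}u_{n-l-1},&i=0,\\ \alpha_i(\lambda)v_{i-1}+u_{n-l+i-1},&1\le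 i\le l-1,\\ u_{n-1},&i=l,\\ \alpha_{i-l}(\sigma(\lambda))v_{i-1},&l+1\le i\le n-1,\end{cases}\qquad \xi u_i=\begin{cases}0,&i=0,\\ \alpha_i(\sigma^{-1}(\lambda))u_{i-1},&1\le i\le n-l-1,\\ 0,&i=n-l,\\ \alpha_{i-n+l}(\lambda)u_{i-1},&n-l+1\le i\le n-1.\end{cases}$$ Non-nilpotent type: $(g\gamma)v_i=(\phi^{i-n+l}\lambda)(g\gamma)v_i$, $(g\gamma)u_i=(\phi^{i}\lambda)(g\gamma)u_i$; $\xi v_i=v_{i-1}$, $\xi u_i=u_{i-1}$ for $i\ge1$, $\xi v_0=\xi u_0=0$; $$xv_i=\begin{cases}\alpha_{i+1}(\sigma^{-1}(\lambda))v_{i+1},&0\le i\le n-l-2,\\ u_0,&i=n-l-1,\\ \alpha_{i+1-n+l}(\lambda)v_{i+1}+u_{i+1-n+l},&n-l\le i\le n-2,\\ y\,v_0+u_l,&i=n-1,\end{cases}\qquad xu_i=\begin{cases}\alpha_{i+1}(\lambda)u_{i+1},&0\le i\le l-2,\\ 0,&i=l-1,\\ \alpha_{i+1-l}(\sigma(\lambda))u_{i+1},&l\le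 i\le n-2,\\ z\,u_0,&i=n-1.\end{cases}$$ Then these formulas define a $D(H_{\mathcal D})$-module structure on $P(l,\lambda)$, and only one, and $P(l,\lambda)\cong P(\lambda)$, the projective cover of $V(l,\lambda)=L(\lambda)$: there is a projective cover $P(l,\lambda)\to L(\lambda)$ (a surjection from a projective module with superfluous kernel), and $P(l,\lambda)$ is isomorphic to the source of every projective cover of $L(\lambda)$. -/

import Mathlib

open scoped TensorProduct

set_option linter.unusedSectionVars false

/-! ### Projective covers and modules from representations -/

/-- `f : P → M` is a projective cover: `P` is projective and `f` is surjective with superfluous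
kernel. -/
structure IsProjectiveCover {A : Type*} [Ring A] {P M : Type*} [AddCommGroup P] [Module A P]
    [AddCommGroup M] [Module A M] (f : P →ₗ[A] M) : Prop where
  projective : Module.Projective A P
  surjective : Function.Surjective f
  superfluous : ∀ N : Submodule A P, N ⊔ LinearMap.ker f = ⊤ → N = ⊤

/-- The vector space `V`, regarded as a left `A`-module through `Φ : A → End_k(V)`. -/
def RepModule {k A V : Type*} [Field k] [Ring A] [Algebra k A] [AddCommGroup V] [Module k V]
    (_Φ : A →ₐ[k] Module.End k V) : Type _ := V

namespace RepModule

variable {k A V : Type*} [Field k] [Ring A] [Algebra k A] [AddCommGroup V] [Module k V]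
  (Φ : A →ₐ[k] Module.End k V)

instance : AddCommGroup (RepModule Φ) := inferInstanceAs (AddCommGroup V)

instance : Module A (RepModule Φ) := Module.compHom V Φ.toRingHom

end RepModule

/-! ### The Drinfeld double -/

namespace DrinfeldDouble

variable (k H : Type*) [Field k] [Ring H] [Bialgebra k H]

/-- The convolution product `(p q)(h) = ∑ p(h₁) q(h₂)` of `H*`. -/
noncomputable def conv (p q : Module.Dual k H) : Module.Dual k H :=
  LinearMap.mul' k k ∘ₗ TensorProduct.map p q ∘ₗ Coalgebra.comul

/-- `h ↦ (h ⇀ p)`, where `(h ⇀ p)(y) = p (y h)`. -/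
noncomputable def leftHit (p : Module.Dual k H) : H →ₗ[k] Module.Dual k H :=
  (LinearMap.mul k H).flip.compr₂ p

/-- `h ↦ (p ↼ h)`, where `(p ↼ h)(y) = p (h y)`. -/
noncomputable def rightHit (p : Module.Dual k H) : H →ₗ[k] Module.Dual k H :=
  (LinearMap.mul k H).compr₂ p

/-- The tensor algebra on the vector space `H* × H`. -/
abbrev Pre : Type _ := TensorAlgebra k (Module.Dual k H × H)

/-- The generators of `Pre` coming from `H*`. -/
noncomputable def preDual : Module.Dual k H →ₗ[k] Pre k H :=
  TensorAlgebra.ι k ∘ₗ LinearMap.inl k (Module.Dual k H) H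

/-- The generators of `Pre` coming from `H`. -/
noncomputable def preAlg : H →ₗ[k] Pre k H :=
  TensorAlgebra.ι k ∘ₗ LinearMap.inr k (Module.Dual k H) H

/-- The relations of the Drinfeld double: `H*` (with the convolution product and unit `ε`) and `H`
are subalgebras, and `∑ h₁ (p ↼ h₂) = ∑ (h₁ ⇀ p) h₂` for all `h ∈ H` and `p ∈ H*`.
When the antipode `S` of `H` is bijective the last relation is the same as the usual straightening
rule `h p = ∑ (h₁ ⇀ p ↼ S⁻¹(h₃)) h₂` of the multiplication of `H*ᶜᵒᵖ ⋈ H`. -/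
inductive Rel : Pre k H → Pre k H → Prop
  | one_dual : Rel (preDual k H Coalgebra.counit) 1
  | mul_dual (p q : Module.Dual k H) :
      Rel (preDual k H (conv k H p q)) (preDual k H p * preDual k H q)
  | one_alg : Rel (preAlg k H 1) 1
  | mul_alg (h h' : H) : Rel (preAlg k H (h * h')) (preAlg k H h * preAlg k H h')
  | cross (p : Module.Dual k H) (h : H) :
      Rel
        ((LinearMap.mul' k (Pre k H) ∘ₗ
          TensorProduct.map (preAlg k H) (preDual k H ∘ₗ rightHit k H p)) (Coalgebra.comul h))
        ((LinearMap.mul' k (Pre k H) ∘ₗ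
          TensorProduct.map (preDual k H ∘ₗ leftHit k H p) (preAlg k H)) (Coalgebra.comul h))

end DrinfeldDouble

/-- The Drinfeld double `D(H) = H*ᶜᵒᵖ ⋈ H`, as an algebra. -/
def DrinfeldDouble (k H : Type*) [Field k] [Ring H] [Bialgebra k H] : Type _ :=
  RingQuot (DrinfeldDouble.Rel k H)

namespace DrinfeldDouble

variable (k H : Type*) [Field k] [Ring H] [Bialgebra k H]

noncomputable instance : Ring (DrinfeldDouble k H) :=
  inferInstanceAs (Ring (RingQuot (Rel k H)))

noncomputable instance : Algebra k (DrinfeldDouble k H) :=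
  inferInstanceAs (Algebra k (RingQuot (Rel k H)))

/-- The quotient map from the tensor algebra. -/
noncomputable def quotMap : Pre k H →ₐ[k] DrinfeldDouble k H := RingQuot.mkAlgHom k (Rel k H)

/-- The canonical map `H* → D(H)`. -/
noncomputable def ofDual : Module.Dual k H →ₗ[k] DrinfeldDouble k H :=
  (quotMap k H).toLinearMap ∘ₗ preDual k H

/-- The canonical map `H → D(H)`. -/
noncomputable def ofAlg : H →ₗ[k] DrinfeldDouble k H :=
  (quotMap k H).toLinearMap ∘ₗ preAlg k H

end DrinfeldDouble

/-! ### A q-binomial fact -/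

/-- Gaussian binomial coefficients. -/
def gaussBinom {R : Type*} [CommRing R] (q : R) : ℕ → ℕ → R
  | _, 0 => 1
  | 0, _ + 1 => 0
  | m + 1, i + 1 => gaussBinom q m i + q ^ (i + 1) * gaussBinom q m (i + 1)

theorem gaussBinom_eq_zero {R : Type*} [CommRing R] (q : R) (m i : ℕ) (h : m < i) :
    gaussBinom q m i = 0 := by
  induction m generalizing i with
  | zero => cases i with
    | zero => omega
    | succ i => rfl
  | succ m ih => cases i with
    | zero => omega
    | succ i => simp [gaussBinom, ih i (by omega), ih (i + 1) (by omega)]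

theorem gaussBinom_self {R : Type*} [CommRing R] (q : R) (m : ℕ) : gaussBinom q m m = 1 := by
  induction m with
  | zero => rfl
  | succ m ih => simp [gaussBinom, ih, gaussBinom_eq_zero]

theorem gaussBinom_absorb {R : Type*} [CommRing R] (q : R) (m i : ℕ) :
    (q ^ (i + 1) - 1) * gaussBinom q (m + 1) (i + 1) = (q ^ (m + 1) - 1) * gaussBinom q m i := by
  induction m generalizing i with
  | zero => cases i with
    | zero => simp [gaussBinom]
    | succ i => simp [gaussBinom]
  | succ m ih =>
    have h1 := ih i
    rw [gaussBinom]
    cases i with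
    | zero =>
      have e : ∀ j, gaussBinom q j 0 = 1 := fun j => by cases j <;> rfl
      simp only [e] at h1 ⊢
      linear_combination q ^ (0 + 1) * h1
    | succ i =>
      have h2 := ih i
      have h3 : gaussBinom q (m + 1) (i + 1) =
        gaussBinom q m i + q ^ (i + 1) * gaussBinom q m (i + 1) := rfl
      linear_combination q ^ (i + 1 + 1) * h1 + q * h2 - q * (q ^ (m + 1) - 1) * h3

theorem add_pow_of_qcomm {k A : Type*} [Field k] [Ring A] [Algebra k A] (q : k) (X Y : A)
    (h : Y * X = q • (X * Y)) (m : ℕ) :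
    (X + Y) ^ m = ∑ i ∈ Finset.range (m + 1), gaussBinom q m i • (X ^ i * Y ^ (m - i)) := by
  have hY : ∀ i, Y * X ^ i = q ^ i • (X ^ i * Y) := by
    intro i
    induction i with
    | zero => simp
    | succ i ih =>
      rw [pow_succ, ← mul_assoc, ih, smul_mul_assoc, mul_assoc, h, mul_smul_comm, smul_smul,
        ← mul_assoc, pow_succ]
  induction m with
  | zero => simp [gaussBinom]
  | succ m ih =>
    rw [pow_succ', ih, add_mul, Finset.mul_sum, Finset.mul_sum, Finset.sum_range_succ' _ (m + 1)]
    have e : ∀ j, gaussBinom q j 0 = 1 := fun j => by cases j <;> rfl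
    simp only [gaussBinom, add_smul, Finset.sum_add_distrib]
    rw [add_assoc]
    congr 1
    · refine Finset.sum_congr rfl fun i hi => ?_
      rw [mul_smul_comm, ← mul_assoc, ← pow_succ', Nat.add_sub_add_right]
    · have : ∀ i ∈ Finset.range (m + 1), Y * gaussBinom q m i • (X ^ i * Y ^ (m - i)) =
          (q ^ i * gaussBinom q m i) • (X ^ i * Y ^ (m + 1 - i)) := by
        intro i hi
        have hi' : i ≤ m := by simpa [Nat.lt_succ_iff] using hi
        rw [mul_smul_comm, ← mul_assoc, hY, smul_mul_assoc, smul_smul, mul_assoc, ← pow_succ',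
          Nat.succ_sub hi', mul_comm (q ^ i)]
      rw [Finset.sum_congr rfl this]
      rw [Finset.sum_range_succ' _ m, Finset.sum_range_succ _ m,
        gaussBinom_eq_zero q m (m + 1) (by omega)]
      simp [e]

/-- `(X + Y)ⁿ = Xⁿ + Yⁿ` if `Y X = q X Y` for a root of unity `q` of order `n ≥ 1`. -/
theorem add_pow_of_qcomm_order {k A : Type*} [Field k] [Ring A] [Algebra k A] (q : kˣ) (X Y : A)
    (h : Y * X = (q : k) • (X * Y)) (hn : 0 < orderOf q) :
    (X + Y) ^ orderOf q = X ^ orderOf q + Y ^ orderOf q := by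
  rw [add_pow_of_qcomm (q : k) X Y h, Finset.sum_range_succ, gaussBinom_self]
  obtain ⟨m, hm⟩ : ∃ m, orderOf q = m + 1 := ⟨orderOf q - 1, by omega⟩
  have hq : (q : k) ^ (m + 1) = 1 := by
    rw [← hm, ← Units.val_pow_eq_pow_val, pow_orderOf_eq_one, Units.val_one]
  rw [hm, Finset.sum_range_succ', Finset.sum_eq_zero]
  · simp [gaussBinom, add_comm]
  · intro i hi
    have hi' : i < m := by simpa using hi
    have h1 := gaussBinom_absorb (q : k) m i
    rw [hq, sub_self, zero_mul] at h1
    have h2 : (q : k) ^ (i + 1) - 1 ≠ 0 := by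
      intro h0
      have h3 : q ^ (i + 1) = 1 := by
        ext
        simpa [sub_eq_zero] using h0
      have := orderOf_le_of_pow_eq_one (Nat.succ_pos i) h3
      omega
    rw [(mul_eq_zero.mp h1).resolve_left h2, zero_smul]

/-! ### Group data and the pointed Hopf algebra of rank one -/

/-- A group datum `(G, χ, a, α)`: with `n` the order of `χ(a)`, either `χⁿ = 1` or
`α (aⁿ - 1) = 0` in the group algebra. -/
structure GroupDatum (k G : Type*) [Field k] [Group G] where
  χ : G →* kˣ
  a : G
  α : k
  a_central : a ∈ Subgroup.center G
  compat : χ ^ orderOf (χ a) = 1 ∨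
    α • (MonoidAlgebra.of k G (a ^ orderOf (χ a)) - 1) = 0

namespace GroupDatum

section Group

variable {k G : Type*} [Field k] [Group G] (D : GroupDatum k G)

/-- `ρ = χ(a)`. -/
def ρ : kˣ := D.χ D.a

/-- `n`, the order of `ρ = χ(a)`. -/
noncomputable def n : ℕ := orderOf D.ρ

/-- Nilpotent type: `α (aⁿ - 1) = 0` in the group algebra. Every other group datum is of
non-nilpotent type: `α (aⁿ - 1) ≠ 0` and (by `compat`) `χⁿ = 1`. -/
def IsNilpotent : Prop := D.α • (MonoidAlgebra.of k G (D.a ^ D.n) - 1) = 0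

/-- Generators of `H_D`: the elements of `G`, and `x`. -/
inductive Gen (G : Type*) : Type _
  | grp (g : G) : Gen G
  | x : Gen G

/-- The generator `g` in the free algebra. -/
def preGrp (k : Type*) {G : Type*} [Field k] (g : G) : FreeAlgebra k (Gen G) :=
  FreeAlgebra.ι k (Gen.grp g)

/-- The generator `x` in the free algebra. -/
def preX (k G : Type*) [Field k] : FreeAlgebra k (Gen G) := FreeAlgebra.ι k Gen.x

/-- Defining relations of `H_D`. -/
inductive Rel : FreeAlgebra k (Gen G) → FreeAlgebra k (Gen G) → Prop
  | one : Rel (preGrp k 1) 1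
  | mul (g h : G) : Rel (preGrp k (g * h)) (preGrp k g * preGrp k h)
  | pow : Rel (preX k G ^ D.n) (D.α • (preGrp k (D.a ^ D.n) - 1))
  | comm (g : G) : Rel (preX k G * preGrp k g) ((D.χ g : k) • (preGrp k g * preX k G))

/-- The pointed rank one Hopf algebra `H_D`: the algebra generated by `G` and `x` subject to the
relations of `G`, `xⁿ = α (aⁿ - 1)` and `x g = χ(g) g x`. -/
def HD : Type _ := RingQuot D.Rel

noncomputable instance : Ring D.HD := inferInstanceAs (Ring (RingQuot D.Rel))

noncomputable instance : Algebra k D.HD := inferInstanceAs (Algebra k (RingQuot D.Rel))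

/-- The quotient map from the free algebra. -/
noncomputable def quotMap : FreeAlgebra k (Gen G) →ₐ[k] D.HD := RingQuot.mkAlgHom k D.Rel

theorem quotMap_rel {u v : FreeAlgebra k (Gen G)} (h : D.Rel u v) : D.quotMap u = D.quotMap v :=
  RingQuot.mkAlgHom_rel k h

/-- `g ∈ H_D`. -/
noncomputable def grp (g : G) : D.HD := D.quotMap (preGrp k g)

/-- `x ∈ H_D`. -/
noncomputable def x : D.HD := D.quotMap (preX k G)

theorem grp_one : D.grp 1 = 1 := by
  simpa [grp] using D.quotMap_rel Rel.one

theorem grp_mul (g h : G) : D.grp (g * h) = D.grp g * D.grp h := by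
  simpa [grp] using D.quotMap_rel (Rel.mul g h)

theorem x_pow : D.x ^ D.n = D.α • (D.grp (D.a ^ D.n) - 1) := by
  simpa [grp, x] using D.quotMap_rel Rel.pow

theorem x_grp (g : G) : D.x * D.grp g = (D.χ g : k) • (D.grp g * D.x) := by
  simpa [grp, x] using D.quotMap_rel (Rel.comm g)

/-- `γ : G → B` and `X : B` satisfy the defining relations of `H_D`. -/
structure Satisfies {B : Type*} [Ring B] [Algebra k B] (γ : G → B) (X : B) : Prop where
  one : γ 1 = 1
  mul : ∀ g h, γ (g * h) = γ g * γ h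
  pow : X ^ D.n = D.α • (γ (D.a ^ D.n) - 1)
  comm : ∀ g, X * γ g = (D.χ g : k) • (γ g * X)

/-- The algebra map `H_D → B` with `g ↦ γ g` and `x ↦ X`. -/
noncomputable def lift {B : Type*} [Ring B] [Algebra k B] {γ : G → B} {X : B}
    (h : D.Satisfies γ X) : D.HD →ₐ[k] B :=
  RingQuot.liftAlgHom k ⟨FreeAlgebra.lift k (fun s => match s with
    | Gen.grp g => γ g
    | Gen.x => X), by
    intro u v huv
    cases huv with
    | one => simpa [preGrp] using h.one
    | mul g g' => simpa [preGrp] using h.mul g g'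
    | pow => simpa [preGrp, preX] using h.pow
    | comm g => simpa [preGrp, preX] using h.comm g⟩

section lift

variable {B : Type*} [Ring B] [Algebra k B] {γ : G → B} {X : B} (h : D.Satisfies γ X)

theorem lift_grp (g : G) : D.lift h (D.grp g) = γ g := by
  unfold lift grp quotMap
  refine (RingQuot.liftAlgHom_mkAlgHom_apply k (B := B) _ _ _).trans ?_
  simp [preGrp]

theorem lift_x : D.lift h D.x = X := by
  unfold lift x quotMap
  refine (RingQuot.liftAlgHom_mkAlgHom_apply k (B := B) _ _ _).trans ?_
  simp [preX]

end lift

theorem hom_ext {B : Type*} [Semiring B] [Algebra k B] {f f' : D.HD →ₐ[k] B}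
    (hg : ∀ g, f (D.grp g) = f' (D.grp g)) (hx : f D.x = f' D.x) : f = f' := by
  apply RingQuot.ringQuot_ext'
  apply FreeAlgebra.hom_ext
  funext s
  cases s with
  | grp g => exact hg g
  | x => exact hx

end Group

section Finite

variable {k G : Type*} [Field k] [Group G] [Finite G] (D : GroupDatum k G)

theorem n_pos : 0 < D.n := (D.χ.isOfFinOrder (isOfFinOrder_of_finite D.a)).orderOf_pos

instance : NeZero D.n := ⟨D.n_pos.ne'⟩

theorem comul_satisfies :
    D.Satisfies (B := D.HD ⊗[k] D.HD) (fun g => D.grp g ⊗ₜ D.grp g)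
      (D.x ⊗ₜ D.grp D.a + 1 ⊗ₜ D.x) where
  one := by simp [grp_one, Algebra.TensorProduct.one_def]
  mul g h := by simp [grp_mul]
  pow := by
    have hq : ((1 : D.HD) ⊗ₜ[k] D.x) * (D.x ⊗ₜ[k] D.grp D.a) =
        (D.ρ : k) • ((D.x ⊗ₜ[k] D.grp D.a) * ((1 : D.HD) ⊗ₜ[k] D.x)) := by
      simp [x_grp, ρ]
    have hp : ∀ m, D.grp D.a ^ m = D.grp (D.a ^ m) := by
      intro m
      induction m with
      | zero => simp [grp_one]
      | succ m ih => rw [pow_succ, pow_succ, grp_mul, ih]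
    have := add_pow_of_qcomm_order D.ρ _ _ hq D.n_pos
    change _ ^ D.n = _ ^ D.n + _ ^ D.n at this
    rw [this, Algebra.TensorProduct.tmul_pow, Algebra.TensorProduct.tmul_pow, x_pow, one_pow, hp]
    rw [← TensorProduct.smul_tmul', TensorProduct.tmul_smul, ← smul_add,
      TensorProduct.sub_tmul, TensorProduct.tmul_sub, Algebra.TensorProduct.one_def,
      sub_add_sub_cancel]
  comm g := by
    have hc : D.grp D.a * D.grp g = D.grp g * D.grp D.a := by
      rw [← grp_mul, ← grp_mul, (Subgroup.mem_center_iff.mp D.a_central g)]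
    simp [add_mul, mul_add, x_grp, hc, TensorProduct.smul_tmul']

/-- The comultiplication: `Δ(g) = g ⊗ g`, `Δ(x) = x ⊗ a + 1 ⊗ x`. -/
noncomputable def comulHom : D.HD →ₐ[k] D.HD ⊗[k] D.HD := D.lift D.comul_satisfies

theorem comulHom_grp (g : G) : D.comulHom (D.grp g) = D.grp g ⊗ₜ D.grp g :=
  D.lift_grp D.comul_satisfies g

theorem comulHom_x : D.comulHom D.x = D.x ⊗ₜ D.grp D.a + 1 ⊗ₜ D.x :=
  D.lift_x D.comul_satisfies

theorem counit_satisfies : D.Satisfies (B := k) (fun _ => 1) 0 where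
  one := rfl
  mul := by simp
  pow := by simp [D.n_pos.ne']
  comm := by simp

/-- The counit: `ε(g) = 1`, `ε(x) = 0`. -/
noncomputable def counitHom : D.HD →ₐ[k] k := D.lift D.counit_satisfies

theorem counitHom_grp (g : G) : D.counitHom (D.grp g) = 1 := D.lift_grp D.counit_satisfies g

theorem counitHom_x : D.counitHom D.x = 0 := D.lift_x D.counit_satisfies

noncomputable instance : Bialgebra k D.HD :=
  Bialgebra.ofAlgHom D.comulHom D.counitHom
    (by
      apply D.hom_ext
      · intro g
        simp [comulHom_grp]
      · simp [comulHom_grp, comulHom_x, TensorProduct.add_tmul, TensorProduct.tmul_add,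
          Algebra.TensorProduct.one_def, add_assoc])
    (by
      apply D.hom_ext
      · intro g
        simp [comulHom_grp, counitHom_grp]
      · simp [comulHom_x, counitHom_x])
    (by
      apply D.hom_ext
      · intro g
        simp [comulHom_grp, counitHom_grp]
      · simp [comulHom_x, counitHom_x, counitHom_grp])

/-- The `k`-vector space with basis `{g xʲ | g ∈ G, 0 ≤ j ≤ n - 1}`. -/
abbrev BasisSpace : Type _ := G × Fin D.n →₀ k

/-- Left multiplication by `g`: `g (h xʲ) = (g h) xʲ`. -/
noncomputable def regGrp (g : G) : Module.End k D.BasisSpace :=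
  Finsupp.lmapDomain k k fun p => (g * p.1, p.2)

/-- Left multiplication by `x`: `x (h xʲ) = χ(h) h xʲ⁺¹`, with `xⁿ = α (aⁿ - 1)`. -/
noncomputable def regX : Module.End k D.BasisSpace :=
  Finsupp.linearCombination k fun p =>
    (D.χ p.1 : k) •
      if h : p.2.val + 1 < D.n then Finsupp.single (p.1, (⟨p.2.val + 1, h⟩ : Fin D.n)) (1 : k)
      else D.α • (Finsupp.single (D.a ^ D.n * p.1, 0) 1 - Finsupp.single (p.1, 0) 1)

theorem regGrp_single (g : G) (p : G × Fin D.n) (c : k) :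
    D.regGrp g (Finsupp.single p c) = Finsupp.single (g * p.1, p.2) c := by
  simp [regGrp]

theorem regX_of_lt (h : G) (j : ℕ) (hj : j + 1 < D.n) :
    D.regX (Finsupp.single (h, (⟨j, by omega⟩ : Fin D.n)) 1) =
      (D.χ h : k) • Finsupp.single (h, (⟨j + 1, hj⟩ : Fin D.n)) 1 := by
  simp [regX, hj]

theorem regX_last (h : G) (j : ℕ) (hj : j + 1 = D.n) :
    D.regX (Finsupp.single (h, (⟨j, by omega⟩ : Fin D.n)) 1) =
      (D.χ h : k) • D.α •
        (Finsupp.single (D.a ^ D.n * h, 0) 1 - Finsupp.single (h, (0 : Fin D.n)) 1) := by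
  simp [regX, hj]

theorem regX_pow_of_lt (h : G) (m j : ℕ) (hj : j + m < D.n) :
    (D.regX ^ m) (Finsupp.single (h, (⟨j, by omega⟩ : Fin D.n)) 1) =
      (D.χ h : k) ^ m • Finsupp.single (h, (⟨j + m, hj⟩ : Fin D.n)) 1 := by
  induction m with
  | zero => simp
  | succ m ih =>
    rw [pow_succ', Module.End.mul_apply, ih (by omega), map_smul, D.regX_of_lt h (j + m) hj,
      smul_smul, pow_succ]
    rfl

theorem chi_pow_a : D.χ (D.a ^ D.n) = 1 := by
  rw [map_pow]
  exact pow_orderOf_eq_one _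

theorem alpha_cases : D.χ ^ D.n = 1 ∨ D.α = 0 ∨ D.a ^ D.n = 1 := by
  refine D.compat.imp id fun h => ?_
  by_contra! hc
  have h1 := congrArg (fun f => f.coeff 1) h
  have hc2 : D.a ^ orderOf (D.χ D.a) ≠ 1 := hc.2
  simp [MonoidAlgebra.one_def, hc2, hc.1] at h1

theorem regX_pow_n (h : G) (j : Fin D.n) :
    (D.regX ^ D.n) (Finsupp.single (h, j) 1) =
      D.α • (Finsupp.single (D.a ^ D.n * h, j) 1 - Finsupp.single (h, j) 1) := by
  obtain ⟨j, hj⟩ := j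
  obtain ⟨m, hm⟩ : ∃ m, j + m + 1 = D.n := ⟨D.n - 1 - j, by omega⟩
  have h1 := D.regX_pow_of_lt h m j (by omega)
  have h2 := D.regX_last h (j + m) hm
  have h3 := D.regX_pow_of_lt h j 0 (by omega)
  have h4 := D.regX_pow_of_lt (D.a ^ D.n * h) j 0 (by omega)
  have e : D.regX ^ D.n = D.regX ^ j * (D.regX * D.regX ^ m) := by
    rw [← pow_succ', ← pow_add]
    congr 1
    omega
  simp only [zero_add, map_mul, chi_pow_a, one_mul] at h3 h4
  have z : (⟨0, D.n_pos⟩ : Fin D.n) = 0 := rfl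
  rw [z] at h3 h4
  rw [e, Module.End.mul_apply, Module.End.mul_apply, h1, map_smul, h2, map_smul, map_smul,
    map_smul, map_sub, h3, h4, ← smul_sub]
  rcases D.alpha_cases with h0 | h0 | h0
  · have hχ : (D.χ h : k) ^ D.n = 1 := by
      rw [← Units.val_pow_eq_pow_val, ← MonoidHom.pow_apply, h0]
      simp
    have : (D.χ h : k) ^ m * (D.χ h : k) * (D.χ h : k) ^ j = 1 := by
      rw [← pow_succ, ← pow_add, ← hχ]
      congr 1
      omega
    rw [smul_comm D.α ((D.χ h : k) ^ j), smul_smul, smul_smul, this, one_smul]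
  · simp [h0]
  · simp [h0]

theorem reg_satisfies : D.Satisfies D.regGrp D.regX where
  one := by
    refine Finsupp.lhom_ext fun p c => ?_
    simp [regGrp_single]
  mul g h := by
    refine Finsupp.lhom_ext fun p c => ?_
    simp [regGrp_single, mul_assoc]
  pow := by
    refine Finsupp.lhom_ext' fun p => LinearMap.ext_ring ?_
    have := D.regX_pow_n p.1 p.2
    simpa [regGrp_single] using this
  comm g := by
    refine Finsupp.lhom_ext' fun p => LinearMap.ext_ring ?_
    have hc : D.a ^ D.n * (g * p.1) = g * (D.a ^ D.n * p.1) := by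
      have := Subgroup.mem_center_iff.mp (Subgroup.pow_mem _ D.a_central D.n) g
      rw [← mul_assoc, ← mul_assoc, this]
    obtain ⟨h, j, hj⟩ := p
    by_cases hj' : j + 1 < D.n
    · simp [regGrp_single, regX_of_lt _ _ _ hj']
    · have hj'' : j + 1 = D.n := by omega
      simp only at hc
      simp only [LinearMap.comp_apply, Finsupp.lsingle_apply, Module.End.mul_apply,
        LinearMap.smul_apply, regGrp_single, regX_last _ _ _ hj'', map_smul, map_sub, map_mul,
        Units.val_mul, mul_smul, hc]

/-- The coordinates of an element of `H_D` in the basis `{g xʲ}`, found by letting it act on `1` in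
the left regular representation. -/
noncomputable def coord : D.HD →ₗ[k] D.BasisSpace :=
  LinearMap.applyₗ (Finsupp.single ((1 : G), (0 : Fin D.n)) (1 : k)) ∘ₗ
    (D.lift D.reg_satisfies).toLinearMap

theorem coord_grp_mul_x_pow (g : G) (j : Fin D.n) :
    D.coord (D.grp g * D.x ^ (j : ℕ)) = Finsupp.single (g, j) 1 := by
  have := D.regX_pow_of_lt 1 j 0 (by simp)
  have z : (⟨0, D.n_pos⟩ : Fin D.n) = 0 := rfl
  simp only [z, zero_add, map_one, Units.val_one, one_pow, one_smul] at this
  simp [coord, lift_grp, lift_x, this, regGrp_single]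

/-- `ξ ∈ H_D*`: `ξ(g xʲ) = 1` if `j = 1`, and `0` for the other `0 ≤ j ≤ n - 1`. -/
noncomputable def xiFun : Module.Dual k D.HD :=
  (Finsupp.linearCombination k fun p : G × Fin D.n => if p.2.val = 1 then (1 : k) else 0) ∘ₗ D.coord

/-- A character `γ` of `G` as an element of `H_D*`: `γ(g xʲ) = γ(g)` if `j = 0`, and `0` for the
other `0 ≤ j ≤ n - 1`. -/
noncomputable def charFun (γ : G →* kˣ) : Module.Dual k D.HD :=
  (Finsupp.linearCombination k fun p : G × Fin D.n =>
    if p.2.val = 0 then (γ p.1 : k) else 0) ∘ₗ D.coord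

theorem xiFun_apply (g : G) (j : Fin D.n) :
    D.xiFun (D.grp g * D.x ^ (j : ℕ)) = if j.val = 1 then 1 else 0 := by
  simp [xiFun, coord_grp_mul_x_pow]

theorem charFun_apply (γ : G →* kˣ) (g : G) (j : Fin D.n) :
    D.charFun γ (D.grp g * D.x ^ (j : ℕ)) = if j.val = 0 then (γ g : k) else 0 := by
  simp [charFun, coord_grp_mul_x_pow]

/-! ### Weights and simple modules of `D(H_D)` -/

/-- `D(H_D)`. -/
abbrev Double : Type _ := DrinfeldDouble k D.HD

/-- `g ∈ D(H_D)`. -/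
noncomputable def dGrp (g : G) : D.Double := DrinfeldDouble.ofAlg k D.HD (D.grp g)

/-- `x ∈ D(H_D)`. -/
noncomputable def dX : D.Double := DrinfeldDouble.ofAlg k D.HD D.x

/-- `γ ∈ D(H_D)`. -/
noncomputable def dChar (γ : G →* kˣ) : D.Double := DrinfeldDouble.ofDual k D.HD (D.charFun γ)

/-- `ξ ∈ D(H_D)`. -/
noncomputable def dXi : D.Double := DrinfeldDouble.ofDual k D.HD D.xiFun

end Finite

section Weights

variable {k G : Type*} [Field k] [Group G]

/-- `Λ`: the characters of `G × Γ`, where `Γ = Hom(G, kˣ)`. -/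
abbrev Weight (k G : Type*) [Field k] [Group G] : Type _ := G × (G →* kˣ) →* kˣ

variable (D : GroupDatum k G)

/-- The weight `φ = χ⁻¹ â`, i.e. `φ(g, γ) = χ(g)⁻¹ γ(a)`. -/
def φ : Weight k G where
  toFun p := (D.χ p.1)⁻¹ * p.2 D.a
  map_one' := by simp
  map_mul' p q := by
    simp only [Prod.fst_mul, Prod.snd_mul, map_mul, mul_inv, MonoidHom.mul_apply]
    exact mul_mul_mul_comm _ _ _ _

/-- `Λ̃`: the weights with `λ(a χ⁻¹) = ρˢ` for some `0 ≤ s ≤ n - 2`. -/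
def tildeΛ : Set (Weight k G) := {lam | ∃ s : ℕ, s + 2 ≤ D.n ∧ lam (D.a, D.χ⁻¹) = D.ρ ^ s}

/-- `I_l` for `1 ≤ l ≤ n - 1`. -/
def I (l : ℕ) : Set (Weight k G) := {lam | lam ∈ D.tildeΛ ∧ lam (D.a, D.χ⁻¹) = D.ρ ^ (l - 1)}

/-- `(i)_ρ = 1 + ρ + ⋯ + ρⁱ⁻¹`. -/
def qNum (i : ℕ) : k := ∑ j ∈ Finset.range i, (D.ρ : k) ^ j

/-- `(i)!_ρ = (i)_ρ (i-1)_ρ ⋯ (1)_ρ`. -/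
def qFactorial (i : ℕ) : k := ∏ j ∈ Finset.range i, D.qNum (j + 1)

/-- `α_i(l, λ) = (i)_ρ (λ(χ) - λ(a) ρ¹⁻ⁱ)`; it does not depend on `l`. -/
def alphaCoeff (i : ℕ) (lam : Weight k G) : k :=
  D.qNum i * ((lam (1, D.χ) : k) - (lam (D.a, 1) : k) * (D.ρ : k) ^ (1 - (i : ℤ)))

/-- `σ(λ) = λ φ^(d(λ) + 1)`, which is `λ φˡ` for `λ ∈ I_l`. -/
def σ (l : ℕ) (lam : Weight k G) : Weight k G := lam * D.φ ^ l

/-- `σ⁻¹(λ)`, which is `λ φˡ⁻ⁿ` for `λ ∈ I_l`. -/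
noncomputable def σInv (l : ℕ) (lam : Weight k G) : Weight k G :=
  lam * D.φ ^ ((l : ℤ) - (D.n : ℤ))

end Weights

section Modules

variable {k G : Type*} [Field k] [Group G] [Finite G] (D : GroupDatum k G)

/-- The left ideal of `D(H_D)` generated by the annihilator of `1_λ` in the subalgebra generated by
`H_D*` and `G`, i.e. by all `g γ - λ(g, γ)` and by `ξ`. -/
noncomputable def vermaIdeal (lam : Weight k G) : Submodule D.Double D.Double :=
  Submodule.span D.Double
    ({y | ∃ (g : G) (γ : G →* kˣ),
      y = D.dGrp g * D.dChar γ - algebraMap k D.Double (lam (g, γ))} ∪ {D.dXi})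

/-- `Z(λ)`, the `D(H_D)`-module induced from the one-dimensional module `k_λ`. -/
abbrev Z (lam : Weight k G) : Type _ := D.Double ⧸ D.vermaIdeal lam

/-- The simple module `L(λ) = Z(λ) / rad Z(λ)`, called `V(l, λ)` for `λ ∈ I_l`. -/
abbrev L (lam : Weight k G) : Type _ := D.Z lam ⧸ Module.jacobson D.Double (D.Z lam)

/-! ### The module `P(l, λ)` -/

/-- The `2n`-dimensional vector space with basis `v_0, …, v_{n-1}, u_0, …, u_{n-1}`. -/
abbrev PSpace : Type _ := (Fin D.n ⊕ Fin D.n) →₀ k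

/-- `v_i`, for `0 ≤ i ≤ n - 1`. -/
noncomputable def v (i : ℕ) : D.PSpace :=
  if h : i < D.n then Finsupp.single (Sum.inl ⟨i, h⟩) 1 else 0

/-- `u_i`, for `0 ≤ i ≤ n - 1`. -/
noncomputable def u (i : ℕ) : D.PSpace :=
  if h : i < D.n then Finsupp.single (Sum.inr ⟨i, h⟩) 1 else 0

/-- The linear operator with `v_i ↦ fv i` and `u_i ↦ fu i` for `0 ≤ i ≤ n - 1`. -/
noncomputable def basisOp (fv fu : ℕ → D.PSpace) : Module.End k D.PSpace :=
  Finsupp.linearCombination k (Sum.elim (fun i => fv i) (fun i => fu i))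

/-- Nilpotent type: the action of `g γ`. -/
noncomputable def nilGrp (l : ℕ) (lam : Weight k G) (g : G) (γ : G →* kˣ) :
    Module.End k D.PSpace :=
  D.basisOp
    (fun i => ((D.φ ^ i * lam) (g, γ) : k) • D.v i)
    (fun i => ((D.φ ^ ((i : ℤ) - D.n + l) * lam) (g, γ) : k) • D.u i)

/-- Nilpotent type: the action of `x`. -/
noncomputable def nilX : Module.End k D.PSpace :=
  D.basisOp
    (fun i => if i + 1 < D.n then D.v (i + 1) else 0)
    (fun i => if i + 1 < D.n then D.u (i + 1) else 0)

/-- Nilpotent type: the action of `ξ`. -/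
noncomputable def nilXi (l : ℕ) (lam : Weight k G) : Module.End k D.PSpace :=
  D.basisOp
    (fun i =>
      if i = 0 then D.u (D.n - l - 1)
      else if i < l then D.alphaCoeff i lam • D.v (i - 1) + D.u (D.n - l + i - 1)
      else if i = l then D.u (D.n - 1)
      else D.alphaCoeff (i - l) (D.σ l lam) • D.v (i - 1))
    (fun i =>
      if i = 0 then 0
      else if i < D.n - l then D.alphaCoeff i (D.σInv l lam) • D.u (i - 1)
      else if i = D.n - l then 0
      else D.alphaCoeff (i - (D.n - l)) lam • D.u (i - 1))

/-- Non-nilpotent type: the action of `g γ`. -/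
noncomputable def nonnilGrp (l : ℕ) (lam : Weight k G) (g : G) (γ : G →* kˣ) :
    Module.End k D.PSpace :=
  D.basisOp
    (fun i => ((D.φ ^ ((i : ℤ) - D.n + l) * lam) (g, γ) : k) • D.v i)
    (fun i => ((D.φ ^ i * lam) (g, γ) : k) • D.u i)

/-- `y_{l,λ} = (ρ¹⁻ˡ λ(a) - ρˡ λ(χ)) / (n-1)!_ρ`. -/
noncomputable def yCoeff (l : ℕ) (lam : Weight k G) : k :=
  ((D.ρ : k) ^ (1 - (l : ℤ)) * (lam (D.a, 1) : k) - (D.ρ : k) ^ l * (lam (1, D.χ) : k)) /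
    D.qFactorial (D.n - 1)

/-- `z_{l,λ} = (ρ λ(a) - λ(χ)) / (n-1)!_ρ`. -/
noncomputable def zCoeff (lam : Weight k G) : k :=
  ((D.ρ : k) * (lam (D.a, 1) : k) - (lam (1, D.χ) : k)) / D.qFactorial (D.n - 1)

/-- Non-nilpotent type: the action of `x`. -/
noncomputable def nonnilX (l : ℕ) (lam : Weight k G) : Module.End k D.PSpace :=
  D.basisOp
    (fun i =>
      if i + 1 < D.n - l then D.alphaCoeff (i + 1) (D.σInv l lam) • D.v (i + 1)
      else if i + 1 = D.n - l then D.u 0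
      else if i + 1 < D.n then
        D.alphaCoeff (i + 1 - (D.n - l)) lam • D.v (i + 1) + D.u (i + 1 - (D.n - l))
      else D.yCoeff l lam • D.v 0 + D.u l)
    (fun i =>
      if i + 1 < l then D.alphaCoeff (i + 1) lam • D.u (i + 1)
      else if i + 1 = l then 0
      else if i + 1 < D.n then D.alphaCoeff (i + 1 - l) (D.σ l lam) • D.u (i + 1)
      else D.zCoeff lam • D.u 0)

/-- Non-nilpotent type: the action of `ξ`. -/
noncomputable def nonnilXi : Module.End k D.PSpace :=
  D.basisOp
    (fun i => if i = 0 then 0 else D.v (i - 1))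
    (fun i => if i = 0 then 0 else D.u (i - 1))

/-- `Φ` is the action of `D(H_D)` that defines the module `P(l, λ)`: the elements `g γ`, `x` and `ξ`
act on the basis `v_0, …, v_{n-1}, u_0, …, u_{n-1}` by the formulas for the type of the datum. -/
structure IsActionP (l : ℕ) (lam : Weight k G) (Φ : D.Double →ₐ[k] Module.End k D.PSpace) :
    Prop where
  nil_grp : D.IsNilpotent → ∀ g γ, Φ (D.dGrp g * D.dChar γ) = D.nilGrp l lam g γ
  nil_x : D.IsNilpotent → Φ D.dX = D.nilX
  nil_xi : D.IsNilpotent → Φ D.dXi = D.nilXi l lam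
  nonnil_grp : ¬ D.IsNilpotent → ∀ g γ, Φ (D.dGrp g * D.dChar γ) = D.nonnilGrp l lam g γ
  nonnil_x : ¬ D.IsNilpotent → Φ D.dX = D.nonnilX l lam
  nonnil_xi : ¬ D.IsNilpotent → Φ D.dXi = D.nonnilXi

end Modules

end GroupDatum

/-! ### The universal property of the Drinfeld double -/

namespace DrinfeldDouble

variable {k H : Type*} [Field k] [Ring H] [Bialgebra k H]

/-! The module P(l, λ) represents an exact functor, and everything except the existence of the
action is read off from this.

Let m be a vector of weight λφᵉ in a D(H_D)-module, and T = xξ. Then Tm has the same weight, and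
moving x past powers of ξ gives x ξʲ⁺¹ m = ξʲ (T - c_j) m with explicit scalars c_j
(`X_Y_pow_apply`, `descCoeff`). Hence ∏_{j<n} (T - c_j) = xⁿ ξⁿ = 0 on the weight space
(`aeval_prod_eq_zero`). Take e = 0, c = 0 in nilpotent type and e = l - 1, c = `topCoeff` otherwise.
Then exactly two of the c_j equal c, so the vectors of weight λφᵉ killed by (T - c)² (`genSpace`)
are cut out by a weight projection followed by a polynomial in T.

Put w = v_0, respectively w = v_{n-1}. Every m in `genSpace` is the image of w under a homomorphism
from P(l, λ) (`exists_intertwines_of_nil`, `exists_intertwines_of_nonnil`). The images of the other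
basis vectors are dictated by the formulas of the action; the relations they must satisfy follow
from the vanishing lemmas `pow_eq_zero_of_descent` and `pow_sub_eq_zero_of_descent`, because c_j ≠ c
for all other j.

Applied to D(H_D) itself, this gives a map P(l, λ) → D(H_D) that splits d ↦ d w, so P(l, λ) is
projective. Applied to Z(λ), it gives a surjection onto Z(λ), hence onto L(λ) ≠ 0. The vectors of
weight λφᵉ in P(l, λ) are spanned by w and (T - c) w, and any of them with a nonzero w-coefficient
generates the module; so the kernel of a surjection onto a nonzero module is superfluous. Uniqueness
of projective covers is the general argument.

The action exists because D(H_D) has a presentation by G, x, ξ and the functions on G (`DoubleData`,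
`DoubleData.toHom`), whose relations can be checked on basis vectors. Functions replace Γ because
the characters of G span them; dually, λ restricted to Γ is evaluation at some b ∈ G, so a weight
vector has an eigenvalue for each g ∈ G and a degree in G. In non-nilpotent type x respects this
degree only up to a multiple of ξⁿ⁻¹, which is the origin of the constants y and z. -/

theorem quotMap_rel {u v : Pre k H} (h : Rel k H u v) : quotMap k H u = quotMap k H v :=
  RingQuot.mkAlgHom_rel k h

theorem quotMap_surjective : Function.Surjective (quotMap k H) :=
  RingQuot.mkAlgHom_surjective k _

theorem ofDual_counit : ofDual k H Coalgebra.counit = 1 := by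
  simpa [ofDual] using quotMap_rel (Rel.one_dual (k := k) (H := H))

theorem ofDual_conv (p q : Module.Dual k H) :
    ofDual k H (conv k H p q) = ofDual k H p * ofDual k H q := by
  simpa [ofDual] using quotMap_rel (Rel.mul_dual p q)

theorem ofAlg_one : ofAlg k H 1 = 1 := by
  simpa [ofAlg] using quotMap_rel (Rel.one_alg (k := k) (H := H))

theorem ofAlg_mul (h h' : H) : ofAlg k H (h * h') = ofAlg k H h * ofAlg k H h' := by
  simpa [ofAlg] using quotMap_rel (Rel.mul_alg h h')

variable (k H) in
/-- The canonical map `H → D(H)` as an algebra homomorphism. -/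
noncomputable def ofAlgHom : H →ₐ[k] DrinfeldDouble k H :=
  AlgHom.ofLinearMap (ofAlg k H) ofAlg_one ofAlg_mul

/-- The maps `f : H → B` and `F : H* → B` satisfy the cross relation of `D(H)` for `p` and `h`. -/
def Crossed {B : Type*} [Ring B] [Algebra k B] (f : H →ₗ[k] B) (F : Module.Dual k H →ₗ[k] B)
    (p : Module.Dual k H) (h : H) : Prop :=
  (LinearMap.mul' k B ∘ₗ TensorProduct.map f (F ∘ₗ rightHit k H p)) (Coalgebra.comul h) =
    (LinearMap.mul' k B ∘ₗ TensorProduct.map (F ∘ₗ leftHit k H p) f) (Coalgebra.comul h)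

theorem crossed_ofAlg_ofDual (p : Module.Dual k H) (h : H) :
    Crossed (ofAlg k H) (ofDual k H) p h := by
  have key : ∀ (f g : H →ₗ[k] Pre k H) (t : H ⊗[k] H),
      quotMap k H ((LinearMap.mul' k (Pre k H) ∘ₗ TensorProduct.map f g) t) =
      (LinearMap.mul' k (DrinfeldDouble k H) ∘ₗ
        TensorProduct.map ((quotMap k H).toLinearMap ∘ₗ f) ((quotMap k H).toLinearMap ∘ₗ g)) t := by
    intro f g t
    induction t with
    | zero => simp
    | tmul x y => simp
    | add x y hx hy => simp only [map_add, hx, hy]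
  have h1 := quotMap_rel (Rel.cross p h)
  rw [key, key] at h1
  exact h1

section lift

variable {B : Type*} [Ring B] [Algebra k B] (f : H →ₐ[k] B) (F : Module.Dual k H →ₗ[k] B)

/-- The two hit actions are commuting module structures on H*, so p can be moved past h' and then
past h. The cross relation therefore needs to be known only for generators of H. -/
theorem Crossed.mul {h h' : H} (hh : ∀ p, Crossed f.toLinearMap F p h)
    (hh' : ∀ p, Crossed f.toLinearMap F p h') (p : Module.Dual k H) :
    Crossed f.toLinearMap F p (h * h') := by
  have e := (Coalgebra.Repr.arbitrary k h).eq
  have e' := (Coalgebra.Repr.arbitrary k h').eq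
  set R := Coalgebra.Repr.arbitrary k h
  set R' := Coalgebra.Repr.arbitrary k h'
  have c : ∀ p, ∑ i ∈ R.index, f (R.left i) * F (rightHit k H p (R.right i)) =
      ∑ i ∈ R.index, F (leftHit k H p (R.left i)) * f (R.right i) := by
    intro p
    simpa [Crossed, ← e] using hh p
  have c' : ∀ p, ∑ i ∈ R'.index, f (R'.left i) * F (rightHit k H p (R'.right i)) =
      ∑ i ∈ R'.index, F (leftHit k H p (R'.left i)) * f (R'.right i) := by
    intro p
    simpa [Crossed, ← e'] using hh' p
  have r : ∀ p a b, rightHit k H p (a * b) = rightHit k H (rightHit k H p a) b := by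
    intro p a b
    ext y
    simp [rightHit, mul_assoc]
  have l : ∀ p a b, leftHit k H p (a * b) = leftHit k H (leftHit k H p b) a := by
    intro p a b
    ext y
    simp [leftHit, mul_assoc]
  have lr : ∀ p a b, leftHit k H (rightHit k H p a) b = rightHit k H (leftHit k H p b) a := by
    intro p a b
    ext y
    simp [leftHit, rightHit, mul_assoc]
  unfold Crossed
  rw [Bialgebra.comul_mul, ← e, ← e']
  simp only [Finset.sum_mul_sum, map_sum, Algebra.TensorProduct.tmul_mul_tmul,
    LinearMap.comp_apply, TensorProduct.map_tmul, LinearMap.mul'_apply, AlgHom.toLinearMap_apply,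
    map_mul, r, l]
  -- First h' is moved across p ↼ h₂, then h across h'₁ ⇀ p; between the two moves the left and
  -- right hits are interchanged.
  calc _ = ∑ i ∈ R.index, f (R.left i) *
        ∑ j ∈ R'.index, f (R'.left j) *
          F (rightHit k H (rightHit k H p (R.right i)) (R'.right j)) := by
        simp only [Finset.mul_sum, mul_assoc]
    _ = ∑ j ∈ R'.index, (∑ i ∈ R.index, f (R.left i) *
          F (rightHit k H (leftHit k H p (R'.left j)) (R.right i))) * f (R'.right j) := by
        simp only [c', lr, Finset.mul_sum, Finset.sum_mul, ← mul_assoc]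
        rw [Finset.sum_comm]
    _ = _ := by
        simp only [c, Finset.sum_mul, mul_assoc]
        rw [Finset.sum_comm]

theorem Crossed.add {h h' : H} {p : Module.Dual k H} (hh : Crossed f.toLinearMap F p h)
    (hh' : Crossed f.toLinearMap F p h') : Crossed f.toLinearMap F p (h + h') := by
  unfold Crossed at *
  simp only [map_add, hh, hh']

theorem crossed_algebraMap (r : k) (p : Module.Dual k H) :
    Crossed f.toLinearMap F p (algebraMap k H r) := by
  have l1 : leftHit k H p 1 = p := by ext; simp [leftHit]
  have r1 : rightHit k H p 1 = p := by ext; simp [rightHit]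
  rw [Algebra.algebraMap_eq_smul_one]
  simp [Crossed, Algebra.TensorProduct.one_def, l1, r1]

variable (h1 : F Coalgebra.counit = 1) (hmul : ∀ p q, F (conv k H p q) = F p * F q)
  (hc : ∀ p h, Crossed f.toLinearMap F p h)

/-- The algebra map `D(H) → B` that restricts to `f` on `H` and to `F` on `H*`. -/
noncomputable def lift : DrinfeldDouble k H →ₐ[k] B :=
  RingQuot.liftAlgHom k ⟨TensorAlgebra.lift k (LinearMap.coprod F f.toLinearMap), by
    have key : ∀ (u v : H →ₗ[k] Pre k H) (t : H ⊗[k] H),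
        TensorAlgebra.lift k (LinearMap.coprod F f.toLinearMap)
          ((LinearMap.mul' k (Pre k H) ∘ₗ TensorProduct.map u v) t) =
        (LinearMap.mul' k B ∘ₗ TensorProduct.map
          ((TensorAlgebra.lift k (LinearMap.coprod F f.toLinearMap)).toLinearMap ∘ₗ u)
          ((TensorAlgebra.lift k (LinearMap.coprod F f.toLinearMap)).toLinearMap ∘ₗ v)) t := by
      intro u v t
      induction t with
      | zero => simp
      | tmul x y => simp
      | add x y hx hy => simp only [map_add, hx, hy]
    have ef : (TensorAlgebra.lift k (LinearMap.coprod F f.toLinearMap)).toLinearMap ∘ₗ preAlg k H =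
        f.toLinearMap := by
      ext; simp [preAlg]
    have eF : (TensorAlgebra.lift k (LinearMap.coprod F f.toLinearMap)).toLinearMap ∘ₗ
        preDual k H = F := by
      apply LinearMap.ext; simp [preDual]
    intro u v huv
    cases huv with
    | one_dual => simpa [preDual] using h1
    | mul_dual p q => simpa [preDual] using hmul p q
    | one_alg => simp [preAlg]
    | mul_alg h h' => simp [preAlg]
    | cross p h =>
      rw [key, key, ← LinearMap.comp_assoc, ← LinearMap.comp_assoc, ef, eF]
      exact hc p h⟩

theorem lift_ofAlg (h : H) : lift f F h1 hmul hc (ofAlg k H h) = f h := by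
  refine (RingQuot.liftAlgHom_mkAlgHom_apply k (B := B) _ _ _).trans ?_
  simp [preAlg]

theorem lift_ofDual (p : Module.Dual k H) : lift f F h1 hmul hc (ofDual k H p) = F p := by
  refine (RingQuot.liftAlgHom_mkAlgHom_apply k (B := B) _ _ _).trans ?_
  simp [preDual]

end lift

theorem subalgebra_eq_top {S : Subalgebra k (DrinfeldDouble k H)} (ha : ∀ h, ofAlg k H h ∈ S)
    (hd : ∀ p, ofDual k H p ∈ S) : S = ⊤ := by
  rw [eq_top_iff]
  rintro z -
  obtain ⟨t, rfl⟩ := quotMap_surjective z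
  have ht : t ∈ Algebra.adjoin k (Set.range (TensorAlgebra.ι k (M := Module.Dual k H × H))) := by
    rw [TensorAlgebra.adjoin_range_ι]
    trivial
  have hle : Algebra.adjoin k (Set.range (TensorAlgebra.ι k (M := Module.Dual k H × H))) ≤
      S.comap (quotMap k H) := by
    rw [Algebra.adjoin_le_iff]
    rintro _ ⟨⟨p, h⟩, rfl⟩
    have e : TensorAlgebra.ι k (p, h) = preDual k H p + preAlg k H h := by
      simp [preDual, preAlg, ← map_add]
    change quotMap k H _ ∈ S
    rw [e, map_add]
    exact S.add_mem (hd p) (ha h)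
  exact hle ht

end DrinfeldDouble

/-! ### The basis of `H_D` -/

/-- Kept free of division. In the q-Pascal recursion, (i+1+j+1)_q = (i+1)_q + qⁱ⁺¹ (j+1)_q supplies
one summand to each of the two induction hypotheses. -/
theorem gaussBinom_mul_qFactorial {R : Type*} [CommRing R] (q : R) (i j : ℕ) :
    gaussBinom q (i + j) i * ((∏ s ∈ Finset.range i, ∑ r ∈ Finset.range (s + 1), q ^ r) *
      ∏ s ∈ Finset.range j, ∑ r ∈ Finset.range (s + 1), q ^ r) =
      ∏ s ∈ Finset.range (i + j), ∑ r ∈ Finset.range (s + 1), q ^ r := by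
  have hz : ∀ m, gaussBinom q m 0 = 1 := fun m => by cases m <;> rfl
  have split : ∀ i j : ℕ, ∑ r ∈ Finset.range (i + j), q ^ r =
      ∑ r ∈ Finset.range i, q ^ r + q ^ i * ∑ r ∈ Finset.range j, q ^ r := by
    intro i j
    simp [Finset.sum_range_add, pow_add, Finset.mul_sum]
  induction i generalizing j with
  | zero => simp [hz]
  | succ i ihi =>
    induction j with
    | zero => simp [gaussBinom_self]
    | succ j ihj =>
      have e1 := ihi (j + 1)
      have e2 : i + 1 + (j + 1) = (i + (j + 1)) + 1 := by ring
      have e3 : i + 1 + j = i + (j + 1) := by ring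
      rw [e2, Finset.prod_range_succ _ (i + (j + 1)), gaussBinom]
      rw [e3] at ihj
      have s := split (i + 1) (j + 1)
      rw [e2] at s
      rw [s, Finset.prod_range_succ _ i, Finset.prod_range_succ _ j]
      rw [Finset.prod_range_succ _ j] at e1
      rw [Finset.prod_range_succ _ i] at ihj
      linear_combination (∑ r ∈ Finset.range (i + 1), q ^ r) * e1 +
        q ^ (i + 1) * (∑ r ∈ Finset.range (j + 1), q ^ r) * ihj

namespace GroupDatum

section Hopf

variable {k G : Type*} [Field k] [CommGroup G] [Finite G] (D : GroupDatum k G)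

theorem grp_pow (g : G) (m : ℕ) : D.grp g ^ m = D.grp (g ^ m) := by
  induction m with
  | zero => simp [grp_one]
  | succ m ih => rw [pow_succ, pow_succ, grp_mul, ih]

theorem x_pow_grp (m : ℕ) (g : G) :
    D.x ^ m * D.grp g = (D.χ g : k) ^ m • (D.grp g * D.x ^ m) := by
  induction m with
  | zero => simp
  | succ m ih =>
    rw [pow_succ', mul_assoc, ih, mul_smul_comm, ← mul_assoc, x_grp, smul_mul_assoc, smul_smul,
      mul_assoc, pow_succ]

theorem comul_apply (h : D.HD) : Coalgebra.comul (R := k) h = D.comulHom h := rfl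

theorem counit_apply (h : D.HD) : Coalgebra.counit (R := k) h = D.counitHom h := rfl

theorem comul_grp_mul_x_pow (g : G) (m : ℕ) :
    Coalgebra.comul (R := k) (D.grp g * D.x ^ m) = ∑ i ∈ Finset.range (m + 1),
      gaussBinom (D.ρ : k) m i •
        ((D.grp g * D.x ^ i) ⊗ₜ[k] (D.grp (g * D.a ^ i) * D.x ^ (m - i))) := by
  have hq : ((1 : D.HD) ⊗ₜ[k] D.x) * (D.x ⊗ₜ[k] D.grp D.a) =
      (D.ρ : k) • ((D.x ⊗ₜ[k] D.grp D.a) * ((1 : D.HD) ⊗ₜ[k] D.x)) := by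
    simp [x_grp, ρ]
  rw [comul_apply, map_mul, map_pow, comulHom_grp, comulHom_x, add_pow_of_qcomm _ _ _ hq,
    Finset.mul_sum]
  refine Finset.sum_congr rfl fun i _ => ?_
  simp [Algebra.TensorProduct.tmul_pow, grp_mul, grp_pow, mul_assoc]

/-- A subspace of `H_D` that contains `1` and is stable under left multiplication by `G` and `x` is
everything. -/
theorem submodule_eq_top {S : Submodule k D.HD} (h1 : 1 ∈ S) (hg : ∀ g, ∀ s ∈ S, D.grp g * s ∈ S)
    (hx : ∀ s ∈ S, D.x * s ∈ S) : S = ⊤ := by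
  -- The elements preserving S under left multiplication form a subalgebra. The presentation maps
  -- H_D into it, and composing with the inclusion gives the identity, so the subalgebra is all of
  -- H_D.
  let A : Subalgebra k D.HD :=
    { carrier := {h | ∀ s ∈ S, h * s ∈ S}
      mul_mem' := fun {a b} ha hb s hs => by
        rw [mul_assoc]
        exact ha _ (hb _ hs)
      add_mem' := fun {a b} ha hb s hs => by
        rw [add_mul]
        exact S.add_mem (ha _ hs) (hb _ hs)
      algebraMap_mem' := fun r s hs => by
        rw [← Algebra.smul_def]
        exact S.smul_mem _ hs }
  have sat : D.Satisfies (B := A) (fun g => ⟨D.grp g, hg g⟩) ⟨D.x, hx⟩ :=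
    { one := Subtype.ext D.grp_one
      mul := fun g h => Subtype.ext (D.grp_mul g h)
      pow := Subtype.ext D.x_pow
      comm := fun g => Subtype.ext (D.x_grp g) }
  have e : A.val.comp (D.lift sat) = AlgHom.id k D.HD := by
    apply D.hom_ext
    · intro g
      simp [lift_grp]
    · simp [lift_x]
  rw [eq_top_iff]
  rintro h -
  have h2 : h = (D.lift sat h : D.HD) := (DFunLike.congr_fun e h).symm
  have h3 := (D.lift sat h).2 1 h1
  rwa [← h2, mul_one] at h3

theorem span_grp_mul_x_pow :
    Submodule.span k (Set.range fun p : G × Fin D.n => D.grp p.1 * D.x ^ (p.2 : ℕ)) = ⊤ := by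
  have mem : ∀ g (j : ℕ), j < D.n → D.grp g * D.x ^ j ∈
      Submodule.span k (Set.range fun p : G × Fin D.n => D.grp p.1 * D.x ^ (p.2 : ℕ)) :=
    fun g j hj => Submodule.subset_span ⟨(g, ⟨j, hj⟩), rfl⟩
  apply D.submodule_eq_top
  · simpa [grp_one] using mem 1 0 D.n_pos
  · intro g s hs
    induction hs using Submodule.span_induction with
    | mem s hs =>
      obtain ⟨⟨h, j⟩, rfl⟩ := hs
      have := mem (g * h) j j.2
      rwa [grp_mul, mul_assoc] at this
    | zero => simp
    | add s t _ _ hs ht => rw [mul_add]; exact Submodule.add_mem _ hs ht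
    | smul r s _ hs => rw [mul_smul_comm]; exact Submodule.smul_mem _ _ hs
  · intro s hs
    induction hs using Submodule.span_induction with
    | mem s hs =>
      obtain ⟨⟨h, j, hj⟩, rfl⟩ := hs
      simp only
      rw [← mul_assoc, x_grp, smul_mul_assoc, mul_assoc, ← pow_succ']
      refine Submodule.smul_mem _ _ ?_
      by_cases hj' : j + 1 < D.n
      · exact mem h _ hj'
      · rw [show j + 1 = D.n by omega, x_pow, mul_smul_comm, mul_sub, ← grp_mul, mul_one]
        refine Submodule.smul_mem _ _ (Submodule.sub_mem _ ?_ ?_)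
        · simpa using mem (h * D.a ^ D.n) 0 D.n_pos
        · simpa using mem h 0 D.n_pos
    | zero => simp
    | add s t _ _ hs ht => rw [mul_add]; exact Submodule.add_mem _ hs ht
    | smul r s _ hs => rw [mul_smul_comm]; exact Submodule.smul_mem _ _ hs

theorem linearMap_ext {M : Type*} [AddCommGroup M] [Module k M] {f f' : D.HD →ₗ[k] M}
    (h : ∀ g (j : ℕ), j < D.n → f (D.grp g * D.x ^ j) = f' (D.grp g * D.x ^ j)) : f = f' := by
  apply LinearMap.ext_on_range D.span_grp_mul_x_pow
  rintro ⟨g, j⟩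
  exact h g j j.2

theorem conv_grp_mul_x_pow (p q : Module.Dual k D.HD) (g : G) (m : ℕ) :
    DrinfeldDouble.conv k D.HD p q (D.grp g * D.x ^ m) = ∑ i ∈ Finset.range (m + 1),
      gaussBinom (D.ρ : k) m i *
        (p (D.grp g * D.x ^ i) * q (D.grp (g * D.a ^ i) * D.x ^ (m - i))) := by
  rw [DrinfeldDouble.conv, LinearMap.comp_apply, LinearMap.comp_apply, comul_grp_mul_x_pow]
  simp

theorem qFactorial_succ (i : ℕ) : D.qFactorial (i + 1) = D.qFactorial i * D.qNum (i + 1) :=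
  Finset.prod_range_succ _ _

theorem gaussBinom_mul_factorial (i j : ℕ) :
    gaussBinom (D.ρ : k) (i + j) i * (D.qFactorial i * D.qFactorial j) = D.qFactorial (i + j) :=
  gaussBinom_mul_qFactorial _ _ _

theorem qNum_mul_sub_one (i : ℕ) : D.qNum i * ((D.ρ : k) - 1) = (D.ρ : k) ^ i - 1 :=
  geom_sum_mul _ _

theorem rho_pow_eq_one_iff (i : ℕ) : (D.ρ : k) ^ i = 1 ↔ D.n ∣ i := by
  rw [n, orderOf_dvd_iff_pow_eq_one, ← Units.val_pow_eq_pow_val, Units.val_eq_one]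

theorem rho_pow_n : (D.ρ : k) ^ D.n = 1 := (D.rho_pow_eq_one_iff _).2 dvd_rfl

theorem qNum_ne_zero {i : ℕ} (h0 : 0 < i) (hi : i < D.n) : D.qNum i ≠ 0 := by
  intro h
  have := D.qNum_mul_sub_one i
  rw [h, zero_mul, eq_comm, sub_eq_zero, rho_pow_eq_one_iff] at this
  exact absurd (Nat.le_of_dvd h0 this) (by omega)

theorem qFactorial_ne_zero {i : ℕ} (hi : i < D.n) : D.qFactorial i ≠ 0 := by
  rw [qFactorial, Finset.prod_ne_zero_iff]
  intro j hj
  have := Finset.mem_range.1 hj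
  exact D.qNum_ne_zero (by omega) (by omega)

theorem qNum_n (hn : 1 < D.n) : D.qNum D.n = 0 := by
  have h := D.qNum_mul_sub_one D.n
  rw [rho_pow_n, sub_self, mul_eq_zero, sub_eq_zero] at h
  refine h.resolve_right fun h1 => ?_
  have := (D.rho_pow_eq_one_iff 1).1 (by simpa using h1)
  have := Nat.le_of_dvd one_pos this
  omega

end Hopf

end GroupDatum

/-! ### A presentation of `D(H_D)` -/

/-- The commutators picked up at each X add to a geometric sum, since S and T commute with X up to
inverse powers of q. It is applied to (X, Y) = (x, ξ) and to (ξ, x); for q = ρ the sum with n terms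
vanishes. -/
theorem mul_pow_of_commutator {k B : Type*} [Field k] [Ring B] [Algebra k B] {q : k} (hq : q ≠ 0)
    {X Y S T : B} (h : Y * X = X * Y + (S - T)) (hS : S * X = q • (X * S))
    (hT : T * X = q⁻¹ • (X * T)) (j : ℕ) :
    Y * X ^ (j + 1) = X ^ (j + 1) * Y +
      (∑ r ∈ Finset.range (j + 1), q ^ r) • (X ^ j * (S - (q ^ j)⁻¹ • T)) := by
  induction j with
  | zero => simpa using h
  | succ j ih =>
    have s1 := Finset.sum_range_succ (fun r => q ^ r) (j + 1)
    have s2 : ∑ r ∈ Finset.range (j + 1 + 1), q ^ r =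
        1 + q * ∑ r ∈ Finset.range (j + 1), q ^ r := by
      rw [Finset.sum_range_succ', Finset.mul_sum]
      simp [pow_succ', add_comm]
    have s3 : (∑ r ∈ Finset.range (j + 1 + 1), q ^ r) * (q ^ (j + 1))⁻¹ =
        1 + (∑ r ∈ Finset.range (j + 1), q ^ r) * ((q ^ j)⁻¹ * q⁻¹) := by
      rw [s1, add_mul, mul_inv_cancel₀ (pow_ne_zero _ hq), add_comm, pow_succ, mul_inv]
    rw [pow_succ X (j + 1), ← mul_assoc, ih, add_mul, mul_assoc, h, mul_add, smul_mul_assoc,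
      mul_assoc, sub_mul, hS, smul_mul_assoc, hT, smul_smul]
    simp only [mul_sub, smul_sub, mul_smul_comm, smul_smul, ← mul_assoc, ← pow_succ]
    rw [s3, s2]
    module

namespace GroupDatum

section Presentation

variable {k G : Type*} [Field k] [CommGroup G] [Finite G] (D : GroupDatum k G)

/-- Elements of an algebra `B` that satisfy the defining relations of `D(H_D)`: `K g` stands for
`g`, `X` for `x`, `Y` for `ξ`, and `C f` for the functional `g xʲ ↦ δ_{j,0} f(g)`. -/
structure DoubleData (B : Type*) [Ring B] [Algebra k B] where
  K : G → B
  X : B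
  Y : B
  C : (G → k) →ₐ[k] B
  sat : D.Satisfies K X
  K_C : ∀ g f, K g * C f = C f * K g
  K_Y : ∀ g, K g * Y = (D.χ g : k) • (Y * K g)
  Y_C : ∀ f, Y * C f = C (fun h => f (h * D.a)) * Y
  Y_pow : Y ^ D.n = 0
  Y_X : Y * X = X * Y + (C (fun h => (D.χ h : k)) - K D.a)
  -- The correction term comes from xⁿ = α(aⁿ - 1): multiplication by x can carry xⁿ⁻¹ back to
  -- degree zero. It disappears in nilpotent type.
  C_X : ∀ f, C f * X = X * C (fun h => f (h * D.a)) -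
    (D.α / D.qFactorial (D.n - 1)) • (Y ^ (D.n - 1) *
      ((K D.a - (D.ρ : k) • C (fun h => (D.χ h : k))) *
        C (fun h => f (h * D.a) - f (h * D.a * (D.a ^ D.n)⁻¹))))

/-- The function `h ↦ p(h a⁻ʲ xʲ)` on `G`. -/
noncomputable def comp (j : ℕ) : Module.Dual k D.HD →ₗ[k] (G → k) where
  toFun p h := p (D.grp (h * (D.a ^ j)⁻¹) * D.x ^ j)
  map_add' _ _ := rfl
  map_smul' _ _ := rfl

theorem comp_apply (j : ℕ) (p : Module.Dual k D.HD) (h : G) :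
    D.comp j p h = p (D.grp (h * (D.a ^ j)⁻¹) * D.x ^ j) := rfl

namespace DoubleData

variable {D} {B : Type*} [Ring B] [Algebra k B] (E : D.DoubleData B)

/-- The image of the data under an algebra homomorphism. -/
def map {B' : Type*} [Ring B'] [Algebra k B'] (f : B →ₐ[k] B') : D.DoubleData B' where
  K g := f (E.K g)
  X := f E.X
  Y := f E.Y
  C := f.comp E.C
  sat :=
    { one := by rw [E.sat.one, map_one]
      mul := fun g h => by rw [E.sat.mul, map_mul]
      pow := by rw [← map_pow, E.sat.pow, map_smul, map_sub, map_one]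
      comm := fun g => by rw [← map_mul, E.sat.comm, map_smul, map_mul] }
  K_C g u := by simpa using congrArg f (E.K_C g u)
  K_Y g := by simpa using congrArg f (E.K_Y g)
  Y_C u := by simpa using congrArg f (E.Y_C u)
  Y_pow := by simpa using congrArg f E.Y_pow
  Y_X := by simpa using congrArg f E.Y_X
  C_X u := by simpa using congrArg f (E.C_X u)

theorem Y_pow_C (j : ℕ) (f : G → k) :
    E.Y ^ j * E.C f = E.C (fun h => f (h * D.a ^ j)) * E.Y ^ j := by
  induction j generalizing f with
  | zero => simp
  | succ j ih =>
    rw [pow_succ, mul_assoc, E.Y_C, ← mul_assoc, ih, mul_assoc]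
    simp only [pow_succ', mul_assoc, mul_comm D.a]

theorem C_Y_pow (j : ℕ) (f : G → k) :
    E.C f * E.Y ^ j = E.Y ^ j * E.C (fun h => f (h * (D.a ^ j)⁻¹)) := by
  simp [Y_pow_C]

theorem Ka_Y : E.K D.a * E.Y = (D.ρ : k) • (E.Y * E.K D.a) := E.K_Y D.a

theorem Y_Cchi : E.Y * E.C (fun h => (D.χ h : k)) =
    (D.ρ : k) • (E.C (fun h => (D.χ h : k)) * E.Y) := by
  rw [E.Y_C, ← smul_mul_assoc, ← map_smul]
  congr 2
  ext h
  simp [ρ, mul_comm]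

theorem K_Y_pow (g : G) (j : ℕ) :
    E.K g * E.Y ^ j = (D.χ g : k) ^ j • (E.Y ^ j * E.K g) := by
  induction j with
  | zero => simp
  | succ j ih =>
    rw [pow_succ, ← mul_assoc, ih, smul_mul_assoc, mul_assoc, E.K_Y, mul_smul_comm, smul_smul,
      ← mul_assoc, pow_succ]

/-- `ξʲ⁺¹ x - x ξʲ⁺¹ = (j+1) ξʲ (ρ⁻ʲ χ - a)`. -/
theorem Y_pow_X (j : ℕ) : E.Y ^ (j + 1) * E.X = E.X * E.Y ^ (j + 1) +
    D.qNum (j + 1) • (E.Y ^ j *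
      (((D.ρ : k) ^ j)⁻¹ • E.C (fun h => (D.χ h : k)) - E.K D.a)) := by
  have e1 : E.C (fun h => (D.χ h : k)) * E.Y =
      (D.ρ : k)⁻¹ • (E.Y * E.C (fun h => (D.χ h : k))) := by
    rw [E.Y_Cchi, smul_smul, inv_mul_cancel₀ D.ρ.ne_zero, one_smul]
  have e2 : E.X * E.Y = E.Y * E.X + (E.K D.a - E.C (fun h => (D.χ h : k))) := by
    rw [E.Y_X]
    abel
  rw [mul_pow_of_commutator D.ρ.ne_zero e2 E.Ka_Y e1 j, add_assoc, left_eq_add, qNum, ← smul_add,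
    ← mul_add]
  simp

/-- The extension of the data to `H*`. -/
noncomputable def dualMap : Module.Dual k D.HD →ₗ[k] B :=
  ∑ j ∈ Finset.range D.n, (D.qFactorial j)⁻¹ •
    (LinearMap.mulLeft k (E.Y ^ j) ∘ₗ E.C.toLinearMap ∘ₗ D.comp j)

theorem dualMap_apply (p : Module.Dual k D.HD) : E.dualMap p =
    ∑ j ∈ Finset.range D.n, (D.qFactorial j)⁻¹ • (E.Y ^ j * E.C (D.comp j p)) := by
  simp [dualMap]

theorem qFactorial_zero : D.qFactorial 0 = 1 := rfl

theorem counit_grp_mul_x_pow (g : G) (j : ℕ) :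
    Coalgebra.counit (R := k) (D.grp g * D.x ^ j) = if j = 0 then 1 else 0 := by
  rw [counit_apply, map_mul, map_pow, counitHom_grp, counitHom_x, one_mul, zero_pow_eq]

theorem dualMap_counit : E.dualMap Coalgebra.counit = 1 := by
  rw [dualMap_apply, Finset.sum_eq_single_of_mem 0 (Finset.mem_range.2 D.n_pos)]
  · have : D.comp 0 Coalgebra.counit = 1 := by
      ext h
      rw [comp_apply, counit_grp_mul_x_pow]
      rfl
    simp [this, qFactorial_zero]
  · intro j _ hj
    have : D.comp j Coalgebra.counit = 0 := by
      ext h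
      rw [comp_apply, counit_grp_mul_x_pow, if_neg hj]
      rfl
    simp [this]

/-- Multiplying ξⁱ f by ξʲ f' translates f by a⁻ʲ, and the Gaussian binomial in the convolution is
exactly what converts the factor 1/(i+j)! into 1/((i)! (j)!). Terms with i + j ≥ n vanish because ξⁿ
= 0. -/
theorem dualMap_conv (p q : Module.Dual k D.HD) :
    E.dualMap (DrinfeldDouble.conv k D.HD p q) = E.dualMap p * E.dualMap q := by
  let F : ℕ → ℕ → B := fun i j => ((D.qFactorial i)⁻¹ * (D.qFactorial j)⁻¹) •
    (E.Y ^ (i + j) * E.C (fun h => p (D.grp (h * (D.a ^ (i + j))⁻¹) * D.x ^ i) *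
      q (D.grp (h * (D.a ^ j)⁻¹) * D.x ^ j)))
  have hF : ∀ i j, D.n ≤ i + j → F i j = 0 := by
    intro i j hij
    obtain ⟨m, hm⟩ := Nat.exists_eq_add_of_le hij
    simp only [F]
    rw [hm, pow_add, E.Y_pow, zero_mul, zero_mul, smul_zero]
  have hR : E.dualMap p * E.dualMap q =
      ∑ i ∈ Finset.range D.n, ∑ j ∈ Finset.range D.n, F i j := by
    rw [dualMap_apply, dualMap_apply, Finset.sum_mul_sum]
    refine Finset.sum_congr rfl fun i _ => Finset.sum_congr rfl fun j _ => ?_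
    rw [smul_mul_smul_comm, mul_assoc, ← mul_assoc (E.C _), E.C_Y_pow, mul_assoc, ← map_mul,
      ← mul_assoc, ← pow_add]
    simp only [F, comp_apply, Pi.mul_def, pow_add, mul_inv, mul_assoc, mul_comm (D.a ^ i)⁻¹]
  have hL : E.dualMap (DrinfeldDouble.conv k D.HD p q) =
      ∑ m ∈ Finset.range D.n, ∑ i ∈ Finset.range (m + 1), F i (m - i) := by
    rw [dualMap_apply]
    refine Finset.sum_congr rfl fun m hm => ?_
    have e : D.comp m (DrinfeldDouble.conv k D.HD p q) = ∑ i ∈ Finset.range (m + 1),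
        gaussBinom (D.ρ : k) m i • (fun h => p (D.grp (h * (D.a ^ m)⁻¹) * D.x ^ i) *
          q (D.grp (h * (D.a ^ (m - i))⁻¹) * D.x ^ (m - i))) := by
      ext h
      rw [comp_apply, conv_grp_mul_x_pow, Finset.sum_apply]
      refine Finset.sum_congr rfl fun i hi => ?_
      have hi' : i ≤ m := Nat.lt_succ_iff.1 (Finset.mem_range.1 hi)
      have : h * (D.a ^ m)⁻¹ * D.a ^ i = h * (D.a ^ (m - i))⁻¹ := by
        rw [mul_assoc, ← Nat.sub_add_cancel hi', pow_add]
        simp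
      rw [this]
      rfl
    rw [e, map_sum, Finset.mul_sum, Finset.smul_sum]
    refine Finset.sum_congr rfl fun i hi => ?_
    have hi' : i ≤ m := Nat.lt_succ_iff.1 (Finset.mem_range.1 hi)
    have hm' := Finset.mem_range.1 hm
    have b := D.gaussBinom_mul_factorial i (m - i)
    rw [Nat.add_sub_cancel' hi'] at b
    have n1 := D.qFactorial_ne_zero (i := i) (by omega)
    have n2 := D.qFactorial_ne_zero (i := m - i) (by omega)
    have n3 := D.qFactorial_ne_zero hm'
    simp only [F, Nat.add_sub_cancel' hi', map_smul, mul_smul_comm, smul_smul]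
    congr 1
    field_simp
    linear_combination b
  -- The sum along diagonals covers the triangle i + j < n; the rest of the square contributes zero.
  rw [hL, hR, Finset.sum_range_diag_flip]
  refine Finset.sum_congr rfl fun i hi => ?_
  refine Finset.sum_subset (Finset.range_subset_range.2 (Nat.sub_le _ _)) fun j _ hj => ?_
  refine hF _ _ ?_
  have := Finset.mem_range.not.1 hj
  omega

/-! ### The cross relations for the generators of H_D -/

theorem rightHit_grp (p : Module.Dual k D.HD) (g h : G) (j : ℕ) :
    DrinfeldDouble.rightHit k D.HD p (D.grp g) (D.grp h * D.x ^ j) =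
      p (D.grp (g * h) * D.x ^ j) := by
  simp [DrinfeldDouble.rightHit, grp_mul, mul_assoc]

theorem leftHit_grp (p : Module.Dual k D.HD) (g h : G) (j : ℕ) :
    DrinfeldDouble.leftHit k D.HD p (D.grp g) (D.grp h * D.x ^ j) =
      (D.χ g : k) ^ j * p (D.grp (g * h) * D.x ^ j) := by
  simp [DrinfeldDouble.leftHit, grp_mul, mul_assoc, x_pow_grp, mul_comm g]

theorem rightHit_x (p : Module.Dual k D.HD) (h : G) (j : ℕ) :
    DrinfeldDouble.rightHit k D.HD p D.x (D.grp h * D.x ^ j) =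
      (D.χ h : k) * p (D.grp h * D.x ^ (j + 1)) := by
  simp [DrinfeldDouble.rightHit, ← mul_assoc, x_grp, pow_succ']

theorem leftHit_x (p : Module.Dual k D.HD) (h : G) (j : ℕ) :
    DrinfeldDouble.leftHit k D.HD p D.x (D.grp h * D.x ^ j) = p (D.grp h * D.x ^ (j + 1)) := by
  simp [DrinfeldDouble.leftHit, mul_assoc, pow_succ]

theorem crossed_grp_iff {F : Module.Dual k D.HD →ₗ[k] B} {f : D.HD →ₗ[k] B}
    (p : Module.Dual k D.HD) (g : G) : DrinfeldDouble.Crossed f F p (D.grp g) ↔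
      f (D.grp g) * F (DrinfeldDouble.rightHit k D.HD p (D.grp g)) =
        F (DrinfeldDouble.leftHit k D.HD p (D.grp g)) * f (D.grp g) := by
  simp [DrinfeldDouble.Crossed, comul_apply, comulHom_grp]

theorem crossed_x_iff {F : Module.Dual k D.HD →ₗ[k] B} {f : D.HD →ₗ[k] B} (hf : f 1 = 1)
    (p : Module.Dual k D.HD) : DrinfeldDouble.Crossed f F p D.x ↔
      f D.x * F (DrinfeldDouble.rightHit k D.HD p (D.grp D.a)) +
          F (DrinfeldDouble.rightHit k D.HD p D.x) =
        F (DrinfeldDouble.leftHit k D.HD p D.x) * f (D.grp D.a) + F p * f D.x := by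
  have l1 : DrinfeldDouble.leftHit k D.HD p 1 = p := by ext; simp [DrinfeldDouble.leftHit]
  simp [DrinfeldDouble.Crossed, comul_apply, comulHom_x, hf, l1]

theorem crossed_grp (p : Module.Dual k D.HD) (g : G) :
    DrinfeldDouble.Crossed (D.lift E.sat).toLinearMap E.dualMap p (D.grp g) := by
  rw [crossed_grp_iff, AlgHom.toLinearMap_apply, lift_grp, dualMap_apply, dualMap_apply,
    Finset.mul_sum, Finset.sum_mul]
  refine Finset.sum_congr rfl fun j _ => ?_
  have e : D.comp j (DrinfeldDouble.leftHit k D.HD p (D.grp g)) =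
      (D.χ g : k) ^ j • D.comp j (DrinfeldDouble.rightHit k D.HD p (D.grp g)) := by
    ext h
    simp [comp_apply, leftHit_grp, rightHit_grp]
  rw [e, map_smul, mul_smul_comm, smul_mul_assoc, ← mul_assoc, E.K_Y_pow]
  simp only [smul_mul_assoc, mul_smul_comm, mul_assoc, E.K_C]

theorem grp_mul_x_pow_n (p : Module.Dual k D.HD) (h : G) :
    p (D.grp h * D.x ^ D.n) = D.α * (p (D.grp (h * D.a ^ D.n)) - p (D.grp h)) := by
  simp [x_pow, mul_sub, grp_mul]

/-- Both sides are compared in each power of ξ. Moving x past ξʲ⁺¹ creates terms in ξʲ, which are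
the degree j parts of the two hits by x. In the top degree these hits see xⁿ, and the correction in
`C_X` accounts for them. -/
theorem crossed_x (p : Module.Dual k D.HD) :
    DrinfeldDouble.Crossed (D.lift E.sat).toLinearMap E.dualMap p D.x := by
  rw [crossed_x_iff (by simp), AlgHom.toLinearMap_apply, AlgHom.toLinearMap_apply, lift_x, lift_grp]
  simp only [dualMap_apply]
  obtain ⟨N, hN⟩ : ∃ N, D.n = N + 1 := ⟨D.n - 1, by have := D.n_pos; omega⟩
  have hN' : D.n - 1 = N := by omega
  have hY : E.Y ^ (N + 1) = 0 := hN ▸ E.Y_pow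
  have cx := E.C_X
  rw [hN'] at cx
  -- The correction in `C_X` starts with ξⁿ⁻¹, so it is killed by any further ξ on the left.
  have cY : ∀ j (f : G → k), E.Y ^ (j + 1) * (E.C f * E.X) =
      E.Y ^ (j + 1) * (E.X * E.C (fun h => f (h * D.a))) := by
    intro j f
    rw [cx, mul_sub, mul_smul_comm, ← mul_assoc (E.Y ^ (j + 1)) (E.Y ^ N), ← pow_add,
      show j + 1 + N = N + 1 + j by ring, pow_add (E.Y) (N + 1), hY, zero_mul, zero_mul,
      smul_zero, sub_zero]
  have sh : ∀ (j : ℕ) h, h * D.a * (D.a ^ (j + 1))⁻¹ = h * (D.a ^ j)⁻¹ := by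
    intro j h
    rw [pow_succ', mul_inv, ← mul_assoc, mul_inv_cancel_right]
  have ca : ∀ j, D.comp j (DrinfeldDouble.rightHit k D.HD p (D.grp D.a)) =
      fun h => D.comp j p (h * D.a) := by
    intro j
    ext h
    rw [comp_apply, rightHit_grp, comp_apply, ← mul_assoc, mul_comm D.a]
  have cl : ∀ j, D.comp j (DrinfeldDouble.leftHit k D.HD p D.x) =
      fun h => D.comp (j + 1) p (h * D.a) := by
    intro j
    ext h
    rw [comp_apply, leftHit_x, comp_apply, sh]
  have cr : ∀ j, D.comp j (DrinfeldDouble.rightHit k D.HD p D.x) =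
      ((D.ρ : k) ^ j)⁻¹ • ((fun h => (D.χ h : k)) * fun h => D.comp (j + 1) p (h * D.a)) := by
    intro j
    ext h
    rw [comp_apply, rightHit_x, Pi.smul_apply, Pi.mul_apply, comp_apply, sh]
    simp [ρ]
    ring
  -- The component of index n wraps around to the component of index 0 because xⁿ = α(aⁿ - 1).
  have ctop : (fun h => D.comp (N + 1) p (h * D.a)) = D.α • fun h =>
      D.comp 0 p (h * D.a) - D.comp 0 p (h * D.a * (D.a ^ D.n)⁻¹) := by
    ext h
    simp only [comp_apply, ← hN, grp_mul_x_pow_n, Pi.smul_apply, smul_eq_mul]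
    simp
  simp only [ca, cl, cr, hN, Finset.mul_sum, Finset.sum_mul, smul_mul_assoc, mul_smul_comm,
    mul_assoc]
  rw [Finset.sum_range_succ' (fun j => (D.qFactorial j)⁻¹ • (E.Y ^ j * (E.C _ * E.X))),
    Finset.sum_range_succ' (fun j => (D.qFactorial j)⁻¹ • (E.X * _)),
    Finset.sum_range_succ _ N, Finset.sum_range_succ _ N]
  have step : ∀ j ∈ Finset.range N,
      (D.qFactorial (j + 1))⁻¹ • (E.Y ^ (j + 1) * (E.C (D.comp (j + 1) p) * E.X)) =
      (D.qFactorial (j + 1))⁻¹ • (E.X * (E.Y ^ (j + 1) *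
        E.C (fun h => D.comp (j + 1) p (h * D.a)))) +
      (D.qFactorial j)⁻¹ • (E.Y ^ j * E.C (((D.ρ : k) ^ j)⁻¹ •
        ((fun h => (D.χ h : k)) * fun h => D.comp (j + 1) p (h * D.a)))) -
      (D.qFactorial j)⁻¹ • (E.Y ^ j *
        (E.C (fun h => D.comp (j + 1) p (h * D.a)) * E.K D.a)) := by
    intro j hj
    have hj' := Finset.mem_range.1 hj
    have n1 : (D.qFactorial (j + 1))⁻¹ * D.qNum (j + 1) = (D.qFactorial j)⁻¹ := by
      rw [qFactorial_succ, mul_inv, mul_assoc,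
        inv_mul_cancel₀ (D.qNum_ne_zero (by omega) (by omega)), mul_one]
    rw [cY, ← mul_assoc, E.Y_pow_X, add_mul, smul_add, smul_mul_assoc, smul_smul, n1, mul_assoc,
      mul_assoc, sub_mul, E.K_C, smul_mul_assoc, ← map_mul, mul_sub, smul_sub, map_smul]
    abel
  rw [Finset.sum_congr rfl step, Finset.sum_sub_distrib, Finset.sum_add_distrib]
  -- The term without ξ is the only one in which the correction survives; it gives the missing
  -- degree n - 1 terms, using ρ^{-(n-1)} = ρ.
  have c0 : E.C (D.comp 0 p) * E.X = E.X * E.C (fun h => D.comp 0 p (h * D.a)) -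
      (D.qFactorial N)⁻¹ • (E.Y ^ N * (E.C (fun h => D.comp (N + 1) p (h * D.a)) * E.K D.a)) +
      (D.qFactorial N)⁻¹ • (E.Y ^ N * E.C (((D.ρ : k) ^ N)⁻¹ •
        ((fun h => (D.χ h : k)) * fun h => D.comp (N + 1) p (h * D.a)))) := by
    have hr : ((D.ρ : k) ^ N)⁻¹ = D.ρ := by
      exact inv_eq_of_mul_eq_one_left (by rw [← pow_succ', ← hN, rho_pow_n])
    rw [cx, ctop, hr, map_smul, map_smul, map_mul, map_smul, sub_mul, E.K_C, smul_mul_assoc]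
    simp only [mul_sub, smul_sub, mul_smul_comm, smul_mul_assoc, smul_smul]
    rw [div_eq_mul_inv, mul_comm D.α]
    module
  simp only [pow_zero, one_mul, qFactorial_zero, inv_one, one_smul]
  rw [c0]
  abel

/-- The algebra map `D(H_D) → B` given by the data. -/
noncomputable def toHom : D.Double →ₐ[k] B :=
  DrinfeldDouble.lift (D.lift E.sat) E.dualMap E.dualMap_counit E.dualMap_conv (by
    intro p h
    -- The h that satisfy the cross relation with every p form a subspace containing 1 and stable
    -- under left multiplication by the generators.
    let S : Submodule k D.HD :=
      { carrier := {h | ∀ p, DrinfeldDouble.Crossed (D.lift E.sat).toLinearMap E.dualMap p h}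
        zero_mem' := fun p => by
          simpa using DrinfeldDouble.crossed_algebraMap (D.lift E.sat) E.dualMap 0 p
        add_mem' := fun ha hb p => DrinfeldDouble.Crossed.add _ _ (ha p) (hb p)
        smul_mem' := fun r s hs p => by
          rw [Algebra.smul_def]
          exact DrinfeldDouble.Crossed.mul _ _
            (fun p => DrinfeldDouble.crossed_algebraMap _ _ r p) hs p }
    have hS : S = ⊤ := D.submodule_eq_top
      (fun p => by simpa using DrinfeldDouble.crossed_algebraMap (D.lift E.sat) E.dualMap 1 p)
      (fun g s hs => DrinfeldDouble.Crossed.mul _ _ (fun p => E.crossed_grp p g) hs)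
      (fun s hs => DrinfeldDouble.Crossed.mul _ _ (fun p => E.crossed_x p) hs)
    have : h ∈ S := hS ▸ Submodule.mem_top
    exact this p)

theorem toHom_ofAlg (h : D.HD) : E.toHom (DrinfeldDouble.ofAlg k D.HD h) = D.lift E.sat h :=
  DrinfeldDouble.lift_ofAlg _ _ _ _ _ h

theorem toHom_ofDual (p : Module.Dual k D.HD) :
    E.toHom (DrinfeldDouble.ofDual k D.HD p) = E.dualMap p :=
  DrinfeldDouble.lift_ofDual _ _ _ _ _ p

end DoubleData

end Presentation

end GroupDatum

/-! ### The generators of `D(H_D)` -/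

namespace GroupDatum

section Universal

variable {k G : Type*} [Field k] [CommGroup G] [Finite G] (D : GroupDatum k G)

open DoubleData

/-- The functional `h xⁱ ↦ δ_{i,j} (j)! f(h aʲ)`, which is the product of `ξʲ` and the functional
`h xⁱ ↦ δ_{i,0} f(h)`. -/
noncomputable def dualFun (j : ℕ) (f : G → k) : Module.Dual k D.HD :=
  (Finsupp.linearCombination k fun p : G × Fin D.n =>
    if p.2.val = j then D.qFactorial j * f (p.1 * D.a ^ j) else 0) ∘ₗ D.coord

theorem dualFun_apply (j : ℕ) (f : G → k) (h : G) {i : ℕ} (hi : i < D.n) :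
    D.dualFun j f (D.grp h * D.x ^ i) =
      if i = j then D.qFactorial j * f (h * D.a ^ j) else 0 := by
  have := D.coord_grp_mul_x_pow h ⟨i, hi⟩
  simp only at this
  simp [dualFun, this]

theorem dualFun_apply_grp (j : ℕ) (f : G → k) (h : G) :
    D.dualFun j f (D.grp h) = if 0 = j then D.qFactorial j * f (h * D.a ^ j) else 0 := by
  simpa using D.dualFun_apply j f h D.n_pos

theorem dualFun_zero_apply (f : G → k) (h : G) {i : ℕ} (hi : i < D.n) :
    D.dualFun 0 f (D.grp h * D.x ^ i) = if i = 0 then f h else 0 := by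
  rw [dualFun_apply _ _ _ _ hi, qFactorial_zero]
  simp

theorem charFun_eq (γ : G →* kˣ) : D.charFun γ = D.dualFun 0 (fun h => (γ h : k)) := by
  apply D.linearMap_ext
  intro g j hj
  rw [dualFun_zero_apply _ _ _ hj]
  exact D.charFun_apply γ g ⟨j, hj⟩

theorem qNum_one : D.qNum 1 = 1 := by simp [qNum]

theorem qFactorial_one : D.qFactorial 1 = 1 := by
  rw [qFactorial_succ, qNum_one, qFactorial_zero, one_mul]

theorem xiFun_eq : D.xiFun = D.dualFun 1 1 := by
  apply D.linearMap_ext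
  intro g j hj
  rw [dualFun_apply _ _ _ _ hj, qFactorial_one]
  simpa using D.xiFun_apply g ⟨j, hj⟩

theorem dualFun_add (j : ℕ) (f f' : G → k) :
    D.dualFun j (f + f') = D.dualFun j f + D.dualFun j f' := by
  apply D.linearMap_ext
  intro g i hi
  rw [LinearMap.add_apply, dualFun_apply _ _ _ _ hi, dualFun_apply _ _ _ _ hi,
    dualFun_apply _ _ _ _ hi]
  split_ifs <;> simp [mul_add]

theorem dualFun_smul (j : ℕ) (r : k) (f : G → k) :
    D.dualFun j (r • f) = r • D.dualFun j f := by
  apply D.linearMap_ext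
  intro g i hi
  rw [LinearMap.smul_apply, dualFun_apply _ _ _ _ hi, dualFun_apply _ _ _ _ hi]
  split_ifs <;> simp [mul_left_comm]

theorem dualFun_one : D.dualFun 0 1 = Coalgebra.counit := by
  apply D.linearMap_ext
  intro g i hi
  rw [dualFun_zero_apply _ _ _ hi, counit_grp_mul_x_pow]
  rfl

theorem conv_dualFun_zero (j : ℕ) (f f' : G → k) :
    DrinfeldDouble.conv k D.HD (D.dualFun j f) (D.dualFun 0 f') = D.dualFun j (f * f') := by
  apply D.linearMap_ext
  intro g i hi
  rw [conv_grp_mul_x_pow, dualFun_apply _ _ _ _ hi, Finset.sum_range_succ, Finset.sum_eq_zero]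
  · rw [dualFun_apply _ _ _ _ hi, Nat.sub_self, dualFun_zero_apply _ _ _ D.n_pos, gaussBinom_self]
    by_cases h : i = j
    · simp [h, mul_assoc]
    · simp [h]
  · intro s hs
    have := Finset.mem_range.1 hs
    rw [dualFun_zero_apply D f' _ (i := i - s) (by omega), if_neg (by omega)]
    simp

/-- Only the summand of Δ(g xⁱ⁺¹) with first tensor factor of degree 1 matters. Its coefficient
(i+1)_ρ is what the factor (j)!_ρ in `dualFun` is designed to absorb. -/
theorem conv_xi_dualFun (j : ℕ) (f : G → k) :
    DrinfeldDouble.conv k D.HD (D.dualFun 1 1) (D.dualFun j f) = D.dualFun (j + 1) f := by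
  apply D.linearMap_ext
  intro g i hi
  rw [conv_grp_mul_x_pow, dualFun_apply _ _ _ _ hi]
  cases i with
  | zero => simp [dualFun_apply_grp]
  | succ i =>
    rw [Finset.sum_eq_single_of_mem 1 (by simp)]
    · rw [dualFun_apply _ _ _ _ (by omega), if_pos rfl, dualFun_apply _ _ _ _ (by omega),
        Nat.add_sub_cancel, qFactorial_one]
      have b := D.gaussBinom_mul_factorial 1 i
      rw [add_comm 1 i, qFactorial_one, one_mul] at b
      by_cases hij : i = j
      · subst hij
        simp only [if_true, ← b, Pi.one_apply, pow_succ', pow_zero, mul_one, one_mul, mul_assoc]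
      · simp [hij]
    · intro s hs hs1
      have := Finset.mem_range.1 hs
      rw [dualFun_apply _ _ _ _ (by omega), if_neg hs1]
      simp

/-- The divided powers ξʲ/(j)! times functions on G exhaust H*, as (j)!_ρ ≠ 0 for j < n. This forces
the formula for `dualMap`. -/
theorem dual_eq_sum_dualFun (p : Module.Dual k D.HD) :
    p = ∑ j ∈ Finset.range D.n, (D.qFactorial j)⁻¹ • D.dualFun j (D.comp j p) := by
  apply D.linearMap_ext
  intro g i hi
  rw [LinearMap.sum_apply, Finset.sum_eq_single_of_mem i (Finset.mem_range.2 hi)]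
  · rw [LinearMap.smul_apply, dualFun_apply _ _ _ _ hi, if_pos rfl, comp_apply, smul_eq_mul,
      inv_mul_cancel_left₀ (D.qFactorial_ne_zero hi), mul_inv_cancel_right]
  · intro j _ hj
    rw [LinearMap.smul_apply, dualFun_apply _ _ _ _ hi, if_neg hj.symm, smul_zero]

/-- The element of `D(H_D)` given by the functional `h xⁱ ↦ δ_{i,0} f(h)`. -/
noncomputable def dFun : (G → k) →ₐ[k] D.Double :=
  AlgHom.ofLinearMap
    { toFun := fun f => DrinfeldDouble.ofDual k D.HD (D.dualFun 0 f)
      map_add' := fun f f' => by rw [dualFun_add, map_add]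
      map_smul' := fun r f => by rw [dualFun_smul, map_smul]; rfl }
    (by
      change DrinfeldDouble.ofDual k D.HD (D.dualFun 0 1) = 1
      rw [dualFun_one, DrinfeldDouble.ofDual_counit])
    (fun f f' => by
      change DrinfeldDouble.ofDual k D.HD (D.dualFun 0 (f * f')) = _
      rw [← conv_dualFun_zero, DrinfeldDouble.ofDual_conv]
      rfl)

theorem dFun_apply (f : G → k) : D.dFun f = DrinfeldDouble.ofDual k D.HD (D.dualFun 0 f) := rfl

theorem dChar_eq (γ : G →* kˣ) : D.dChar γ = D.dFun (fun h => (γ h : k)) := by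
  rw [dChar, charFun_eq, dFun_apply]

theorem dXi_pow_mul_dFun (j : ℕ) (f : G → k) :
    D.dXi ^ j * D.dFun f = DrinfeldDouble.ofDual k D.HD (D.dualFun j f) := by
  induction j with
  | zero => simp [dFun_apply]
  | succ j ih =>
    rw [pow_succ', mul_assoc, ih, dXi, xiFun_eq, ← DrinfeldDouble.ofDual_conv, conv_xi_dualFun]

theorem ofDual_eq (p : Module.Dual k D.HD) : DrinfeldDouble.ofDual k D.HD p =
    ∑ j ∈ Finset.range D.n, (D.qFactorial j)⁻¹ • (D.dXi ^ j * D.dFun (D.comp j p)) := by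
  conv_lhs => rw [D.dual_eq_sum_dualFun p, map_sum]
  simp only [map_smul, dXi_pow_mul_dFun]

theorem dGrp_satisfies : D.Satisfies D.dGrp D.dX where
  one := by rw [dGrp, grp_one, DrinfeldDouble.ofAlg_one]
  mul g h := by rw [dGrp, grp_mul, DrinfeldDouble.ofAlg_mul]; rfl
  pow := by
    have := congrArg (DrinfeldDouble.ofAlgHom k D.HD) D.x_pow
    simp only [map_pow, map_smul, map_sub, map_one] at this
    exact this
  comm g := by
    have := congrArg (DrinfeldDouble.ofAlgHom k D.HD) (D.x_grp g)
    simp only [map_mul, map_smul] at this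
    exact this

theorem dGrp_mul_ofDual (p : Module.Dual k D.HD) (g : G) :
    D.dGrp g * DrinfeldDouble.ofDual k D.HD (DrinfeldDouble.rightHit k D.HD p (D.grp g)) =
      DrinfeldDouble.ofDual k D.HD (DrinfeldDouble.leftHit k D.HD p (D.grp g)) * D.dGrp g :=
  (crossed_grp_iff p g).1 (DrinfeldDouble.crossed_ofAlg_ofDual p (D.grp g))

theorem dX_mul_ofDual (p : Module.Dual k D.HD) :
    D.dX * DrinfeldDouble.ofDual k D.HD (DrinfeldDouble.rightHit k D.HD p (D.grp D.a)) +
        DrinfeldDouble.ofDual k D.HD (DrinfeldDouble.rightHit k D.HD p D.x) =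
      DrinfeldDouble.ofDual k D.HD (DrinfeldDouble.leftHit k D.HD p D.x) * D.dGrp D.a +
        DrinfeldDouble.ofDual k D.HD p * D.dX :=
  (crossed_x_iff DrinfeldDouble.ofAlg_one p).1 (DrinfeldDouble.crossed_ofAlg_ofDual p D.x)

/-- A functional of degree zero is nonzero on a positive power of x only through xⁿ = α(aⁿ - 1);
hence the correction term in `C_X`. -/
theorem dualFun_zero_x_pow (f : G → k) (h : G) {i : ℕ} (hi : i < D.n) :
    D.dualFun 0 f (D.grp h * D.x ^ (i + 1)) =
      if i = D.n - 1 then D.α * (f (h * D.a ^ D.n) - f h) else 0 := by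
  by_cases hi' : i + 1 < D.n
  · rw [dualFun_zero_apply _ _ _ hi', if_neg (by omega), if_neg (by omega)]
  · rw [if_pos (by omega), show i + 1 = D.n by omega, grp_mul_x_pow_n, dualFun_apply_grp,
      dualFun_apply_grp]
    simp [qFactorial_zero]

theorem dGrp_mul_dFun (g : G) (f : G → k) : D.dGrp g * D.dFun f = D.dFun f * D.dGrp g := by
  -- The translate is chosen so that both hits by g turn it into f.
  have h := D.dGrp_mul_ofDual (D.dualFun 0 (fun h => f (g⁻¹ * h))) g
  have r : DrinfeldDouble.rightHit k D.HD (D.dualFun 0 (fun h => f (g⁻¹ * h))) (D.grp g) =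
      D.dualFun 0 f := by
    apply D.linearMap_ext
    intro h i hi
    rw [rightHit_grp, dualFun_zero_apply _ _ _ hi, dualFun_zero_apply _ _ _ hi]
    simp
  have l : DrinfeldDouble.leftHit k D.HD (D.dualFun 0 (fun h => f (g⁻¹ * h))) (D.grp g) =
      D.dualFun 0 f := by
    apply D.linearMap_ext
    intro h i hi
    rw [leftHit_grp, dualFun_zero_apply _ _ _ hi, dualFun_zero_apply _ _ _ hi]
    split_ifs with h0 <;> simp [h0]
  rwa [r, l] at h

/-- `G`, `x`, `ξ` and the functions on `G` satisfy the defining relations in `D(H_D)`. -/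
noncomputable def univData (hn : 1 < D.n) : D.DoubleData D.Double where
  K := D.dGrp
  X := D.dX
  Y := D.dXi
  C := D.dFun
  sat := D.dGrp_satisfies
  K_C := D.dGrp_mul_dFun
  K_Y g := by
    have h := D.dGrp_mul_ofDual (D.dualFun 1 1) g
    have r : DrinfeldDouble.rightHit k D.HD (D.dualFun 1 1) (D.grp g) = D.dualFun 1 1 := by
      apply D.linearMap_ext
      intro h i hi
      rw [rightHit_grp, dualFun_apply _ _ _ _ hi, dualFun_apply _ _ _ _ hi]
      simp
    have l : DrinfeldDouble.leftHit k D.HD (D.dualFun 1 1) (D.grp g) =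
        (D.χ g : k) • D.dualFun 1 1 := by
      apply D.linearMap_ext
      intro h i hi
      rw [leftHit_grp, LinearMap.smul_apply, dualFun_apply _ _ _ _ hi, dualFun_apply _ _ _ _ hi]
      split_ifs with h0 <;> simp [h0]
    rw [r, l, map_smul, smul_mul_assoc] at h
    rwa [dXi, xiFun_eq]
  Y_C f := by
    have h1 := D.dXi_pow_mul_dFun 1 f
    rw [pow_one] at h1
    rw [h1, dXi, xiFun_eq, dFun_apply, ← DrinfeldDouble.ofDual_conv]
    congr 1
    apply D.linearMap_ext
    intro g i hi
    rw [conv_grp_mul_x_pow, dualFun_apply _ _ _ _ hi]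
    cases i with
    | zero => simp [dualFun_apply_grp]
    | succ i =>
      rw [Finset.sum_eq_single_of_mem 0 (by simp)]
      · have hz : gaussBinom (D.ρ : k) (i + 1) 0 = 1 := rfl
        rw [dualFun_zero_apply _ _ _ D.n_pos, dualFun_apply _ _ _ _ (by omega), hz,
          qFactorial_one]
        simp
      · intro s hs hs1
        have := Finset.mem_range.1 hs
        rw [dualFun_zero_apply _ _ _ (by omega), if_neg hs1]
        simp
  Y_pow := by
    have h1 := D.dXi_pow_mul_dFun D.n 1
    rw [map_one, mul_one] at h1
    rw [h1]
    have : D.dualFun D.n 1 = 0 := by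
      apply D.linearMap_ext
      intro g i hi
      rw [dualFun_apply _ _ _ _ hi, if_neg hi.ne]
      rfl
    rw [this, map_zero]
  Y_X := by
    -- In the cross relation of ξ with x, the right hit ξ ↼ x is χ and the left hit x ⇀ ξ is ε.
    have h := D.dX_mul_ofDual (D.dualFun 1 1)
    have r : DrinfeldDouble.rightHit k D.HD (D.dualFun 1 1) (D.grp D.a) = D.dualFun 1 1 := by
      apply D.linearMap_ext
      intro h i hi
      rw [rightHit_grp, dualFun_apply _ _ _ _ hi, dualFun_apply _ _ _ _ hi]
      simp
    -- At i + 1 = n the element g xⁿ lies in degree zero, where ξ vanishes; n > 1 ensures i ≠ 0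
    -- there.
    have e : ∀ g i, i < D.n → D.dualFun 1 1 (D.grp g * D.x ^ (i + 1)) = if i = 0 then 1 else 0 := by
      intro g i hi
      by_cases hi' : i + 1 < D.n
      · rw [dualFun_apply _ _ _ _ hi', qFactorial_one]
        simp
      · rw [show i + 1 = D.n by omega, grp_mul_x_pow_n, if_neg (by omega), dualFun_apply_grp,
          dualFun_apply_grp]
        simp
    have r' : DrinfeldDouble.rightHit k D.HD (D.dualFun 1 1) D.x =
        D.dualFun 0 (fun h => (D.χ h : k)) := by
      apply D.linearMap_ext
      intro h i hi
      rw [rightHit_x, e _ _ hi, dualFun_zero_apply _ _ _ hi]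
      simp
    have l' : DrinfeldDouble.leftHit k D.HD (D.dualFun 1 1) D.x = D.dualFun 0 1 := by
      apply D.linearMap_ext
      intro h i hi
      rw [leftHit_x, e _ _ hi, dualFun_zero_apply _ _ _ hi]
      simp
    rw [r, r', l', dualFun_one, DrinfeldDouble.ofDual_counit, one_mul] at h
    rw [dXi, xiFun_eq, dFun_apply, add_sub, eq_sub_iff_add_eq, add_comm, ← h]
  C_X f := by
    have h := D.dX_mul_ofDual (D.dualFun 0 f)
    have hN : D.n - 1 < D.n := by omega
    have hf := D.qFactorial_ne_zero hN
    have ha : D.a ^ (D.n - 1) * D.a = D.a ^ D.n := by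
      rw [← pow_succ, Nat.sub_add_cancel D.n_pos]
    have hs : ∀ h, h * D.a ^ (D.n - 1) * D.a = h * D.a ^ D.n := fun h => by rw [mul_assoc, ha]
    have hs' : ∀ h, h * D.a ^ D.n * (D.a ^ D.n)⁻¹ = h := fun h => mul_inv_cancel_right _ _
    have r : DrinfeldDouble.rightHit k D.HD (D.dualFun 0 f) (D.grp D.a) =
        D.dualFun 0 (fun h => f (h * D.a)) := by
      apply D.linearMap_ext
      intro h i hi
      rw [rightHit_grp, dualFun_zero_apply _ _ _ hi, dualFun_zero_apply _ _ _ hi, mul_comm h]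
    -- Both hits of f by x are concentrated in degree n - 1, so they are multiples of ξⁿ⁻¹ times a
    -- function. For the right hit, χ(h) = ρ χ(h aⁿ⁻¹) because χ(aⁿ) = 1.
    have r' : DrinfeldDouble.rightHit k D.HD (D.dualFun 0 f) D.x =
        (D.α / D.qFactorial (D.n - 1)) • D.dualFun (D.n - 1) (((D.ρ : k) • fun h => (D.χ h : k)) *
          fun h => f (h * D.a) - f (h * D.a * (D.a ^ D.n)⁻¹)) := by
      apply D.linearMap_ext
      intro h i hi
      rw [rightHit_x, dualFun_zero_x_pow _ _ _ hi, LinearMap.smul_apply, dualFun_apply _ _ _ _ hi]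
      split_ifs with h0
      · have hχ : (D.ρ : k) * (D.χ (h * D.a ^ (D.n - 1)) : k) = D.χ h := by
          rw [ρ, ← Units.val_mul, ← map_mul, mul_comm, mul_assoc, ha, map_mul, chi_pow_a, mul_one]
        simp only [Pi.mul_apply, Pi.smul_apply, smul_eq_mul, hχ, hs, hs']
        field_simp
      · simp
    have l' : DrinfeldDouble.leftHit k D.HD (D.dualFun 0 f) D.x =
        (D.α / D.qFactorial (D.n - 1)) • D.dualFun (D.n - 1)
          (fun h => f (h * D.a) - f (h * D.a * (D.a ^ D.n)⁻¹)) := by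
      apply D.linearMap_ext
      intro h i hi
      rw [leftHit_x, dualFun_zero_x_pow _ _ _ hi, LinearMap.smul_apply, dualFun_apply _ _ _ _ hi]
      split_ifs with h0
      · simp only [smul_eq_mul, hs, hs']
        field_simp
      · simp
    rw [r, r', l', map_smul, map_smul, ← dXi_pow_mul_dFun _ (D.n - 1),
      ← dXi_pow_mul_dFun _ (D.n - 1), ← dFun_apply, ← dFun_apply] at h
    rw [sub_mul, dGrp_mul_dFun, mul_sub, smul_sub, ← map_smul, ← map_mul, smul_mul_assoc]
    rw [smul_mul_assoc, smul_mul_assoc, mul_assoc] at h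
    rw [sub_sub_eq_add_sub, h]
    abel

theorem subalgebra_eq_top {S : Subalgebra k D.Double} (hG : ∀ g, D.dGrp g ∈ S) (hX : D.dX ∈ S)
    (hY : D.dXi ∈ S) (hC : ∀ f, D.dFun f ∈ S) : S = ⊤ := by
  apply DrinfeldDouble.subalgebra_eq_top
  · intro h
    let T : Submodule k D.HD := (Subalgebra.toSubmodule S).comap (DrinfeldDouble.ofAlg k D.HD)
    have hT : T = ⊤ := by
      apply D.submodule_eq_top
      · change DrinfeldDouble.ofAlg k D.HD 1 ∈ S
        rw [DrinfeldDouble.ofAlg_one]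
        exact S.one_mem
      · intro g s hs
        change DrinfeldDouble.ofAlg k D.HD _ ∈ S
        rw [DrinfeldDouble.ofAlg_mul]
        exact S.mul_mem (hG g) hs
      · intro s hs
        change DrinfeldDouble.ofAlg k D.HD _ ∈ S
        rw [DrinfeldDouble.ofAlg_mul]
        exact S.mul_mem hX hs
    have : h ∈ T := hT ▸ Submodule.mem_top
    exact this
  · intro p
    rw [ofDual_eq]
    exact S.sum_mem fun j _ => S.smul_mem (S.mul_mem (S.pow_mem hY _) (hC _)) _

theorem algHom_ext {B : Type*} [Ring B] [Algebra k B] {Φ Φ' : D.Double →ₐ[k] B}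
    (hG : ∀ g, Φ (D.dGrp g) = Φ' (D.dGrp g)) (hX : Φ D.dX = Φ' D.dX) (hY : Φ D.dXi = Φ' D.dXi)
    (hC : ∀ f, Φ (D.dFun f) = Φ' (D.dFun f)) : Φ = Φ' := by
  have h := D.subalgebra_eq_top (S := AlgHom.equalizer Φ Φ') hG hX hY hC
  ext z
  have hz : z ∈ AlgHom.equalizer Φ Φ' := h ▸ Algebra.mem_top
  exact hz

namespace DoubleData

variable {D} {B : Type*} [Ring B] [Algebra k B] (E : D.DoubleData B)

theorem toHom_dGrp (g : G) : E.toHom (D.dGrp g) = E.K g := by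
  rw [dGrp, toHom_ofAlg, lift_grp]

theorem toHom_dX : E.toHom D.dX = E.X := by
  rw [dX, toHom_ofAlg, lift_x]

theorem toHom_dualFun (j : ℕ) (hj : j < D.n) (f : G → k) :
    E.toHom (DrinfeldDouble.ofDual k D.HD (D.dualFun j f)) = E.Y ^ j * E.C f := by
  have hf := D.qFactorial_ne_zero hj
  rw [toHom_ofDual, dualMap_apply, Finset.sum_eq_single_of_mem j (Finset.mem_range.2 hj)]
  · have : D.comp j (D.dualFun j f) = D.qFactorial j • f := by
      ext h
      rw [comp_apply, dualFun_apply _ _ _ _ hj, if_pos rfl, inv_mul_cancel_right]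
      rfl
    rw [this, map_smul, mul_smul_comm, smul_smul, inv_mul_cancel₀ hf, one_smul]
  · intro i hi hij
    have : D.comp i (D.dualFun j f) = 0 := by
      ext h
      rw [comp_apply, dualFun_apply _ _ _ _ (Finset.mem_range.1 hi), if_neg hij]
      rfl
    rw [this, map_zero, mul_zero, smul_zero]

theorem toHom_dFun (f : G → k) : E.toHom (D.dFun f) = E.C f := by
  rw [dFun_apply, toHom_dualFun _ _ D.n_pos, pow_zero, one_mul]

theorem toHom_dXi (hn : 1 < D.n) : E.toHom D.dXi = E.Y := by
  rw [dXi, xiFun_eq, toHom_dualFun _ _ hn, map_one, pow_one, mul_one]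

end DoubleData

/-! ### Characters span the functions on a finite abelian group -/

section Characters

variable [IsAlgClosed k] [CharZero k]

/-- The characters of `G` span the functions on `G`. -/
theorem span_characters :
    Submodule.span k (Set.range fun (γ : G →* kˣ) (h : G) => (γ h : k)) = ⊤ := by
  classical
  have : NeZero (Monoid.exponent G) := ⟨Monoid.exponent_ne_zero_of_finite⟩
  have : Fintype (G →* kˣ) := Fintype.ofFinite _
  have : Fintype G := Fintype.ofFinite _
  have key : ∀ g : G, (Pi.single g 1 : G → k) ∈
      Submodule.span k (Set.range fun (γ : G →* kˣ) (h : G) => (γ h : k)) := by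
    intro g
    have hc : (Fintype.card (G →* kˣ) : k) ≠ 0 := Nat.cast_ne_zero.2 Fintype.card_ne_zero
    -- Orthogonality: the indicator of g is the average over γ of γ(g⁻¹) γ.
    have e : (Pi.single g 1 : G → k) = ∑ γ : G →* kˣ,
        ((Fintype.card (G →* kˣ) : k)⁻¹ * (γ g⁻¹ : k)) • fun h => (γ h : k) := by
      ext h
      rw [Finset.sum_apply]
      simp only [Pi.smul_apply, smul_eq_mul, mul_assoc]
      rw [← Finset.mul_sum]
      by_cases hg : g⁻¹ * h = 1
      · have : h = g := (inv_mul_eq_one.1 hg).symm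
        subst this
        simp [hc]
      · obtain ⟨γ, hγ⟩ := CommGroup.exists_apply_ne_one_of_hasEnoughRootsOfUnity G k hg
        have hne : g ≠ h := fun h' => hg (by simp [h'])
        let ev : (G →* kˣ) →* k := (Units.coeHom k).comp (MonoidHom.eval (g⁻¹ * h))
        have hev : ev ≠ 1 := by
          intro h1
          apply hγ
          have := DFunLike.congr_fun h1 γ
          exact Units.ext this
        have h0 := sum_hom_units_eq_zero ev hev
        have h2 : ∑ γ : G →* kˣ, (γ g⁻¹ : k) * (γ h : k) = 0 := by
          rw [← h0]
          refine Finset.sum_congr rfl fun γ _ => ?_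
          simp [ev]
        rw [h2, mul_zero, Pi.single_eq_of_ne hne.symm]
    rw [e]
    exact Submodule.sum_mem _ fun γ _ => Submodule.smul_mem _ _ (Submodule.subset_span ⟨γ, rfl⟩)
  rw [eq_top_iff]
  rintro f -
  have : f = ∑ g, f g • (Pi.single g 1 : G → k) := by
    ext h
    simp [Finset.sum_apply, Pi.single_apply]
  rw [this]
  exact Submodule.sum_mem _ fun g _ => Submodule.smul_mem _ _ (key g)

theorem linearMap_ext_of_characters {M : Type*} [AddCommGroup M] [Module k M]
    {f f' : (G → k) →ₗ[k] M}
    (h : ∀ γ : G →* kˣ, f (fun g => (γ g : k)) = f' (fun g => (γ g : k))) : f = f' := by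
  apply LinearMap.ext_on_range span_characters
  exact h

end Characters

end Universal

end GroupDatum

/-! ### The coefficients of `P(l, λ)` -/

namespace GroupDatum

section Coefficients

variable {k G : Type*} [Field k] [CommGroup G] [Finite G] (D : GroupDatum k G)

theorem weight_apply (lam : Weight k G) (g : G) (γ : G →* kˣ) :
    lam (g, γ) = lam (g, 1) * lam (1, γ) := by
  rw [← map_mul]
  congr 1
  exact Prod.ext (mul_one g).symm (MonoidHom.ext fun h => (one_mul (γ h)).symm)

theorem weight_apply_mul (lam : Weight k G) (g h : G) :
    lam (g * h, 1) = lam (g, 1) * lam (h, 1) := by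
  rw [← map_mul]
  congr 1
  exact Prod.ext rfl (MonoidHom.ext fun h => (one_mul (1 : kˣ)).symm)

theorem weight_apply_inv (lam : Weight k G) (γ : G →* kˣ) :
    lam (1, γ⁻¹) = (lam (1, γ))⁻¹ := by
  rw [← map_inv]
  congr 1
  exact Prod.ext inv_one.symm rfl

theorem rho_sub_one_ne_zero (hn : 1 < D.n) : (D.ρ : k) - 1 ≠ 0 := by
  intro h
  have := (D.rho_pow_eq_one_iff 1).1 (by simpa [sub_eq_zero] using h)
  have := Nat.le_of_dvd one_pos this
  omega

theorem rho_pow_ne_one {i : ℕ} (h0 : 0 < i) (hi : i < D.n) : (D.ρ : k) ^ i - 1 ≠ 0 := by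
  rw [sub_ne_zero, Ne, rho_pow_eq_one_iff]
  intro h
  exact absurd (Nat.le_of_dvd h0 h) (by omega)

theorem alphaCoeff_zero (μ : Weight k G) : D.alphaCoeff 0 μ = 0 := by
  simp [alphaCoeff, qNum]

theorem alphaCoeff_n (hn : 1 < D.n) (μ : Weight k G) : D.alphaCoeff D.n μ = 0 := by
  simp [alphaCoeff, D.qNum_n hn]

/-- The factor (ρ - 1) ρⁱ clears the division in (i)_ρ and the negative power of ρ, so that
identities between the α's become polynomial identities; `cancel_rho` removes the factor again. -/
theorem alphaCoeff_closed (i : ℕ) (μ : Weight k G) :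
    ((D.ρ : k) - 1) * (D.ρ : k) ^ i * D.alphaCoeff i μ =
      ((D.ρ : k) ^ i - 1) * ((μ (1, D.χ) : k) * (D.ρ : k) ^ i - (μ (D.a, 1) : k) * D.ρ) := by
  have hρ : (D.ρ : k) ≠ 0 := D.ρ.ne_zero
  have e : (D.ρ : k) ^ (1 - (i : ℤ)) * (D.ρ : k) ^ i = D.ρ := by
    rw [← zpow_natCast, ← zpow_add₀ hρ]
    simp
  rw [alphaCoeff, ← qNum_mul_sub_one]
  linear_combination (-1 : k) * ((D.ρ : k) - 1) * D.qNum i * (μ (D.a, 1) : k) * e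

theorem phi_one_chi : D.φ (1, D.χ) = D.ρ := by simp [φ, ρ]

theorem phi_a_one : D.φ (D.a, 1) = D.ρ⁻¹ := by simp [φ, ρ]

theorem sigma_one_chi (l : ℕ) (lam : Weight k G) :
    (D.σ l lam (1, D.χ) : k) = lam (1, D.χ) * (D.ρ : k) ^ l := by
  simp [σ, phi_one_chi]

theorem sigma_a_one (l : ℕ) (lam : Weight k G) :
    (D.σ l lam (D.a, 1) : k) * (D.ρ : k) ^ l = lam (D.a, 1) := by
  simp [σ, phi_a_one]

theorem rho_zpow_sub_n (l : ℕ) : D.ρ ^ ((l : ℤ) - D.n) = D.ρ ^ l := by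
  have : D.ρ ^ D.n = 1 := pow_orderOf_eq_one _
  rw [zpow_sub, zpow_natCast, zpow_natCast, this, inv_one, mul_one]

theorem zpow_apply' (μ : Weight k G) (e : ℤ) (p : G × (G →* kˣ)) : (μ ^ e) p = μ p ^ e := rfl

theorem sigmaInv_one_chi (l : ℕ) (lam : Weight k G) :
    (D.σInv l lam (1, D.χ) : k) = lam (1, D.χ) * (D.ρ : k) ^ l := by
  rw [σInv, MonoidHom.mul_apply, zpow_apply', phi_one_chi, rho_zpow_sub_n]
  simp

theorem sigmaInv_a_one (l : ℕ) (lam : Weight k G) :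
    (D.σInv l lam (D.a, 1) : k) * (D.ρ : k) ^ l = lam (D.a, 1) := by
  rw [σInv, MonoidHom.mul_apply, zpow_apply', phi_a_one, inv_zpow, rho_zpow_sub_n]
  simp

variable {D}

theorem weight_a_one {l : ℕ} {lam : Weight k G} (hlam : lam ∈ D.I l) :
    (lam (D.a, 1) : k) = (D.ρ : k) ^ (l - 1) * lam (1, D.χ) := by
  have h : lam (D.a, D.χ⁻¹) = lam (D.a, 1) * (lam (1, D.χ))⁻¹ := by
    rw [weight_apply, weight_apply_inv]
  have h2 := hlam.2
  rw [h, mul_inv_eq_iff_eq_mul] at h2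
  rw [h2]
  simp

variable {l : ℕ} {lam : Weight k G}

theorem weight_a_one_mul_rho (hl : 1 ≤ l) (hlam : lam ∈ D.I l) :
    (lam (D.a, 1) : k) * D.ρ = (D.ρ : k) ^ l * lam (1, D.χ) := by
  obtain ⟨m, rfl⟩ := Nat.exists_eq_add_of_le' hl
  rw [weight_a_one hlam, Nat.add_sub_cancel, pow_succ]
  ring

theorem alphaCoeff_lam (hl : 1 ≤ l) (hlam : lam ∈ D.I l) (i : ℕ) :
    ((D.ρ : k) - 1) * (D.ρ : k) ^ i * D.alphaCoeff i lam =
      ((D.ρ : k) ^ i - 1) * ((D.ρ : k) ^ i - (D.ρ : k) ^ l) * lam (1, D.χ) := by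
  rw [alphaCoeff_closed, weight_a_one_mul_rho hl hlam]
  ring

theorem sigmaInv_a_one_mul_rho (hl : 1 ≤ l) (hlam : lam ∈ D.I l) :
    (D.σInv l lam (D.a, 1) : k) * D.ρ = lam (1, D.χ) := by
  have hρ : (D.ρ : k) ^ l ≠ 0 := pow_ne_zero _ D.ρ.ne_zero
  apply mul_right_cancel₀ hρ
  rw [mul_right_comm, sigmaInv_a_one, weight_a_one_mul_rho hl hlam, mul_comm]

theorem sigma_a_one_mul_rho (hl : 1 ≤ l) (hlam : lam ∈ D.I l) :
    (D.σ l lam (D.a, 1) : k) * D.ρ = lam (1, D.χ) := by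
  have hρ : (D.ρ : k) ^ l ≠ 0 := pow_ne_zero _ D.ρ.ne_zero
  apply mul_right_cancel₀ hρ
  rw [mul_right_comm, sigma_a_one, weight_a_one_mul_rho hl hlam, mul_comm]

theorem alphaCoeff_sigmaInv (hl : 1 ≤ l) (hlam : lam ∈ D.I l) (i : ℕ) :
    ((D.ρ : k) - 1) * (D.ρ : k) ^ i * D.alphaCoeff i (D.σInv l lam) =
      ((D.ρ : k) ^ i - 1) * ((D.ρ : k) ^ (l + i) - 1) * lam (1, D.χ) := by
  rw [alphaCoeff_closed, sigmaInv_a_one_mul_rho hl hlam, sigmaInv_one_chi, pow_add]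
  ring

theorem alphaCoeff_sigma (hl : 1 ≤ l) (hlam : lam ∈ D.I l) (i : ℕ) :
    ((D.ρ : k) - 1) * (D.ρ : k) ^ i * D.alphaCoeff i (D.σ l lam) =
      ((D.ρ : k) ^ i - 1) * ((D.ρ : k) ^ (l + i) - 1) * lam (1, D.χ) := by
  rw [alphaCoeff_closed, sigma_a_one_mul_rho hl hlam, sigma_one_chi, pow_add]
  ring

theorem cancel_rho (D : GroupDatum k G) (hn : 1 < D.n) (i : ℕ) {s t : k}
    (h : ((D.ρ : k) - 1) * (D.ρ : k) ^ i * s = ((D.ρ : k) - 1) * (D.ρ : k) ^ i * t) : s = t :=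
  mul_left_cancel₀ (mul_ne_zero (D.rho_sub_one_ne_zero hn) (pow_ne_zero _ D.ρ.ne_zero)) h

/-- The weights σ(λ) and σ⁻¹(λ) differ by φⁿ, which is trivial on a and on χ because ρⁿ = 1. -/
theorem alphaCoeff_sigma_eq (hl : 1 ≤ l) (hln : l < D.n) (hlam : lam ∈ D.I l) (i : ℕ) :
    D.alphaCoeff i (D.σ l lam) = D.alphaCoeff i (D.σInv l lam) :=
  cancel_rho D (by omega) i
    (by rw [alphaCoeff_sigma hl hlam, alphaCoeff_sigmaInv hl hlam])

/-- Makes the case distinctions at i = l in the action spurious: the coefficients are α_i(λ)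
throughout. -/
theorem alphaCoeff_sub_l (hl : 1 ≤ l) (hln : l < D.n) (hlam : lam ∈ D.I l) {i : ℕ} (hi : l ≤ i) :
    D.alphaCoeff (i - l) (D.σ l lam) = D.alphaCoeff i lam := by
  obtain ⟨j, rfl⟩ := Nat.exists_eq_add_of_le hi
  rw [Nat.add_sub_cancel_left]
  apply cancel_rho D (by omega) (l + j)
  rw [alphaCoeff_lam hl hlam]
  linear_combination (D.ρ : k) ^ l * alphaCoeff_sigma hl hlam j

theorem rho_pow_sub_mul (hln : l < D.n) : (D.ρ : k) ^ (D.n - l) * (D.ρ : k) ^ l = 1 := by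
  rw [← pow_add, Nat.sub_add_cancel hln.le, rho_pow_n]

/-- The same for the case distinctions at i = n - l: the coefficients are α_i(σ⁻¹(λ)) throughout. -/
theorem alphaCoeff_sub_n_sub_l (hl : 1 ≤ l) (hln : l < D.n) (hlam : lam ∈ D.I l) {i : ℕ}
    (hi : D.n - l ≤ i) : D.alphaCoeff (i - (D.n - l)) lam = D.alphaCoeff i (D.σInv l lam) := by
  obtain ⟨j, rfl⟩ := Nat.exists_eq_add_of_le hi
  rw [Nat.add_sub_cancel_left]
  apply cancel_rho D (by omega) (D.n - l + j)
  have h := rho_pow_sub_mul hln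
  have h1 := alphaCoeff_lam hl hlam j
  have h2 := alphaCoeff_sigmaInv hl hlam (D.n - l + j)
  rw [h2, pow_add]
  have e : l + (D.n - l + j) = D.n + j := by omega
  rw [e, pow_add _ D.n, rho_pow_n]
  linear_combination (D.ρ : k) ^ (D.n - l) * h1 - ((D.ρ : k) ^ j - 1) * lam (1, D.χ) * h

theorem alphaCoeff_l (hl : 1 ≤ l) (hln : l < D.n) (hlam : lam ∈ D.I l) :
    D.alphaCoeff l lam = 0 := by
  rw [← alphaCoeff_sub_l hl hln hlam le_rfl, Nat.sub_self, alphaCoeff_zero]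

theorem alphaCoeff_n_sub_l (hl : 1 ≤ l) (hln : l < D.n) (hlam : lam ∈ D.I l) :
    D.alphaCoeff (D.n - l) (D.σInv l lam) = 0 := by
  rw [← alphaCoeff_sub_n_sub_l hl hln hlam le_rfl, Nat.sub_self, alphaCoeff_zero]

/-- The closed form vanishes only if ρⁱ = 1 or ρⁱ = ρˡ, and ρ has order n > l. -/
theorem alphaCoeff_lam_ne_zero (hl : 1 ≤ l) (hln : l < D.n) (hlam : lam ∈ D.I l) {i : ℕ}
    (hi : 0 < i) (hi' : i < l) : D.alphaCoeff i lam ≠ 0 := by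
  intro h0
  have h := alphaCoeff_lam hl hlam i
  have hne := D.rho_pow_ne_one (i := l - i) (by omega) (by omega)
  have e : (D.ρ : k) ^ l = (D.ρ : k) ^ (l - i) * (D.ρ : k) ^ i := by
    rw [← pow_add, Nat.sub_add_cancel hi'.le]
  rw [h0, mul_zero, eq_comm, e] at h
  have h1 := D.rho_pow_ne_one hi (by omega)
  have h2 : (D.ρ : k) ^ i - (D.ρ : k) ^ (l - i) * (D.ρ : k) ^ i ≠ 0 := by
    have : (D.ρ : k) ^ i - (D.ρ : k) ^ (l - i) * (D.ρ : k) ^ i =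
      -((D.ρ : k) ^ (l - i) - 1) * (D.ρ : k) ^ i := by ring
    rw [this]
    exact mul_ne_zero (neg_ne_zero.2 hne) (pow_ne_zero _ D.ρ.ne_zero)
  exact mul_ne_zero (mul_ne_zero h1 h2) (Units.ne_zero _) h

theorem alphaCoeff_sigmaInv_ne_zero (hl : 1 ≤ l) (hlam : lam ∈ D.I l) {i : ℕ}
    (hi : 0 < i) (hi' : i < D.n - l) : D.alphaCoeff i (D.σInv l lam) ≠ 0 := by
  intro h0
  have h := alphaCoeff_sigmaInv hl hlam i
  have hne := D.rho_pow_ne_one (i := l + i) (by omega) (by omega)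
  rw [h0, mul_zero, eq_comm] at h
  exact mul_ne_zero (mul_ne_zero (D.rho_pow_ne_one hi (by omega)) hne) (Units.ne_zero _) h

/-- The right side is the difference of the eigenvalues of χ and a on a vector of weight μφⁱ, so
this identity is the relation ξx - xξ = χ - a on a chain of weight vectors. -/
theorem alphaCoeff_succ_sub (i : ℕ) (μ : Weight k G) (hn : 1 < D.n) :
    D.alphaCoeff (i + 1) μ - D.alphaCoeff i μ =
      μ (1, D.χ) * (D.ρ : k) ^ i - μ (D.a, 1) * ((D.ρ : k) ^ i)⁻¹ := by
  have hρ : (D.ρ : k) ≠ 0 := D.ρ.ne_zero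
  apply cancel_rho D hn (i + 1)
  have h1 := D.alphaCoeff_closed (i + 1) μ
  have h2 := D.alphaCoeff_closed i μ
  have h3 : (D.ρ : k) ^ i * ((D.ρ : k) ^ i)⁻¹ = 1 := mul_inv_cancel₀ (pow_ne_zero _ hρ)
  rw [mul_sub, h1]
  linear_combination -(D.ρ : k) * h2 + ((D.ρ : k) - 1) * D.ρ * (μ (D.a, 1) : k) * h3

end Coefficients

/-! ### The operators on `P(l, λ)` -/

section Operators

variable {k G : Type*} [Field k] [CommGroup G] [Finite G] (D : GroupDatum k G)

theorem v_of_lt {i : ℕ} (h : i < D.n) : D.v i = Finsupp.single (Sum.inl ⟨i, h⟩) 1 := dif_pos h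

theorem u_of_lt {i : ℕ} (h : i < D.n) : D.u i = Finsupp.single (Sum.inr ⟨i, h⟩) 1 := dif_pos h

theorem v_of_ge {i : ℕ} (h : D.n ≤ i) : D.v i = 0 := dif_neg (by omega)

theorem u_of_ge {i : ℕ} (h : D.n ≤ i) : D.u i = 0 := dif_neg (by omega)

variable {D}

theorem pSpace_ext {M : Type*} [AddCommGroup M] [Module k M] {f f' : D.PSpace →ₗ[k] M}
    (hv : ∀ i < D.n, f (D.v i) = f' (D.v i)) (hu : ∀ i < D.n, f (D.u i) = f' (D.u i)) :
    f = f' := by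
  refine Finsupp.lhom_ext' fun s => LinearMap.ext_ring ?_
  rcases s with ⟨i, hi⟩ | ⟨i, hi⟩
  · have := hv i hi
    rwa [D.v_of_lt hi] at this
  · have := hu i hi
    rwa [D.u_of_lt hi] at this

variable (D) in
/-- The linear map on `P(l, λ)` with given values on `v_i` and `u_i`, for `0 ≤ i ≤ n - 1`. -/
noncomputable def basisMap {M : Type*} [AddCommGroup M] [Module k M] (fv fu : ℕ → M) :
    D.PSpace →ₗ[k] M :=
  Finsupp.linearCombination k (Sum.elim (fun i => fv i) (fun i => fu i))

theorem basisMap_v {M : Type*} [AddCommGroup M] [Module k M] (fv fu : ℕ → M) {i : ℕ}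
    (hi : i < D.n) : D.basisMap fv fu (D.v i) = fv i := by
  simp [basisMap, D.v_of_lt hi]

theorem basisMap_u {M : Type*} [AddCommGroup M] [Module k M] (fv fu : ℕ → M) {i : ℕ}
    (hi : i < D.n) : D.basisMap fv fu (D.u i) = fu i := by
  simp [basisMap, D.u_of_lt hi]

theorem basisOp_v (fv fu : ℕ → D.PSpace) {i : ℕ} (hi : i < D.n) :
    D.basisOp fv fu (D.v i) = fv i := basisMap_v fv fu hi

theorem basisOp_u (fv fu : ℕ → D.PSpace) {i : ℕ} (hi : i < D.n) :
    D.basisOp fv fu (D.u i) = fu i := basisMap_u fv fu hi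

variable (D) in
/-- The diagonal operator `v_i ↦ wv i v_i`, `u_i ↦ wu i u_i`. -/
noncomputable def diagOp (wv wu : ℕ → k) : Module.End k D.PSpace :=
  D.basisOp (fun i => wv i • D.v i) (fun i => wu i • D.u i)

theorem diagOp_v (wv wu : ℕ → k) (i : ℕ) : D.diagOp wv wu (D.v i) = wv i • D.v i := by
  by_cases hi : i < D.n
  · exact basisOp_v _ _ hi
  · simp [D.v_of_ge (not_lt.1 hi)]

theorem diagOp_u (wv wu : ℕ → k) (i : ℕ) : D.diagOp wv wu (D.u i) = wu i • D.u i := by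
  by_cases hi : i < D.n
  · exact basisOp_u _ _ hi
  · simp [D.u_of_ge (not_lt.1 hi)]

variable (D) in
/-- The eigenvalue of `g` on vectors of weight `λ φᵉ`. -/
def wtGrp (lam : Weight k G) (e : ℤ) (g : G) : k := ((lam (g, 1) * (D.χ g) ^ (-e) : kˣ) : k)

theorem wtGrp_one (lam : Weight k G) (e : ℤ) : D.wtGrp lam e 1 = 1 := by
  have : lam ((1 : G), (1 : G →* kˣ)) = 1 := map_one lam
  simp [wtGrp, this]

theorem wtGrp_mul (lam : Weight k G) (e : ℤ) (g h : G) :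
    D.wtGrp lam e (g * h) = D.wtGrp lam e g * D.wtGrp lam e h := by
  simp only [wtGrp, weight_apply_mul, map_mul, mul_zpow, Units.val_mul]
  ring

theorem wtGrp_add_one (lam : Weight k G) (e : ℤ) (g : G) :
    (D.χ g : k) * D.wtGrp lam (e + 1) g = D.wtGrp lam e g := by
  rw [wtGrp, wtGrp, ← Units.val_mul, mul_left_comm, ← zpow_one_add]
  congr 3
  ring

theorem wtGrp_a (lam : Weight k G) (e : ℤ) :
    D.wtGrp lam e D.a = (lam (D.a, 1) : k) * (D.ρ : k) ^ (-e) := by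
  simp [wtGrp, ρ]

theorem phi_zpow_mul_apply {lam : Weight k G} {b : G} (hb : ∀ γ : G →* kˣ, lam (1, γ) = γ b)
    (e : ℤ) (g : G) (γ : G →* kˣ) :
    ((D.φ ^ e * lam) (g, γ) : k) = D.wtGrp lam e g * (γ (b * D.a ^ e) : k) := by
  have h1 : lam (g, γ) = lam (g, 1) * γ b := by
    rw [← hb, weight_apply]
  have h2 : (D.φ ^ e) (g, γ) = (D.χ g) ^ (-e) * (γ D.a) ^ e := by
    rw [zpow_apply', φ]
    simp [mul_zpow]
  rw [MonoidHom.mul_apply, h1, h2, wtGrp, map_mul, map_zpow, ← Units.val_mul]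
  congr 1
  simp only [mul_comm, mul_left_comm, mul_assoc]

theorem chi_deg {lam : Weight k G} {b : G} (hb : ∀ γ : G →* kˣ, lam (1, γ) = γ b) (e : ℤ) :
    (D.χ (b * D.a ^ e) : k) = (lam (1, D.χ) : k) * (D.ρ : k) ^ e := by
  rw [hb, map_mul, map_zpow, ρ]
  simp

theorem nilX_v (i : ℕ) : D.nilX (D.v i) = D.v (i + 1) := by
  by_cases hi : i < D.n
  · rw [nilX, basisOp_v _ _ hi]
    split_ifs with h
    · rfl
    · rw [D.v_of_ge (by omega)]
  · rw [D.v_of_ge (by omega), D.v_of_ge (by omega), map_zero]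

theorem nilX_u (i : ℕ) : D.nilX (D.u i) = D.u (i + 1) := by
  by_cases hi : i < D.n
  · rw [nilX, basisOp_u _ _ hi]
    split_ifs with h
    · rfl
    · rw [D.u_of_ge (by omega)]
  · rw [D.u_of_ge (by omega), D.u_of_ge (by omega), map_zero]

theorem nonnilXi_v {i : ℕ} (hi : i < D.n) :
    D.nonnilXi (D.v i) = if i = 0 then 0 else D.v (i - 1) := basisOp_v _ _ hi

theorem nonnilXi_u {i : ℕ} (hi : i < D.n) :
    D.nonnilXi (D.u i) = if i = 0 then 0 else D.u (i - 1) := basisOp_u _ _ hi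

variable {l : ℕ} {lam : Weight k G}

/-- One formula for all branches and all i, which also holds out of range: α_0 = α_l = α_n = 0, and
v_i, u_i are zero for i ≥ n. The truncated i - 1 at i = 0 is multiplied by α_0 = 0. -/
theorem nilXi_v (hl : 1 ≤ l) (hln : l < D.n) (hlam : lam ∈ D.I l) (i : ℕ) :
    D.nilXi l lam (D.v i) = D.alphaCoeff i lam • D.v (i - 1) + D.u (D.n - l - 1 + i) := by
  rcases lt_trichotomy i D.n with hi | rfl | hi
  · rw [nilXi, basisOp_v _ _ hi]
    split_ifs with h0 h1 h2
    · simp [h0, alphaCoeff_zero]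
    · congr 2
      omega
    · subst h2
      rw [alphaCoeff_l hl hln hlam, zero_smul, zero_add]
      congr 1
      omega
    · rw [alphaCoeff_sub_l hl hln hlam (by omega), D.u_of_ge (by omega), add_zero]
  · rw [D.v_of_ge le_rfl, D.alphaCoeff_n (by omega), D.u_of_ge (by omega)]
    simp
  · rw [D.v_of_ge hi.le, D.v_of_ge (by omega), D.u_of_ge (by omega)]
    simp

theorem nilXi_u (hl : 1 ≤ l) (hln : l < D.n) (hlam : lam ∈ D.I l) (i : ℕ) :
    D.nilXi l lam (D.u i) = D.alphaCoeff i (D.σInv l lam) • D.u (i - 1) := by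
  rcases lt_trichotomy i D.n with hi | rfl | hi
  · rw [nilXi, basisOp_u _ _ hi]
    split_ifs with h0 h1 h2
    · simp [h0, alphaCoeff_zero]
    · rfl
    · subst h2
      rw [alphaCoeff_n_sub_l hl hln hlam, zero_smul]
    · rw [alphaCoeff_sub_n_sub_l hl hln hlam (by omega)]
  · rw [D.u_of_ge le_rfl, D.alphaCoeff_n (by omega)]
    simp
  · rw [D.u_of_ge hi.le, D.u_of_ge (by omega)]
    simp

theorem nonnilX_u (hl : 1 ≤ l) (hln : l < D.n) (hlam : lam ∈ D.I l) {i : ℕ} (hi : i + 1 < D.n) :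
    D.nonnilX l lam (D.u i) = D.alphaCoeff (i + 1) lam • D.u (i + 1) := by
  rw [nonnilX, basisOp_u _ _ (by omega)]
  split_ifs with h0 h1
  · rfl
  · rw [h1, alphaCoeff_l hl hln hlam, zero_smul]
  · rw [alphaCoeff_sub_l hl hln hlam (by omega)]

theorem nonnilX_u_last (hln : l < D.n) {i : ℕ} (hi : i + 1 = D.n) :
    D.nonnilX l lam (D.u i) = D.zCoeff lam • D.u 0 := by
  rw [nonnilX, basisOp_u _ _ (by omega), if_neg (by omega), if_neg (by omega), if_neg (by omega)]

/-- Merges the branches below the last index: at i + 1 = n - l the coefficient of v_{i+1} is zero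
anyway. -/
theorem nonnilX_v (hl : 1 ≤ l) (hln : l < D.n) (hlam : lam ∈ D.I l) {i : ℕ} (hi : i + 1 < D.n) :
    D.nonnilX l lam (D.v i) = D.alphaCoeff (i + 1) (D.σInv l lam) • D.v (i + 1) +
      if D.n - l ≤ i + 1 then D.u (i + 1 - (D.n - l)) else 0 := by
  rw [nonnilX, basisOp_v _ _ (by omega)]
  split_ifs with h0 h1 h2 h3 h4 <;> try omega
  · simp
  · rw [h2, alphaCoeff_n_sub_l hl hln hlam]
    simp
  · rw [alphaCoeff_sub_n_sub_l hl hln hlam (by omega)]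

theorem nonnilX_v_last (hl : 1 ≤ l) (hln : l < D.n) {i : ℕ} (hi : i + 1 = D.n) :
    D.nonnilX l lam (D.v i) = D.yCoeff l lam • D.v 0 + D.u l := by
  rw [nonnilX, basisOp_v _ _ (by omega), if_neg (by omega), if_neg (by omega), if_neg (by omega)]

end Operators

end GroupDatum

/-! ### The action of `D(H_D)` on `P(l, λ)` -/

namespace GroupDatum

section Action

variable {k G : Type*} [Field k] [CommGroup G] [Finite G] {D : GroupDatum k G}

variable (D) in
/-- The action of `G` on the space with `v_i` of weight `λ φ^(ev i)` and `u_i` of weight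
`λ φ^(eu i)`. -/
noncomputable def gradedK (lam : Weight k G) (ev eu : ℕ → ℤ) (g : G) : Module.End k D.PSpace :=
  D.diagOp (fun i => D.wtGrp lam (ev i) g) (fun i => D.wtGrp lam (eu i) g)

variable (D) in
/-- The action of the functions on `G` on the space with `v_i` of degree `b a^(ev i)` and `u_i` of
degree `b a^(eu i)`, as a linear map. -/
noncomputable def gradedCLin (b : G) (ev eu : ℕ → ℤ) : (G → k) →ₗ[k] Module.End k D.PSpace where
  toFun f := D.diagOp (fun i => f (b * D.a ^ ev i)) (fun i => f (b * D.a ^ eu i))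
  map_add' f f' := by
    apply pSpace_ext <;> intro i _ <;> simp [diagOp_v, diagOp_u, add_smul]
  map_smul' r f := by
    apply pSpace_ext <;> intro i _ <;> simp [diagOp_v, diagOp_u, mul_smul]

theorem gradedCLin_apply (b : G) (ev eu : ℕ → ℤ) (f : G → k) : D.gradedCLin b ev eu f =
    D.diagOp (fun i => f (b * D.a ^ ev i)) (fun i => f (b * D.a ^ eu i)) := rfl

variable (D) in
/-- The action of the functions on `G` on the space with `v_i` of degree `b a^(ev i)` and `u_i` of
degree `b a^(eu i)`. -/
noncomputable def gradedC (b : G) (ev eu : ℕ → ℤ) : (G → k) →ₐ[k] Module.End k D.PSpace :=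
  AlgHom.ofLinearMap (D.gradedCLin b ev eu)
    (by
      rw [gradedCLin_apply]
      apply pSpace_ext <;> intro i _ <;> simp [diagOp_v, diagOp_u])
    (fun f f' => by
      simp only [gradedCLin_apply]
      apply pSpace_ext <;> intro i _ <;> simp [diagOp_v, diagOp_u, smul_smul, mul_comm])

theorem gradedC_apply (b : G) (ev eu : ℕ → ℤ) (f : G → k) : D.gradedC b ev eu f =
    D.diagOp (fun i => f (b * D.a ^ ev i)) (fun i => f (b * D.a ^ eu i)) :=
  (AlgHom.ofLinearMap_apply _ _ _ f).trans (gradedCLin_apply b ev eu f)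

variable {lam : Weight k G} {b : G} {ev eu : ℕ → ℤ}

theorem gradedK_v (g : G) (i : ℕ) :
    D.gradedK lam ev eu g (D.v i) = D.wtGrp lam (ev i) g • D.v i := diagOp_v _ _ i

theorem gradedK_u (g : G) (i : ℕ) :
    D.gradedK lam ev eu g (D.u i) = D.wtGrp lam (eu i) g • D.u i := diagOp_u _ _ i

theorem gradedC_v (f : G → k) (i : ℕ) :
    D.gradedC b ev eu f (D.v i) = f (b * D.a ^ ev i) • D.v i := by
  rw [gradedC_apply, diagOp_v]

theorem gradedC_u (f : G → k) (i : ℕ) :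
    D.gradedC b ev eu f (D.u i) = f (b * D.a ^ eu i) • D.u i := by
  rw [gradedC_apply, diagOp_u]

theorem gradedK_one : D.gradedK lam ev eu 1 = 1 := by
  apply pSpace_ext <;> intro i _ <;> simp [gradedK_v, gradedK_u, wtGrp_one]

theorem gradedK_mul (g h : G) :
    D.gradedK lam ev eu (g * h) = D.gradedK lam ev eu g * D.gradedK lam ev eu h := by
  apply pSpace_ext <;> intro i _ <;>
    simp [gradedK_v, gradedK_u, wtGrp_mul, smul_smul, mul_comm]

theorem gradedK_gradedC (g : G) (f : G → k) :
    D.gradedK lam ev eu g * D.gradedC b ev eu f = D.gradedC b ev eu f * D.gradedK lam ev eu g := by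
  apply pSpace_ext <;> intro i _ <;>
    simp [gradedK_v, gradedK_u, gradedC_v, gradedC_u, smul_smul, mul_comm]

theorem gradedK_mul_gradedC_v (hb : ∀ γ : G →* kˣ, lam (1, γ) = γ b) (g : G) (γ : G →* kˣ)
    (i : ℕ) : (D.gradedK lam ev eu g * D.gradedC b ev eu fun h => (γ h : k)) (D.v i) =
      ((D.φ ^ ev i * lam) (g, γ) : k) • D.v i := by
  rw [Module.End.mul_apply, gradedC_v, map_smul, gradedK_v, smul_smul, phi_zpow_mul_apply hb,
    mul_comm]

theorem gradedK_mul_gradedC_u (hb : ∀ γ : G →* kˣ, lam (1, γ) = γ b) (g : G) (γ : G →* kˣ)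
    (i : ℕ) : (D.gradedK lam ev eu g * D.gradedC b ev eu fun h => (γ h : k)) (D.u i) =
      ((D.φ ^ eu i * lam) (g, γ) : k) • D.u i := by
  rw [Module.End.mul_apply, gradedC_u, map_smul, gradedK_u, smul_smul, phi_zpow_mul_apply hb,
    mul_comm]

theorem deg_mul_a (b : G) (e : ℤ) : b * D.a ^ e * D.a = b * D.a ^ (e + 1) := by
  rw [mul_assoc, ← zpow_add_one]

/-- Nilpotent type means α = 0 or aⁿ = 1, and either one removes the correction in `C_X`. -/
theorem alpha_mul_sub_of_nil (hD : D.IsNilpotent) (f : G → k) (h : G) :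
    D.α * (f (h * D.a) - f (h * D.a * (D.a ^ D.n)⁻¹)) = 0 := by
  by_cases h0 : D.a ^ D.n = 1
  · rw [h0, inv_one, mul_one, sub_self, mul_zero]
  · have h1 := congrArg (fun f => f.coeff 1) hD
    have : D.α = 0 := by simpa [MonoidAlgebra.one_def, h0] using h1
    rw [this, zero_mul]

theorem alpha_smul_sub_of_nil {B : Type*} [Ring B] [Algebra k B] (hD : D.IsNilpotent)
    {K : G → B} (hK : K 1 = 1) : D.α • (K (D.a ^ D.n) - 1) = 0 := by
  by_cases h0 : D.a ^ D.n = 1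
  · rw [h0, hK, sub_self, smul_zero]
  · have h1 := congrArg (fun f => f.coeff 1) hD
    have : D.α = 0 := by simpa [MonoidAlgebra.one_def, h0] using h1
    rw [this, zero_smul]

theorem chi_pow_n_of_not_nil (hD : ¬ D.IsNilpotent) : D.χ ^ D.n = 1 := D.compat.resolve_right hD

/-! ### The relations on P(l, λ) in nilpotent type -/

variable {l : ℕ}

theorem nilX_pow_v (m i : ℕ) : (D.nilX ^ m) (D.v i) = D.v (i + m) := by
  induction m with
  | zero => simp
  | succ m ih => rw [pow_succ', Module.End.mul_apply, ih, nilX_v, add_assoc]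

theorem nilX_pow_u (m i : ℕ) : (D.nilX ^ m) (D.u i) = D.u (i + m) := by
  induction m with
  | zero => simp
  | succ m ih => rw [pow_succ', Module.End.mul_apply, ih, nilX_u, add_assoc]

theorem nilXi_pow_u (hl : 1 ≤ l) (hln : l < D.n) (hlam : lam ∈ D.I l) (i : ℕ) :
    (D.nilXi l lam ^ (i + 1)) (D.u i) = 0 := by
  induction i with
  | zero => simp [nilXi_u hl hln hlam, alphaCoeff_zero]
  | succ i ih =>
    rw [pow_succ, Module.End.mul_apply, nilXi_u hl hln hlam, map_smul, Nat.add_sub_cancel, ih,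
      smul_zero]

/-- The u-component of ξ v_i is shifted by x in step with v_i and cancels. What remains on both
chains is α_{i+1} - α_i, given by `alphaCoeff_succ_sub`. -/
theorem nil_commutator (hl : 1 ≤ l) (hln : l < D.n) (hlam : lam ∈ D.I l)
    (hb : ∀ γ : G →* kˣ, lam (1, γ) = γ b) :
    D.nilXi l lam * D.nilX = D.nilX * D.nilXi l lam +
      (D.gradedC b (fun i => i) (fun i => (i : ℤ) - D.n + l) (fun h => (D.χ h : k)) -
        D.gradedK lam (fun i => i) (fun i => (i : ℤ) - D.n + l) D.a) := by
  have hn : 1 < D.n := by omega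
  apply pSpace_ext
  · intro i hi
    have e : D.alphaCoeff i lam • D.v (i - 1 + 1) = D.alphaCoeff i lam • D.v i := by
      cases i with
      | zero => simp [alphaCoeff_zero]
      | succ i => rfl
    have e2 := D.alphaCoeff_succ_sub i lam hn
    simp only [LinearMap.add_apply, LinearMap.sub_apply, Module.End.mul_apply, nilX_v,
      nilXi_v hl hln hlam, map_add, map_smul, nilX_u, gradedC_v, gradedK_v, e, chi_deg hb,
      wtGrp_a, Nat.add_sub_cancel, zpow_neg]
    rw [← sub_smul, zpow_natCast, ← e2]
    have e3 : D.n - l - 1 + (i + 1) = D.n - l - 1 + i + 1 := by ring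
    rw [e3]
    module
  · intro i hi
    have e : D.alphaCoeff i (D.σInv l lam) • D.u (i - 1 + 1) =
        D.alphaCoeff i (D.σInv l lam) • D.u i := by
      cases i with
      | zero => simp [alphaCoeff_zero]
      | succ i => rfl
    have e2 := D.alphaCoeff_succ_sub i (D.σInv l lam) hn
    have hρ : (D.ρ : k) ≠ 0 := D.ρ.ne_zero
    have e4 : ∀ s : ℤ, (D.ρ : k) ^ (s - D.n + l) = (D.ρ : k) ^ s * (D.ρ : k) ^ l := by
      intro s
      rw [zpow_add₀ hρ, zpow_sub₀ hρ, zpow_natCast, zpow_natCast, rho_pow_n, div_one]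
    have e5 : (lam (D.a, 1) : k) * ((D.ρ : k) ^ ((i : ℤ) - D.n + l))⁻¹ =
        (D.σInv l lam (D.a, 1) : k) * ((D.ρ : k) ^ i)⁻¹ := by
      rw [e4, ← D.sigmaInv_a_one l lam, zpow_natCast]
      field_simp
    simp only [LinearMap.add_apply, LinearMap.sub_apply, Module.End.mul_apply, nilX_u,
      nilXi_u hl hln hlam, map_smul, gradedC_u, gradedK_u, e, chi_deg hb,
      wtGrp_a, Nat.add_sub_cancel, zpow_neg, e5]
    rw [← sub_smul, e4, zpow_natCast, mul_left_comm, mul_comm ((D.ρ : k) ^ i), ← sigmaInv_one_chi,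
      ← e2]
    module

theorem nil_gradedK_nilXi (hl : 1 ≤ l) (hln : l < D.n) (hlam : lam ∈ D.I l) (g : G) :
    D.gradedK lam (fun i => i) (fun i => (i : ℤ) - D.n + l) g * D.nilXi l lam =
      (D.χ g : k) • (D.nilXi l lam * D.gradedK lam (fun i => i) (fun i => (i : ℤ) - D.n + l) g) := by
  apply pSpace_ext <;> intro i _
  · have e : ((D.n - l - 1 + i : ℕ) : ℤ) - D.n + l + 1 = i := by omega
    have h := D.wtGrp_add_one lam (((D.n - l - 1 + i : ℕ) : ℤ) - D.n + l) g
    rw [e] at h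
    simp only [Module.End.mul_apply, LinearMap.smul_apply, gradedK_v, gradedK_u, map_smul,
      nilXi_v hl hln hlam, map_add, smul_add, smul_smul, h]
    congr 1
    cases i with
    | zero => simp [alphaCoeff_zero]
    | succ i =>
      simp only [Nat.add_sub_cancel, Nat.cast_add, Nat.cast_one]
      rw [← mul_assoc, wtGrp_add_one, mul_comm]
  · simp only [Module.End.mul_apply, LinearMap.smul_apply, gradedK_u, map_smul,
      nilXi_u hl hln hlam, smul_smul]
    cases i with
    | zero => simp [alphaCoeff_zero]
    | succ i =>
      have e : ((i + 1 : ℕ) : ℤ) - D.n + l = (i : ℤ) - D.n + l + 1 := by push_cast; ring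
      simp only [Nat.add_sub_cancel, e]
      rw [← mul_assoc, wtGrp_add_one, mul_comm]

theorem nil_nilXi_gradedC (hl : 1 ≤ l) (hln : l < D.n) (hlam : lam ∈ D.I l) (f : G → k) :
    D.nilXi l lam * D.gradedC b (fun i => i) (fun i => (i : ℤ) - D.n + l) f =
      D.gradedC b (fun i => i) (fun i => (i : ℤ) - D.n + l) (fun h => f (h * D.a)) *
        D.nilXi l lam := by
  apply pSpace_ext <;> intro i _
  · have e : ((D.n - l - 1 + i : ℕ) : ℤ) - D.n + l + 1 = i := by omega
    simp only [Module.End.mul_apply, gradedC_v, gradedC_u, map_smul,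
      nilXi_v hl hln hlam, map_add, smul_add, smul_smul, deg_mul_a, e]
    congr 1
    cases i with
    | zero => simp [alphaCoeff_zero]
    | succ i => simp [mul_comm]
  · simp only [Module.End.mul_apply, gradedC_u, map_smul,
      nilXi_u hl hln hlam, smul_smul, deg_mul_a]
    cases i with
    | zero => simp [alphaCoeff_zero]
    | succ i =>
      have e : ((i + 1 : ℕ) : ℤ) - D.n + l = (i : ℤ) - D.n + l + 1 := by push_cast; ring
      simp only [Nat.add_sub_cancel, e, mul_comm]

/-- The coefficient of the commutator with the n-th power is (n)_ρ = 0. So Yⁿ or Xⁿ can be tested on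
generators only. -/
theorem commute_pow_n {B : Type*} [Ring B] [Algebra k B] (hn : 1 < D.n) {X Y S T : B}
    (h : Y * X = X * Y + (S - T)) (hS : S * X = (D.ρ : k) • (X * S))
    (hT : T * X = (D.ρ : k)⁻¹ • (X * T)) : Y * X ^ D.n = X ^ D.n * Y := by
  have e : D.n - 1 + 1 = D.n := by omega
  have h1 := mul_pow_of_commutator D.ρ.ne_zero h hS hT (D.n - 1)
  have h2 := D.qNum_n hn
  rw [qNum] at h2
  rwa [e, h2, zero_smul, add_zero] at h1

theorem gradedC_chi_of_comm {Y : Module.End k D.PSpace}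
    (h : ∀ f : G → k, Y * D.gradedC b ev eu f = D.gradedC b ev eu (fun h => f (h * D.a)) * Y) :
    D.gradedC b ev eu (fun h => (D.χ h : k)) * Y =
      (D.ρ : k)⁻¹ • (Y * D.gradedC b ev eu (fun h => (D.χ h : k))) := by
  have e : (fun h => (D.χ (h * D.a) : k)) = (D.ρ : k) • fun h => (D.χ h : k) := by
    ext h
    simp [ρ, mul_comm]
  rw [h, e, map_smul, smul_mul_assoc, smul_smul, inv_mul_cancel₀ D.ρ.ne_zero, one_smul]

/-- Since ξⁿ commutes with x, and powers of x carry v_0 and u_0 to all basis vectors, it is enough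
that ξⁿ kills v_0 and u_0. -/
theorem nilXi_pow_n (hl : 1 ≤ l) (hln : l < D.n) (hlam : lam ∈ D.I l)
    (hb : ∀ γ : G →* kˣ, lam (1, γ) = γ b) : D.nilXi l lam ^ D.n = 0 := by
  have hc : D.nilX * D.nilXi l lam = D.nilXi l lam * D.nilX +
      (D.gradedK lam (fun i => i) (fun i => (i : ℤ) - D.n + l) D.a -
        D.gradedC b (fun i => i) (fun i => (i : ℤ) - D.n + l) (fun h => (D.χ h : k))) := by
    rw [nil_commutator hl hln hlam hb]
    abel
  have h1 := commute_pow_n (B := Module.End k D.PSpace) (D := D) (by omega) hc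
    (nil_gradedK_nilXi hl hln hlam D.a)
    (gradedC_chi_of_comm (nil_nilXi_gradedC hl hln hlam))
  have h2 : Commute (D.nilXi l lam ^ D.n) D.nilX := h1.symm
  have h3 := fun m => (h2.pow_right m).eq
  apply pSpace_ext <;> intro i _
  · have e := nilX_pow_v (D := D) i 0
    rw [zero_add] at e
    rw [← e, ← Module.End.mul_apply, h3, Module.End.mul_apply]
    have : (D.nilXi l lam ^ D.n) (D.v 0) = 0 := by
      -- Split as n = (l - 1) + (n - l) + 1: ξ v_0 = u_{n-l-1}, which is killed by ξⁿ⁻ˡ.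
      have e2 : D.nilXi l lam ^ D.n = D.nilXi l lam ^ (l - 1) *
          (D.nilXi l lam ^ (D.n - l - 1 + 1) * D.nilXi l lam) := by
        rw [← pow_succ, ← pow_add]
        congr 1
        omega
      rw [e2, Module.End.mul_apply, Module.End.mul_apply, nilXi_v hl hln hlam, alphaCoeff_zero,
        zero_smul, zero_add, add_zero, nilXi_pow_u hl hln hlam, map_zero]
    rw [this, map_zero]
    rfl
  · have e := nilX_pow_u (D := D) i 0
    rw [zero_add] at e
    rw [← e, ← Module.End.mul_apply, h3, Module.End.mul_apply]
    have : (D.nilXi l lam ^ D.n) (D.u 0) = 0 := by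
      have e2 : D.nilXi l lam ^ D.n = D.nilXi l lam ^ (D.n - 1) * D.nilXi l lam := by
        rw [← pow_succ]
        congr 1
        omega
      rw [e2, Module.End.mul_apply, nilXi_u hl hln hlam, alphaCoeff_zero, zero_smul,
        map_zero]
    rw [this, map_zero]
    rfl

/-- The action on `P(l, λ)` for data of nilpotent type. -/
noncomputable def nilData (hD : D.IsNilpotent) (hl : 1 ≤ l) (hln : l < D.n) (hlam : lam ∈ D.I l)
    (hb : ∀ γ : G →* kˣ, lam (1, γ) = γ b) : D.DoubleData (Module.End k D.PSpace) where
  K := D.gradedK lam (fun i => i) (fun i => (i : ℤ) - D.n + l)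
  X := D.nilX
  Y := D.nilXi l lam
  C := D.gradedC b (fun i => i) (fun i => (i : ℤ) - D.n + l)
  sat :=
    { one := gradedK_one
      mul := gradedK_mul
      pow := by
        rw [alpha_smul_sub_of_nil hD gradedK_one]
        apply pSpace_ext <;> intro i _
        · rw [nilX_pow_v, D.v_of_ge (by omega)]
          rfl
        · rw [nilX_pow_u, D.u_of_ge (by omega)]
          rfl
      comm := fun g => by
        apply pSpace_ext <;> intro i _
        · simp only [Module.End.mul_apply, LinearMap.smul_apply, gradedK_v, map_smul, nilX_v,
            smul_smul, Nat.cast_add, Nat.cast_one, wtGrp_add_one]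
        · have e : ((i + 1 : ℕ) : ℤ) - D.n + l = (i : ℤ) - D.n + l + 1 := by push_cast; ring
          simp only [Module.End.mul_apply, LinearMap.smul_apply, gradedK_u, map_smul, nilX_u,
            smul_smul, e, wtGrp_add_one] }
  K_C := gradedK_gradedC
  K_Y := nil_gradedK_nilXi hl hln hlam
  Y_C := nil_nilXi_gradedC hl hln hlam
  Y_pow := nilXi_pow_n hl hln hlam hb
  Y_X := nil_commutator hl hln hlam hb
  C_X f := by
    -- In nilpotent type the correction is zero, so only the shift of degree by x has to be checked.
    have h0 : (D.α / D.qFactorial (D.n - 1)) •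
        (fun h => f (h * D.a) - f (h * D.a * (D.a ^ D.n)⁻¹)) = 0 := by
      ext h
      have := alpha_mul_sub_of_nil hD f h
      rw [Pi.smul_apply, smul_eq_mul, div_mul_eq_mul_div, this, zero_div]
      rfl
    rw [← mul_smul_comm, ← mul_smul_comm, ← map_smul _ (D.α / D.qFactorial (D.n - 1)), h0,
      map_zero, mul_zero, mul_zero]
    refine Eq.trans ?_ (sub_zero (G := Module.End k D.PSpace) _).symm
    apply pSpace_ext <;> intro i _
    · simp only [Module.End.mul_apply, gradedC_v, map_smul, nilX_v, deg_mul_a, Nat.cast_add,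
        Nat.cast_one]
    · have e : ((i + 1 : ℕ) : ℤ) - D.n + l = (i : ℤ) - D.n + l + 1 := by push_cast; ring
      simp only [Module.End.mul_apply, gradedC_u, map_smul, nilX_u, deg_mul_a, e]

/-! ### The relations on P(l, λ) in non-nilpotent type -/

theorem wtGrp_sub_n (hD : ¬ D.IsNilpotent) (e : ℤ) (g : G) :
    D.wtGrp lam (e - D.n) g = D.wtGrp lam e g := by
  have h : D.χ g ^ D.n = 1 := by
    rw [← MonoidHom.pow_apply, chi_pow_n_of_not_nil hD]
    rfl
  rw [wtGrp, wtGrp, neg_sub, sub_eq_add_neg, zpow_add, zpow_natCast, h, one_mul]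

theorem chi_deg_sub_n (hb : ∀ γ : G →* kˣ, lam (1, γ) = γ b) (e : ℤ) :
    (D.χ (b * D.a ^ (e - D.n)) : k) = D.χ (b * D.a ^ e) := by
  rw [chi_deg hb, chi_deg hb, zpow_sub₀ D.ρ.ne_zero, zpow_natCast, rho_pow_n, div_one]

theorem yCoeff_eq (hl : 1 ≤ l) (hlam : lam ∈ D.I l) :
    D.yCoeff l lam = (1 - (D.ρ : k) ^ l) * lam (1, D.χ) / D.qFactorial (D.n - 1) := by
  have h := weight_a_one_mul_rho hl hlam
  have hρ : (D.ρ : k) ≠ 0 := D.ρ.ne_zero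
  have e : (D.ρ : k) ^ (1 - (l : ℤ)) * lam (D.a, 1) = lam (1, D.χ) := by
    rw [zpow_sub₀ hρ, zpow_one, zpow_natCast, div_mul_eq_mul_div, mul_comm, h,
      mul_div_cancel_left₀ _ (pow_ne_zero _ hρ)]
  rw [yCoeff, e]
  ring

/-- The constant y is the scalar by which α (a - ρχ)/(n-1)! acts in weight λφˡ⁻¹, the weight of
v_{n-1}. So y v_0 in x v_{n-1} is what the correction in `C_X` demands. -/
theorem yCoeff_eq_weight (hα : D.α = 1) (hb : ∀ γ : G →* kˣ, lam (1, γ) = γ b) :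
    D.yCoeff l lam = D.α / D.qFactorial (D.n - 1) *
      (D.wtGrp lam (l - 1) D.a - D.ρ * D.χ (b * D.a ^ ((l : ℤ) - 1))) := by
  have hρ : (D.ρ : k) ≠ 0 := D.ρ.ne_zero
  have e3 : (D.ρ : k) ^ l = D.ρ * (D.ρ : k) ^ ((l : ℤ) - 1) := by
    rw [zpow_sub_one₀ hρ, zpow_natCast]
    field_simp
  rw [yCoeff, hα, wtGrp_a, chi_deg hb, neg_sub, e3]
  ring

/-- Lets the two contributions to xⁿ⁻ˡ⁺¹ v_{n-1} cancel in `nonnilX_pow_n`. -/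
theorem zCoeff_eq (hl : 1 ≤ l) (hlam : lam ∈ D.I l) :
    D.zCoeff lam = -D.yCoeff l lam := by
  rw [yCoeff_eq hl hlam, zCoeff, mul_comm, weight_a_one_mul_rho hl hlam]
  ring

theorem nonnilXi_pow_v (m : ℕ) {i : ℕ} (hi : i < D.n) :
    (D.nonnilXi ^ m) (D.v i) = if m ≤ i then D.v (i - m) else 0 := by
  induction m with
  | zero => simp
  | succ m ih =>
    rw [pow_succ', Module.End.mul_apply, ih]
    split_ifs with h1 h2 h2
    · rw [nonnilXi_v (by omega), if_neg (by omega)]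
      congr 1
    · rw [nonnilXi_v (by omega), if_pos (by omega)]
    · omega
    · rw [map_zero]

theorem nonnilXi_pow_u (m : ℕ) {i : ℕ} (hi : i < D.n) :
    (D.nonnilXi ^ m) (D.u i) = if m ≤ i then D.u (i - m) else 0 := by
  induction m with
  | zero => simp
  | succ m ih =>
    rw [pow_succ', Module.End.mul_apply, ih]
    split_ifs with h1 h2 h2
    · rw [nonnilXi_u (by omega), if_neg (by omega)]
      congr 1
    · rw [nonnilXi_u (by omega), if_pos (by omega)]
    · omega
    · rw [map_zero]

/-- The u-terms of x v_i are moved down by ξ in step with v_i. At the last index ξ kills v_0 and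
u_0, which matches α_n = 0. -/
theorem nonnil_commutator (hl : 1 ≤ l) (hln : l < D.n) (hlam : lam ∈ D.I l)
    (hb : ∀ γ : G →* kˣ, lam (1, γ) = γ b) :
    D.nonnilXi * D.nonnilX l lam = D.nonnilX l lam * D.nonnilXi +
      (D.gradedC b (fun i => (i : ℤ) - D.n + l) (fun i => i) (fun h => (D.χ h : k)) -
        D.gradedK lam (fun i => (i : ℤ) - D.n + l) (fun i => i) D.a) := by
  have hn : 1 < D.n := by omega
  have hρ : (D.ρ : k) ≠ 0 := D.ρ.ne_zero
  apply pSpace_ext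
  · intro i hi
    have e2 := D.alphaCoeff_succ_sub i (D.σInv l lam) hn
    have e4 : ∀ s : ℤ, (D.ρ : k) ^ (s - D.n + l) = (D.ρ : k) ^ s * (D.ρ : k) ^ l := by
      intro s
      rw [zpow_add₀ hρ, zpow_sub₀ hρ, zpow_natCast, zpow_natCast, rho_pow_n, div_one]
    have e5 : (lam (D.a, 1) : k) * ((D.ρ : k) ^ ((i : ℤ) - D.n + l))⁻¹ =
        (D.σInv l lam (D.a, 1) : k) * ((D.ρ : k) ^ i)⁻¹ := by
      rw [e4, ← D.sigmaInv_a_one l lam, zpow_natCast]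
      field_simp
    have hXY : (D.nonnilX l lam) (D.nonnilXi (D.v i)) = D.alphaCoeff i (D.σInv l lam) • D.v i +
        if D.n - l ≤ i then D.u (i - (D.n - l)) else 0 := by
      rw [nonnilXi_v hi]
      cases i with
      | zero => simp [alphaCoeff_zero, Nat.sub_ne_zero_of_lt hln]
      | succ i => rw [if_neg (by omega), Nat.add_sub_cancel, nonnilX_v hl hln hlam hi]
    have hYX : D.nonnilXi (D.nonnilX l lam (D.v i)) =
        D.alphaCoeff (i + 1) (D.σInv l lam) • D.v i +
          if D.n - l ≤ i then D.u (i - (D.n - l)) else 0 := by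
      by_cases hi' : i + 1 < D.n
      · rw [nonnilX_v hl hln hlam hi', map_add, map_smul, nonnilXi_v hi', if_neg (by omega),
          Nat.add_sub_cancel]
        congr 1
        split_ifs with h1 h2 h2
        · rw [nonnilXi_u (by omega), if_neg (by omega)]
          congr 1
          omega
        · rw [nonnilXi_u (by omega), if_pos (by omega)]
        · omega
        · rw [map_zero]
      · rw [nonnilX_v_last hl hln (by omega), map_add, map_smul, nonnilXi_v D.n_pos, if_pos rfl,
          nonnilXi_u hln, if_neg (by omega), if_pos (by omega), show i + 1 = D.n by omega,
          D.alphaCoeff_n hn, smul_zero, zero_smul]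
        congr 2
        omega
    rw [LinearMap.add_apply, LinearMap.sub_apply, Module.End.mul_apply, Module.End.mul_apply, hYX,
      hXY, gradedC_v, gradedK_v, chi_deg hb, wtGrp_a, zpow_neg, e5, ← sub_smul, e4, zpow_natCast,
      mul_left_comm, mul_comm ((D.ρ : k) ^ i), ← sigmaInv_one_chi,
      ← e2]
    module
  · intro i hi
    have e2 := D.alphaCoeff_succ_sub i lam hn
    have hXY : (D.nonnilX l lam) (D.nonnilXi (D.u i)) = D.alphaCoeff i lam • D.u i := by
      rw [nonnilXi_u hi]
      cases i with
      | zero => simp [alphaCoeff_zero]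
      | succ i => rw [if_neg (by omega), Nat.add_sub_cancel, nonnilX_u hl hln hlam hi]
    have hYX : D.nonnilXi (D.nonnilX l lam (D.u i)) = D.alphaCoeff (i + 1) lam • D.u i := by
      by_cases hi' : i + 1 < D.n
      · rw [nonnilX_u hl hln hlam hi', map_smul, nonnilXi_u hi', if_neg (by omega),
          Nat.add_sub_cancel]
      · rw [nonnilX_u_last hln (by omega), map_smul, nonnilXi_u D.n_pos, if_pos rfl,
          show i + 1 = D.n by omega, D.alphaCoeff_n hn, smul_zero, zero_smul]
    rw [LinearMap.add_apply, LinearMap.sub_apply, Module.End.mul_apply, Module.End.mul_apply, hYX,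
      hXY, gradedC_u, gradedK_u, chi_deg hb, wtGrp_a, zpow_neg, ← sub_smul, zpow_natCast, ← e2]
    module

/-- The vectors y v_0 + u_l and z u_0 mix exponents of φ that differ by n, hence the periodicity of
w. It holds for the action of G, because χⁿ = 1, and for χ, but not for arbitrary functions on G;
those need the correction in `C_X`. -/
theorem nonnilX_graded (hl : 1 ≤ l) (hln : l < D.n) (hlam : lam ∈ D.I l)
    {T : Module.End k D.PSpace} {w : ℤ → k} {q : k}
    (hv : ∀ i, T (D.v i) = w ((i : ℤ) - D.n + l) • D.v i) (hu : ∀ i, T (D.u i) = w i • D.u i)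
    (hw : ∀ e, w (e - D.n) = w e) (hq : ∀ e, q * w (e + 1) = w e) :
    D.nonnilX l lam * T = q • (T * D.nonnilX l lam) := by
  apply pSpace_ext
  · intro i hi
    rw [Module.End.mul_apply, LinearMap.smul_apply, Module.End.mul_apply, hv, map_smul]
    by_cases hi' : i + 1 < D.n
    · have e : ((i + 1 : ℕ) : ℤ) - D.n + l = (i : ℤ) - D.n + l + 1 := by push_cast; ring
      rw [nonnilX_v hl hln hlam hi', map_add, map_smul, hv, e, ← hq]
      split_ifs with h
      · have e1 : ((i + 1 - (D.n - l) : ℕ) : ℤ) = (i : ℤ) - D.n + l + 1 := by omega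
        rw [hu, e1]
        module
      · rw [map_zero]
        module
    · have e : (i : ℤ) - D.n + l + 1 = l := by omega
      have e1 : ((0 : ℕ) : ℤ) - D.n + l = l - D.n := by push_cast; ring
      rw [nonnilX_v_last hl hln (by omega), map_add, map_smul, hu, hv, ← hq, e, e1, hw]
      module
  · intro i hi
    rw [Module.End.mul_apply, LinearMap.smul_apply, Module.End.mul_apply, hu, map_smul]
    by_cases hi' : i + 1 < D.n
    · rw [nonnilX_u hl hln hlam hi', map_smul, hu, ← hq, Nat.cast_add, Nat.cast_one]
      module
    · have e : (i : ℤ) + 1 = D.n := by omega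
      rw [nonnilX_u_last hln (by omega), map_smul, hu, ← hq, e, ← hw, sub_self, Nat.cast_zero]
      module

theorem nonnilX_pow_u_zero (hl : 1 ≤ l) (hln : l < D.n) (hlam : lam ∈ D.I l) :
    (D.nonnilX l lam ^ l) (D.u 0) = 0 := by
  have h : ∀ j, j < l → (D.nonnilX l lam ^ (j + 1)) (D.u (l - 1 - j)) = 0 := by
    intro j
    induction j with
    | zero =>
      intro _
      rw [zero_add, pow_one, Nat.sub_zero, nonnilX_u hl hln hlam (by omega),
        Nat.sub_add_cancel hl, alphaCoeff_l hl hln hlam, zero_smul]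
    | succ j ih =>
      intro hj
      rw [pow_succ, Module.End.mul_apply, nonnilX_u hl hln hlam (by omega), map_smul,
        show l - 1 - (j + 1) + 1 = l - 1 - j by omega, ih (by omega), smul_zero]
  have h1 := h (l - 1) (by omega)
  rwa [Nat.sub_add_cancel hl, Nat.sub_self] at h1

theorem nonnilX_pow_v_zero (hl : 1 ≤ l) (hln : l < D.n) (hlam : lam ∈ D.I l) {m : ℕ}
    (hm : m < D.n - l) : (D.nonnilX l lam ^ m) (D.v 0) =
      (∏ i ∈ Finset.range m, D.alphaCoeff (i + 1) (D.σInv l lam)) • D.v m := by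
  induction m with
  | zero => simp
  | succ m ih =>
    rw [pow_succ', Module.End.mul_apply, ih (by omega), map_smul,
      nonnilX_v hl hln hlam (by omega), if_neg (by omega), add_zero, smul_smul,
      Finset.prod_range_succ]

theorem nonnilX_pow_u_l (hl : 1 ≤ l) (hln : l < D.n) (hlam : lam ∈ D.I l) {m : ℕ}
    (hm : m < D.n - l) : (D.nonnilX l lam ^ m) (D.u l) =
      (∏ i ∈ Finset.range m, D.alphaCoeff (i + 1) (D.σInv l lam)) • D.u (l + m) := by
  induction m with
  | zero => simp
  | succ m ih =>
    have e := alphaCoeff_sub_l hl hln hlam (i := l + m + 1) (by omega)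
    rw [show l + m + 1 - l = m + 1 by omega, alphaCoeff_sigma_eq hl hln hlam] at e
    rw [pow_succ', Module.End.mul_apply, ih (by omega), map_smul,
      nonnilX_u hl hln hlam (by omega), smul_smul, Finset.prod_range_succ, e, add_assoc]

/-- Since xⁿ commutes with ξ, and powers of ξ carry v_{n-1} and u_{n-1} to all basis vectors, these
two suffice. For the second, x u_{n-1} = z u_0 and xˡ u_0 = 0. -/
theorem nonnilX_pow_n (hD : ¬ D.IsNilpotent) (hl : 1 ≤ l) (hln : l < D.n) (hlam : lam ∈ D.I l)
    (hb : ∀ γ : G →* kˣ, lam (1, γ) = γ b) : D.nonnilX l lam ^ D.n = 0 := by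
  have hρ : (D.ρ : k) ≠ 0 := D.ρ.ne_zero
  have hK := nonnilX_graded hl hln hlam
    (T := D.gradedK lam (fun i => (i : ℤ) - D.n + l) (fun i => i) D.a)
    (w := fun e => D.wtGrp lam e D.a) (q := D.ρ) (gradedK_v D.a) (gradedK_u D.a)
    (fun e => wtGrp_sub_n hD e D.a) (fun e => wtGrp_add_one lam e D.a)
  have hC := nonnilX_graded hl hln hlam
    (T := D.gradedC b (fun i => (i : ℤ) - D.n + l) (fun i => i) (fun h => (D.χ h : k)))
    (w := fun e => (D.χ (b * D.a ^ e) : k)) (q := (D.ρ : k)⁻¹) (gradedC_v _) (gradedC_u _)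
    (fun e => chi_deg_sub_n hb e) (fun e => by
      rw [chi_deg hb, chi_deg hb, zpow_add_one₀ hρ]
      field_simp)
  have h1 := commute_pow_n (B := Module.End k D.PSpace) (D := D) (by omega)
    (nonnil_commutator hl hln hlam hb)
    (by rw [hC, smul_smul, mul_inv_cancel₀ hρ, one_smul])
    (by rw [hK, smul_smul, inv_mul_cancel₀ hρ, one_smul])
  have h2 : Commute (D.nonnilX l lam ^ D.n) D.nonnilXi := h1.symm
  have h3 := fun m => (h2.pow_right m).eq
  have hlast : D.n - 1 < D.n := by omega
  have e1 : D.n - 1 + 1 = D.n := by omega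
  have hv : (D.nonnilX l lam ^ D.n) (D.v (D.n - 1)) = 0 := by
    have e2 : D.nonnilX l lam ^ D.n = D.nonnilX l lam ^ (l - 1) *
        D.nonnilX l lam ^ (1 + (D.n - l - 1) + 1) := by
      rw [← pow_add]
      congr 1
      omega
    -- From x v_{n-1} = y v_0 + u_l, the power xⁿ⁻ˡ⁻¹ produces a common product of α's times y
    -- v_{n-l-1} + u_{n-1}. One more x gives (y + z) u_0 = 0.
    have e3 : (D.nonnilX l lam ^ (1 + (D.n - l - 1) + 1)) (D.v (D.n - 1)) = 0 := by
      rw [pow_succ, Module.End.mul_apply, nonnilX_v_last hl hln e1, pow_add, pow_one,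
        Module.End.mul_apply, map_add, map_smul, nonnilX_pow_v_zero hl hln hlam (by omega),
        nonnilX_pow_u_l hl hln hlam (by omega), map_add, map_smul, map_smul, map_smul,
        nonnilX_v hl hln hlam (by omega), nonnilX_u_last hln (by omega),
        show D.n - l - 1 + 1 = D.n - l by omega, alphaCoeff_n_sub_l hl hln hlam,
        if_pos le_rfl, Nat.sub_self, zCoeff_eq hl hlam]
      module
    rw [e2, Module.End.mul_apply, e3, map_zero]
  have hu : (D.nonnilX l lam ^ D.n) (D.u (D.n - 1)) = 0 := by
    have e2 : D.nonnilX l lam ^ D.n = D.nonnilX l lam ^ (D.n - l - 1) *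
        (D.nonnilX l lam ^ l * D.nonnilX l lam) := by
      rw [← pow_succ, ← pow_add]
      congr 1
      omega
    rw [e2, Module.End.mul_apply, Module.End.mul_apply, nonnilX_u_last hln e1, map_smul,
      nonnilX_pow_u_zero hl hln hlam, smul_zero, map_zero]
  apply pSpace_ext <;> intro i hi
  · have e := nonnilXi_pow_v (D := D) (D.n - 1 - i) hlast
    rw [if_pos (by omega), show D.n - 1 - (D.n - 1 - i) = i by omega] at e
    rw [← e, ← Module.End.mul_apply, h3, Module.End.mul_apply, hv, map_zero]
    rfl
  · have e := nonnilXi_pow_u (D := D) (D.n - 1 - i) hlast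
    rw [if_pos (by omega), show D.n - 1 - (D.n - 1 - i) = i by omega] at e
    rw [← e, ← Module.End.mul_apply, h3, Module.End.mul_apply, hu, map_zero]
    rfl

/-- From λ(a) = ρˡ⁻¹ λ(χ) and χⁿ = 1 one gets λ(a)ⁿ = λ(χⁿ) = 1. So aⁿ acts as 1 although aⁿ ≠ 1,
consistent with xⁿ = 0. -/
theorem wtGrp_a_pow_n (hD : ¬ D.IsNilpotent) (hlam : lam ∈ D.I l) (e : ℤ) :
    D.wtGrp lam e (D.a ^ D.n) = 1 := by
  have h1 : ∀ m : ℕ, D.wtGrp lam e (D.a ^ m) = D.wtGrp lam e D.a ^ m := by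
    intro m
    induction m with
    | zero => simp [wtGrp_one]
    | succ m ih => rw [pow_succ, wtGrp_mul, ih, pow_succ]
  have h2 : ∀ m : ℕ, lam (1, D.χ ^ m) = lam (1, D.χ) ^ m := by
    intro m
    rw [← map_pow]
    congr 1
    exact Prod.ext (one_pow m).symm rfl
  have h3 : (lam (1, D.χ) : k) ^ D.n = 1 := by
    have h0 : lam ((1 : G), (1 : G →* kˣ)) = 1 := map_one lam
    rw [← Units.val_pow_eq_pow_val, ← h2, chi_pow_n_of_not_nil hD, h0, Units.val_one]
  have h4 : ∀ e : ℤ, ((D.ρ : k) ^ e) ^ D.n = 1 := by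
    intro e
    rw [← zpow_natCast, ← zpow_mul, mul_comm, zpow_mul, zpow_natCast, rho_pow_n, one_zpow]
  rw [h1, wtGrp_a, weight_a_one hlam, mul_pow, mul_pow, h3, h4, ← zpow_natCast (D.ρ : k), h4]
  simp

theorem gradedK_a_pow_n (hD : ¬ D.IsNilpotent) (hlam : lam ∈ D.I l) :
    D.gradedK lam ev eu (D.a ^ D.n) = 1 := by
  apply pSpace_ext <;> intro i _ <;> simp [gradedK_v, gradedK_u, wtGrp_a_pow_n hD hlam]

/-- The action on `P(l, λ)` for data of non-nilpotent type. -/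
noncomputable def nonnilData (hD : ¬ D.IsNilpotent) (hα : D.α = 1) (hl : 1 ≤ l) (hln : l < D.n)
    (hlam : lam ∈ D.I l) (hb : ∀ γ : G →* kˣ, lam (1, γ) = γ b) :
    D.DoubleData (Module.End k D.PSpace) where
  K := D.gradedK lam (fun i => (i : ℤ) - D.n + l) (fun i => i)
  X := D.nonnilX l lam
  Y := D.nonnilXi
  C := D.gradedC b (fun i => (i : ℤ) - D.n + l) (fun i => i)
  sat :=
    { one := gradedK_one
      mul := gradedK_mul
      pow := by
        rw [nonnilX_pow_n hD hl hln hlam hb, gradedK_a_pow_n hD hlam, sub_self, smul_zero]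
      comm := fun g => nonnilX_graded hl hln hlam (w := fun e => D.wtGrp lam e g)
        (gradedK_v g) (gradedK_u g) (fun e => wtGrp_sub_n hD e g)
        (fun e => wtGrp_add_one lam e g) }
  K_C := gradedK_gradedC
  K_Y g := by
    apply pSpace_ext <;> intro i hi
    · simp only [Module.End.mul_apply, LinearMap.smul_apply, gradedK_v, map_smul, nonnilXi_v hi]
      cases i with
      | zero => simp
      | succ i =>
        have e : ((i + 1 : ℕ) : ℤ) - D.n + l = (i : ℤ) - D.n + l + 1 := by push_cast; ring
        rw [if_neg (by omega), Nat.add_sub_cancel, gradedK_v, e, smul_smul, wtGrp_add_one]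
    · simp only [Module.End.mul_apply, LinearMap.smul_apply, gradedK_u, map_smul, nonnilXi_u hi]
      cases i with
      | zero => simp
      | succ i =>
        rw [if_neg (by omega), Nat.add_sub_cancel, gradedK_u, Nat.cast_add, Nat.cast_one, smul_smul,
          wtGrp_add_one]
  Y_C f := by
    apply pSpace_ext <;> intro i hi
    · simp only [Module.End.mul_apply, gradedC_v, map_smul, nonnilXi_v hi]
      cases i with
      | zero => simp
      | succ i =>
        have e : ((i + 1 : ℕ) : ℤ) - D.n + l = (i : ℤ) - D.n + l + 1 := by push_cast; ring
        rw [if_neg (by omega), Nat.add_sub_cancel, gradedC_v, e, deg_mul_a]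
    · simp only [Module.End.mul_apply, gradedC_u, map_smul, nonnilXi_u hi]
      cases i with
      | zero => simp
      | succ i =>
        rw [if_neg (by omega), Nat.add_sub_cancel, gradedC_u, Nat.cast_add, Nat.cast_one, deg_mul_a]
  Y_pow := by
    apply pSpace_ext <;> intro i hi
    · rw [nonnilXi_pow_v _ hi, if_neg (by omega)]
      rfl
    · rw [nonnilXi_pow_u _ hi, if_neg (by omega)]
      rfl
  Y_X := nonnil_commutator hl hln hlam hb
  C_X f := by
    have hρ : (D.ρ : k) ≠ 0 := D.ρ.ne_zero
    have hdn : ∀ e : ℤ, b * D.a ^ e * (D.a ^ D.n)⁻¹ = b * D.a ^ (e - D.n) := by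
      intro e
      rw [mul_assoc, zpow_sub, zpow_natCast]
    apply pSpace_ext <;> intro i hi
    · simp only [LinearMap.sub_apply, LinearMap.smul_apply, Module.End.mul_apply, gradedC_v,
        gradedK_v, map_smul, map_sub, deg_mul_a, hdn, nonnilXi_pow_v _ hi]
      -- The factor ξⁿ⁻¹ kills every v_i except v_{n-1}, so the correction is visible only there.
      by_cases hi' : i + 1 < D.n
      · rw [if_neg (by omega), smul_zero, smul_zero, smul_zero, sub_zero, smul_zero, smul_zero,
          sub_zero, nonnilX_v hl hln hlam hi', map_add, map_smul, gradedC_v]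
        have e : ((i + 1 : ℕ) : ℤ) - D.n + l = (i : ℤ) - D.n + l + 1 := by push_cast; ring
        rw [e]
        split_ifs with h
        · have e1 : ((i + 1 - (D.n - l) : ℕ) : ℤ) = (i : ℤ) - D.n + l + 1 := by omega
          rw [gradedC_u, e1]
          module
        · rw [map_zero]
          module
      · have e : (i : ℤ) - D.n + l + 1 = l := by omega
        have e1 : ((0 : ℕ) : ℤ) - D.n + l = l - D.n := by push_cast; ring
        have e2 : (i : ℤ) - D.n + l = l - 1 := by omega
        rw [if_pos (by omega), show i - (D.n - 1) = 0 by omega,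
          nonnilX_v_last hl hln (by omega), map_add, map_smul, gradedC_v, gradedC_u, e, e1, e2]
        rw [yCoeff_eq_weight hα hb]
        module
    · simp only [LinearMap.sub_apply, LinearMap.smul_apply, Module.End.mul_apply, gradedC_u,
        gradedK_u, map_smul, map_sub, deg_mul_a, hdn, nonnilXi_pow_u _ hi]
      by_cases hi' : i + 1 < D.n
      · rw [if_neg (by omega), smul_zero, smul_zero, smul_zero, sub_zero, smul_zero, smul_zero,
          sub_zero, nonnilX_u hl hln hlam hi', map_smul, gradedC_u, Nat.cast_add, Nat.cast_one]
        module
      · have e : (i : ℤ) + 1 = D.n := by omega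
        have e2 : (i : ℤ) = D.n - 1 := by omega
        rw [if_pos (by omega), show i - (D.n - 1) = 0 by omega,
          nonnilX_u_last hln (by omega), map_smul, gradedC_u, e, sub_self, e2, Nat.cast_zero]
        -- As for y, but in weight λφⁿ⁻¹, the weight of u_{n-1}.
        have hz : D.zCoeff lam = D.α / D.qFactorial (D.n - 1) *
            (D.wtGrp lam (D.n - 1) D.a - D.ρ * D.χ (b * D.a ^ ((D.n : ℤ) - 1))) := by
          have e3 : (D.ρ : k) ^ ((D.n : ℤ) - 1) = (D.ρ : k)⁻¹ := by
            rw [zpow_sub_one₀ hρ, zpow_natCast, rho_pow_n, one_mul]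
          rw [zCoeff, hα, wtGrp_a, chi_deg hb, zpow_neg, e3, inv_inv]
          field_simp
        rw [hz]
        module

end Action

end GroupDatum

/-! ### Weight vectors -/

/-- Let `T = X Y` and `X Yʲ⁺¹ = Yʲ (T - c_j)` on a `T`-stable subspace on which `(T - c)² = 0`. Then
`Yᵠ = 0` implies `Yᵖ = 0` on the subspace, if `c_j ≠ c` for `p ≤ j < q`. -/
theorem pow_eq_zero_of_descent {k M : Type*} [Field k] [AddCommGroup M] [Module k M]
    {X Y T : Module.End k M} {S : Submodule k M} {c : ℕ → k} {c₀ : k}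
    (hT : ∀ m ∈ S, T m ∈ S) (hT2 : ∀ m ∈ S, T (T m - c₀ • m) = c₀ • (T m - c₀ • m))
    (hXY : ∀ m ∈ S, ∀ j, X ((Y ^ (j + 1)) m) = (Y ^ j) (T m - c j • m)) {p q : ℕ} (hpq : p ≤ q)
    (hc : ∀ j, p ≤ j → j < q → c j ≠ c₀) (hq : ∀ m ∈ S, (Y ^ q) m = 0) :
    ∀ m ∈ S, (Y ^ p) m = 0 := by
  induction q, hpq using Nat.le_induction with
  | base => exact hq
  | succ q hpq ih =>
    refine ih (fun j h1 h2 => hc j h1 (by omega)) fun m hm => ?_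
    have hne : c₀ - c q ≠ 0 := sub_ne_zero.2 (hc q hpq (by omega)).symm
    set d := (c₀ - c q)⁻¹ with hd
    have hdm : d * (c₀ - c q) = 1 := inv_mul_cancel₀ hne
    -- This is (T - c_q)⁻¹ m: with N = T - c₀ and N² = 0 on S, the inverse of (c₀ - c_q) + N is d -
    -- d² N.
    let m' := d • m - d ^ 2 • (T m - c₀ • m)
    have hm' : m' ∈ S := S.sub_mem (S.smul_mem _ hm)
      (S.smul_mem _ (S.sub_mem (hT m hm) (S.smul_mem _ hm)))
    have e : T m' - c q • m' = m := by
      have e0 : T m' = d • T m - d ^ 2 • T (T m - c₀ • m) := by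
        simp only [m', map_sub T (d • m), map_smul]
      rw [e0, hT2 m hm]
      have e1 : d • T m - d ^ 2 • c₀ • (T m - c₀ • m) -
          c q • (d • m - d ^ 2 • (T m - c₀ • m)) =
          (d * (c₀ - c q)) • m + (d * (1 - d * (c₀ - c q))) • (T m - c₀ • m) := by module
      rw [e1, hdm]
      simp
    have h := hXY m' hm' q
    rw [hq m' hm', map_zero, e] at h
    exact h.symm

/-- By `pow_eq_zero_of_descent`, Y^{q+1} vanishes on S. As c_q = c₀, applying X shows that Y^q
vanishes on (T - c₀) S, where T acts as c₀; a second descent on that subspace lowers q to p. -/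
theorem pow_sub_eq_zero_of_descent {k M : Type*} [Field k] [AddCommGroup M] [Module k M]
    {X Y T : Module.End k M} {S : Submodule k M} {c : ℕ → k} {c₀ : k}
    (hT : ∀ m ∈ S, T m ∈ S) (hT2 : ∀ m ∈ S, T (T m - c₀ • m) = c₀ • (T m - c₀ • m))
    (hXY : ∀ m ∈ S, ∀ j, X ((Y ^ (j + 1)) m) = (Y ^ j) (T m - c j • m)) {p q N : ℕ} (hpq : p ≤ q)
    (hqN : q < N) (hcq : c q = c₀) (hc : ∀ j, p ≤ j → j < q → c j ≠ c₀)
    (hc' : ∀ j, q < j → j < N → c j ≠ c₀) (hN : ∀ m ∈ S, (Y ^ N) m = 0) :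
    ∀ m ∈ S, (Y ^ p) (T m - c₀ • m) = 0 := by
  intro m hm
  have key : ∀ {m}, m ∈ S.map (T - c₀ • 1) → m ∈ S ∧ T m = c₀ • m := by
    rintro _ ⟨m, hm, rfl⟩
    exact ⟨S.sub_mem (hT m hm) (S.smul_mem _ hm), hT2 m hm⟩
  refine pow_eq_zero_of_descent (X := X) (T := T) (S := S.map (T - c₀ • 1)) (c₀ := c₀)
    ?_ ?_ ?_ hpq hc ?_ _ ⟨m, hm, rfl⟩
  · intro m hm
    rw [(key hm).2]
    exact Submodule.smul_mem _ _ hm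
  · intro m hm
    rw [(key hm).2, sub_self, map_zero, smul_zero]
  · intro m hm
    exact hXY m (key hm).1
  · rintro _ ⟨m, hm, rfl⟩
    have h1 := hXY m hm q
    rw [pow_eq_zero_of_descent hT hT2 hXY hqN (fun j hj => hc' j hj) hN m hm, map_zero, hcq] at h1
    exact h1.symm

namespace GroupDatum

namespace DoubleData

variable {k G : Type*} [Field k] [CommGroup G] [Finite G] {D : GroupDatum k G}
  {B : Type*} [Ring B] [Algebra k B] (E : D.DoubleData B)

/-- The correction in `C_X` involves f(ha) - f(ha·a⁻ⁿ), which is zero for f = χ since χ(aⁿ) = 1. -/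
theorem Cchi_X : E.C (fun h => (D.χ h : k)) * E.X =
    (D.ρ : k) • (E.X * E.C (fun h => (D.χ h : k))) := by
  have e : (fun h => (D.χ (h * D.a) : k)) = (D.ρ : k) • fun h => (D.χ h : k) := by
    ext h
    simp [ρ, mul_comm]
  have e2 : (fun h => (D.χ (h * D.a) : k) - (D.χ (h * D.a * (D.a ^ D.n)⁻¹) : k)) = 0 := by
    ext h
    rw [map_mul D.χ (h * D.a), map_inv, chi_pow_a]
    simp
  rw [E.C_X, e2, e, map_zero, mul_zero, mul_zero, smul_zero, sub_zero, map_smul, mul_smul_comm]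

theorem Ka_X : E.K D.a * E.X = (D.ρ : k)⁻¹ • (E.X * E.K D.a) := by
  rw [E.sat.comm, smul_smul]
  change _ = ((D.ρ : k)⁻¹ * (D.ρ : k)) • _
  rw [inv_mul_cancel₀ D.ρ.ne_zero, one_smul]

theorem Y_X_pow (j : ℕ) : E.Y * E.X ^ (j + 1) = E.X ^ (j + 1) * E.Y +
    D.qNum (j + 1) • (E.X ^ j *
      (E.C (fun h => (D.χ h : k)) - ((D.ρ : k) ^ j)⁻¹ • E.K D.a)) :=
  mul_pow_of_commutator D.ρ.ne_zero E.Y_X E.Cchi_X E.Ka_X j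

theorem X_pow_n_of_nil (hD : D.IsNilpotent) : E.X ^ D.n = 0 := by
  rw [E.sat.pow, alpha_smul_sub_of_nil hD E.sat.one]

theorem C_X_of_nil (hD : D.IsNilpotent) (f : G → k) :
    E.C f * E.X = E.X * E.C (fun h => f (h * D.a)) := by
  have h0 : (D.α / D.qFactorial (D.n - 1)) •
      (fun h => f (h * D.a) - f (h * D.a * (D.a ^ D.n)⁻¹)) = 0 := by
    ext h
    have := alpha_mul_sub_of_nil hD f h
    rw [Pi.smul_apply, smul_eq_mul, div_mul_eq_mul_div, this, zero_div]
    rfl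
  rw [E.C_X, ← mul_smul_comm, ← mul_smul_comm, ← map_smul _ (D.α / D.qFactorial (D.n - 1)), h0,
    map_zero, mul_zero, mul_zero, sub_zero]

end DoubleData

section WeightVectors

variable {k G : Type*} [Field k] [CommGroup G] [Finite G] {D : GroupDatum k G}
  {M : Type*} [AddCommGroup M] [Module k M] (E : D.DoubleData (Module.End k M))

/-- The vectors of weight `λ φᵉ`, where `λ(g, γ) = λ(g, 1) γ(b)`. -/
def weightSpace (lam : Weight k G) (b : G) (e : ℤ) : Submodule k M where
  carrier := {m | (∀ g, E.K g m = D.wtGrp lam e g • m) ∧ ∀ f, E.C f m = f (b * D.a ^ e) • m}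
  zero_mem' := by simp
  add_mem' := fun {m m'} h h' =>
    ⟨fun g => by rw [map_add, h.1, h'.1, smul_add], fun f => by rw [map_add, h.2, h'.2, smul_add]⟩
  smul_mem' := fun r m h =>
    ⟨fun g => by rw [map_smul, h.1, smul_comm], fun f => by rw [map_smul, h.2, smul_comm]⟩

variable {E} {lam : Weight k G} {b : G} {e : ℤ} {m : M}

theorem Y_mem_weightSpace (h : m ∈ weightSpace E lam b e) :
    E.Y m ∈ weightSpace E lam b (e - 1) := by
  constructor
  · intro g
    have h1 := LinearMap.congr_fun (E.K_Y g) m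
    have h2 := D.wtGrp_add_one lam (e - 1) g
    rw [sub_add_cancel] at h2
    rw [Module.End.mul_apply, LinearMap.smul_apply, Module.End.mul_apply, h.1, map_smul, smul_smul,
      h2] at h1
    exact h1
  · intro f
    have h1 := LinearMap.congr_fun (E.Y_C (fun h => f (h * D.a⁻¹))) m
    simp only [mul_inv_cancel_right] at h1
    rw [Module.End.mul_apply, Module.End.mul_apply, h.2, map_smul, mul_assoc, ← zpow_sub_one] at h1
    exact h1.symm

theorem Y_pow_mem_weightSpace (h : m ∈ weightSpace E lam b e) (j : ℕ) :
    (E.Y ^ j) m ∈ weightSpace E lam b (e - j) := by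
  induction j with
  | zero => simpa using h
  | succ j ih =>
    rw [pow_succ', Module.End.mul_apply, Nat.cast_add, Nat.cast_one, ← sub_sub]
    exact Y_mem_weightSpace ih

theorem K_X_apply (h : m ∈ weightSpace E lam b e) (g : G) :
    E.K g (E.X m) = D.wtGrp lam (e + 1) g • E.X m := by
  have h1 := LinearMap.congr_fun (E.sat.comm g) m
  rw [LinearMap.smul_apply, Module.End.mul_apply, Module.End.mul_apply, h.1, map_smul,
    ← D.wtGrp_add_one, mul_smul] at h1
  exact (smul_right_injective M (D.χ g).ne_zero h1).symm

/-- The G-weight always shifts correctly under x. The degree does so when the correction in `C_X`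
vanishes, which either alternative guarantees. -/
theorem X_mem_weightSpace (h : m ∈ weightSpace E lam b e)
    (h0 : D.IsNilpotent ∨ (E.Y ^ (D.n - 1)) m = 0) : E.X m ∈ weightSpace E lam b (e + 1) := by
  refine ⟨K_X_apply h, fun f => ?_⟩
  rcases h0 with h0 | h0
  · have h1 := LinearMap.congr_fun (E.C_X_of_nil h0 f) m
    rw [Module.End.mul_apply, Module.End.mul_apply, h.2, map_smul, deg_mul_a] at h1
    exact h1
  · have h1 := LinearMap.congr_fun (E.C_X f) m
    simp only [LinearMap.sub_apply, LinearMap.smul_apply, Module.End.mul_apply, h.1, h.2, map_smul,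
      map_sub, h0, smul_zero, sub_self, sub_zero, deg_mul_a] at h1
    exact h1

theorem X_pow_mem_weightSpace_of_nil (hD : D.IsNilpotent) (h : m ∈ weightSpace E lam b e)
    (j : ℕ) : (E.X ^ j) m ∈ weightSpace E lam b (e + j) := by
  induction j with
  | zero => simpa using h
  | succ j ih =>
    rw [pow_succ', Module.End.mul_apply, Nat.cast_add, Nat.cast_one, ← add_assoc]
    exact X_mem_weightSpace ih (Or.inl hD)

theorem Ka_apply (h : m ∈ weightSpace E lam b e) :
    E.K D.a m = ((lam (D.a, 1) : k) * (D.ρ : k) ^ (-e)) • m := by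
  rw [h.1, wtGrp_a]

theorem Cchi_apply (hb : ∀ γ : G →* kˣ, lam (1, γ) = γ b) (h : m ∈ weightSpace E lam b e) :
    E.C (fun h => (D.χ h : k)) m = ((lam (1, D.χ) : k) * (D.ρ : k) ^ e) • m := by
  rw [h.2, chi_deg hb]

/-- By ξⁿ = 0 the vector ξm is killed by ξⁿ⁻¹, so applying x to it produces no correction in either
type. This makes xξ the operator to work with. -/
theorem XY_mem_weightSpace (hn : 1 < D.n) (h : m ∈ weightSpace E lam b e) :
    (E.X * E.Y) m ∈ weightSpace E lam b e := by
  have h1 : (E.Y ^ (D.n - 1)) (E.Y m) = 0 := by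
    have e1 : D.n - 1 + 1 = D.n := by omega
    rw [← Module.End.mul_apply, ← pow_succ, e1, E.Y_pow]
    rfl
  have := X_mem_weightSpace (Y_mem_weightSpace h) (Or.inr h1)
  rwa [sub_add_cancel] at this

/-- `ξ xⁱ m = xⁱ ξ m + α_i(λ φᵉ) xⁱ⁻¹ m` for `m` of weight `λ φᵉ`. -/
theorem Y_X_pow_apply (hb : ∀ γ : G →* kˣ, lam (1, γ) = γ b) (h : m ∈ weightSpace E lam b e)
    (i : ℕ) : E.Y ((E.X ^ i) m) = (E.X ^ i) (E.Y m) +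
      D.alphaCoeff i (D.φ ^ e * lam) • (E.X ^ (i - 1)) m := by
  cases i with
  | zero => simp [alphaCoeff_zero]
  | succ i =>
    have h1 := LinearMap.congr_fun (E.Y_X_pow i) m
    simp only [LinearMap.add_apply, LinearMap.smul_apply, LinearMap.sub_apply,
      Module.End.mul_apply, Ka_apply h, Cchi_apply hb h] at h1
    rw [h1, Nat.add_sub_cancel, alphaCoeff, MonoidHom.mul_apply, MonoidHom.mul_apply, zpow_apply',
      zpow_apply', phi_one_chi, phi_a_one]
    have e1 : (D.ρ : k) ^ (1 - ((i + 1 : ℕ) : ℤ)) = ((D.ρ : k) ^ i)⁻¹ := by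
      rw [Nat.cast_add, Nat.cast_one, sub_add_cancel_right, zpow_neg, zpow_natCast]
    rw [e1, smul_smul, ← sub_smul, map_smul, smul_smul]
    congr 2
    simp only [Units.val_mul, Units.val_zpow_eq_zpow_val, Units.val_inv_eq_inv_val, inv_zpow',
      zpow_neg]
    ring

variable (D) in
/-- The scalar `c_j` with `x ξʲ⁺¹ m = ξʲ (x ξ - c_j) m` for `m` of weight `λ φᵉ`. -/
def descCoeff (lam : Weight k G) (e : ℤ) (j : ℕ) : k :=
  D.qNum j * (((D.ρ : k) ^ j)⁻¹ * ((lam (1, D.χ) : k) * (D.ρ : k) ^ e) -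
    D.ρ * ((lam (D.a, 1) : k) * (D.ρ : k) ^ (-e)))

theorem descCoeff_closed {l : ℕ} (hl : 1 ≤ l) (hlam : lam ∈ D.I l) (e : ℤ) (j : ℕ) :
    ((D.ρ : k) - 1) * (D.ρ : k) ^ j * D.descCoeff lam e j =
      ((D.ρ : k) ^ j - 1) * ((D.ρ : k) ^ e - (D.ρ : k) ^ (l + j) * (D.ρ : k) ^ (-e)) *
        lam (1, D.χ) := by
  have h := weight_a_one_mul_rho hl hlam
  have h1 : (D.ρ : k) ^ j * ((D.ρ : k) ^ j)⁻¹ = 1 :=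
    mul_inv_cancel₀ (pow_ne_zero _ D.ρ.ne_zero)
  rw [descCoeff, ← qNum_mul_sub_one, pow_add]
  linear_combination ((D.ρ : k) - 1) * D.qNum j * lam (1, D.χ) * (D.ρ : k) ^ e * h1 -
    ((D.ρ : k) - 1) * D.qNum j * (D.ρ : k) ^ j * (D.ρ : k) ^ (-e) * h

/-- Apply `Y_pow_X` to ξm, on which a and χ act by scalars; the commutator term is a multiple of
ξʲm. -/
theorem X_Y_pow_apply (hb : ∀ γ : G →* kˣ, lam (1, γ) = γ b) (h : m ∈ weightSpace E lam b e)
    (j : ℕ) : E.X ((E.Y ^ (j + 1)) m) =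
      (E.Y ^ j) ((E.X * E.Y) m - D.descCoeff lam e j • m) := by
  cases j with
  | zero => simp [descCoeff, qNum]
  | succ j =>
    have hρ : (D.ρ : k) ≠ 0 := D.ρ.ne_zero
    have h0 := Y_mem_weightSpace h
    have h1 := LinearMap.congr_fun (E.Y_pow_X j) (E.Y m)
    simp only [LinearMap.add_apply, LinearMap.smul_apply, LinearMap.sub_apply,
      Module.End.mul_apply, Ka_apply h0, Cchi_apply hb h0] at h1
    rw [pow_succ _ (j + 1), Module.End.mul_apply, Module.End.mul_apply, map_sub, h1, map_smul,
      smul_smul, ← sub_smul, map_smul, smul_smul, ← Module.End.mul_apply (E.Y ^ j), ← pow_succ,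
      add_sub_assoc, ← sub_smul]
    have e1 : D.qNum (j + 1) * (((D.ρ : k) ^ j)⁻¹ * ((lam (1, D.χ) : k) * (D.ρ : k) ^ (e - 1)) -
        (lam (D.a, 1) : k) * (D.ρ : k) ^ (-(e - 1))) = D.descCoeff lam e (j + 1) := by
      rw [descCoeff, neg_sub, sub_eq_add_neg 1 e, zpow_add₀ hρ, zpow_sub_one₀ hρ, pow_succ, mul_inv,
        zpow_one]
      ring
    rw [e1, sub_self, zero_smul, add_zero]

/-- The vectors of weight `λ φᵉ` that are killed by `(x ξ - c)²`. -/
def genSpace (E : D.DoubleData (Module.End k M)) (lam : Weight k G) (b : G) (e : ℤ) (c : k) :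
    Submodule k M :=
  weightSpace E lam b e ⊓ LinearMap.ker ((E.X * E.Y - c • 1) ^ 2)

theorem mem_genSpace {c : k} : m ∈ genSpace E lam b e c ↔ m ∈ weightSpace E lam b e ∧
    (E.X * E.Y) ((E.X * E.Y) m - c • m) = c • ((E.X * E.Y) m - c • m) := by
  rw [genSpace, Submodule.mem_inf, LinearMap.mem_ker, pow_two, Module.End.mul_apply,
    LinearMap.sub_apply, LinearMap.sub_apply, sub_eq_zero]
  rfl

variable {c : k}

theorem XY_mem_genSpace (hn : 1 < D.n) (h : m ∈ genSpace E lam b e c) :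
    (E.X * E.Y) m ∈ genSpace E lam b e c := by
  rw [mem_genSpace] at h ⊢
  refine ⟨XY_mem_weightSpace hn h.1, ?_⟩
  have h2 := congrArg (E.X * E.Y) h.2
  rwa [map_smul, map_sub (E.X * E.Y) _ (c • m), map_smul _ c m] at h2

theorem sub_mem_genSpace (hn : 1 < D.n) (h : m ∈ genSpace E lam b e c) :
    (E.X * E.Y) m - c • m ∈ genSpace E lam b e c :=
  Submodule.sub_mem _ (XY_mem_genSpace hn h) (Submodule.smul_mem _ _ h)

theorem Y_pow_eq_zero_of_genSpace (hb : ∀ γ : G →* kˣ, lam (1, γ) = γ b) (hn : 1 < D.n) {p : ℕ}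
    (hp : p ≤ D.n) (hc : ∀ j, p ≤ j → j < D.n → D.descCoeff lam e j ≠ c)
    (h : m ∈ genSpace E lam b e c) : (E.Y ^ p) m = 0 :=
  pow_eq_zero_of_descent (X := E.X) (S := genSpace E lam b e c) (fun _ h => XY_mem_genSpace hn h)
    (fun _ h => (mem_genSpace.1 h).2) (fun _ h => X_Y_pow_apply hb (mem_genSpace.1 h).1) hp hc
    (fun m _ => by rw [E.Y_pow]; rfl) m h

theorem Y_pow_sub_eq_zero_of_genSpace (hb : ∀ γ : G →* kˣ, lam (1, γ) = γ b) (hn : 1 < D.n)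
    {p q : ℕ} (hpq : p ≤ q) (hq : q < D.n) (hcq : D.descCoeff lam e q = c)
    (hc : ∀ j, p ≤ j → j < q → D.descCoeff lam e j ≠ c)
    (hc' : ∀ j, q < j → j < D.n → D.descCoeff lam e j ≠ c)
    (h : m ∈ genSpace E lam b e c) : (E.Y ^ p) ((E.X * E.Y) m - c • m) = 0 := by
  exact pow_sub_eq_zero_of_descent (X := E.X) (S := genSpace E lam b e c)
    (fun _ h => XY_mem_genSpace hn h) (fun _ h => (mem_genSpace.1 h).2)
    (fun _ h => X_Y_pow_apply hb (mem_genSpace.1 h).1) hpq hq hcq hc hc'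
    (fun m _ => by rw [E.Y_pow]; rfl) m h

/-- `∏_{j<n} (x ξ - c_j)` kills the vectors of weight `λ φᵉ`. -/
theorem aeval_prod_eq_zero (hb : ∀ γ : G →* kˣ, lam (1, γ) = γ b) (hn : 1 < D.n)
    (h : m ∈ weightSpace E lam b e) : Polynomial.aeval (E.X * E.Y)
      (∏ j ∈ Finset.range D.n, (Polynomial.X - Polynomial.C (D.descCoeff lam e j))) m = 0 := by
  -- By induction ∏_{i<j} (xξ - c_i) = xʲ ξʲ on the weight space; at j = n the factor ξⁿ is zero.
  have key : ∀ (j : ℕ) {m}, m ∈ weightSpace E lam b e → Polynomial.aeval (E.X * E.Y)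
      (∏ i ∈ Finset.range j, (Polynomial.X - Polynomial.C (D.descCoeff lam e i))) m =
        (E.X ^ j) ((E.Y ^ j) m) := by
    intro j
    induction j with
    | zero => simp
    | succ j ih =>
      intro m hm
      rw [Finset.prod_range_succ, map_mul, Module.End.mul_apply, map_sub, Polynomial.aeval_X,
        Polynomial.aeval_C, LinearMap.sub_apply, Module.algebraMap_end_apply,
        ih (Submodule.sub_mem _ (XY_mem_weightSpace hn hm) (Submodule.smul_mem _ _ hm)),
        ← X_Y_pow_apply hb hm, pow_succ E.X, Module.End.mul_apply]
  rw [key _ h, E.Y_pow, LinearMap.zero_apply, map_zero]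

/-- A polynomial in `x ξ` that projects the vectors of weight `λ φᵉ` onto `genSpace`. -/
theorem exists_projection {j₀ j₁ : ℕ} (hj : j₀ < j₁) (hj₁ : j₁ < D.n)
    (h₀ : D.descCoeff lam e j₀ = c) (h₁ : D.descCoeff lam e j₁ = c)
    (hc : ∀ j < D.n, j ≠ j₀ → j ≠ j₁ → D.descCoeff lam e j ≠ c) :
    ∃ f g : Polynomial k, f + g * (Polynomial.X - Polynomial.C c) ^ 2 = 1 ∧
      (∏ j ∈ Finset.range D.n, (Polynomial.X - Polynomial.C (D.descCoeff lam e j))) ∣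
        (Polynomial.X - Polynomial.C c) ^ 2 * f := by
  -- The roots other than the double root c. By Bézout, some multiple f of their product is 1 modulo
  -- (X - c)², and (X - c)² f is divisible by the full product.
  set s := ((Finset.range D.n).erase j₀).erase j₁
  have hcop : IsCoprime (∏ j ∈ s, (Polynomial.X - Polynomial.C (D.descCoeff lam e j)))
      ((Polynomial.X - Polynomial.C c) ^ 2) := by
    refine IsCoprime.pow_right (IsCoprime.prod_left fun j hj' => ?_)
    simp only [s, Finset.mem_erase, Finset.mem_range] at hj'
    exact Polynomial.isCoprime_X_sub_C_of_isUnit_sub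
      (sub_ne_zero.2 (hc j hj'.2.2 hj'.2.1 hj'.1)).isUnit
  obtain ⟨r, g, hrg⟩ := hcop
  refine ⟨r * ∏ j ∈ s, (Polynomial.X - Polynomial.C (D.descCoeff lam e j)), g, hrg, ?_⟩
  have m₀ : j₀ ∈ Finset.range D.n := Finset.mem_range.2 (by omega)
  have m₁ : j₁ ∈ (Finset.range D.n).erase j₀ :=
    Finset.mem_erase.2 ⟨by omega, Finset.mem_range.2 hj₁⟩
  rw [← Finset.mul_prod_erase _ _ m₀, ← Finset.mul_prod_erase _ _ m₁, h₀, h₁]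
  exact ⟨r, by ring⟩

end WeightVectors

end GroupDatum

/-! ### The universal property of `P(l, λ)` -/

namespace GroupDatum

section Lifting

variable {k G : Type*} [Field k] [CommGroup G] [Finite G] {D : GroupDatum k G}

/-- `F` commutes with the operators of the data `E` and `E'`. -/
structure Intertwines {V M : Type*} [AddCommGroup V] [Module k V] [AddCommGroup M] [Module k M]
    (E : D.DoubleData (Module.End k V)) (E' : D.DoubleData (Module.End k M)) (F : V →ₗ[k] M) :
    Prop where
  K : ∀ g, F ∘ₗ E.K g = E'.K g ∘ₗ F
  X : F ∘ₗ E.X = E'.X ∘ₗ F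
  Y : F ∘ₗ E.Y = E'.Y ∘ₗ F
  C : ∀ f, F ∘ₗ E.C f = E'.C f ∘ₗ F

variable {l : ℕ} {lam : Weight k G} {b : G}

theorem intertwines_of_basis {M : Type*} [AddCommGroup M] [Module k M]
    {E : D.DoubleData (Module.End k D.PSpace)} {E' : D.DoubleData (Module.End k M)}
    {F : D.PSpace →ₗ[k] M} {ev eu : ℕ → ℤ}
    (hv : ∀ i, D.v i ∈ weightSpace E lam b (ev i)) (hu : ∀ i, D.u i ∈ weightSpace E lam b (eu i))
    (hv' : ∀ i < D.n, F (D.v i) ∈ weightSpace E' lam b (ev i))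
    (hu' : ∀ i < D.n, F (D.u i) ∈ weightSpace E' lam b (eu i))
    (Xv : ∀ i < D.n, F (E.X (D.v i)) = E'.X (F (D.v i)))
    (Xu : ∀ i < D.n, F (E.X (D.u i)) = E'.X (F (D.u i)))
    (Yv : ∀ i < D.n, F (E.Y (D.v i)) = E'.Y (F (D.v i)))
    (Yu : ∀ i < D.n, F (E.Y (D.u i)) = E'.Y (F (D.u i))) : Intertwines E E' F where
  K g := by
    apply pSpace_ext <;> intro i hi
    · rw [LinearMap.comp_apply, LinearMap.comp_apply, (hv i).1, map_smul, (hv' i hi).1]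
    · rw [LinearMap.comp_apply, LinearMap.comp_apply, (hu i).1, map_smul, (hu' i hi).1]
  X := pSpace_ext Xv Xu
  Y := pSpace_ext Yv Yu
  C f := by
    apply pSpace_ext <;> intro i hi
    · rw [LinearMap.comp_apply, LinearMap.comp_apply, (hv i).2, map_smul, (hv' i hi).2]
    · rw [LinearMap.comp_apply, LinearMap.comp_apply, (hu i).2, map_smul, (hu' i hi).2]

theorem nilData_K (hD : D.IsNilpotent) (hl : 1 ≤ l) (hln : l < D.n)
    (hlam : lam ∈ D.I l) (hb : ∀ γ : G →* kˣ, lam (1, γ) = γ b) :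
    (nilData hD hl hln hlam hb).K = D.gradedK lam (fun i => i) (fun i => (i : ℤ) - D.n + l) := rfl

theorem nilData_C (hD : D.IsNilpotent) (hl : 1 ≤ l) (hln : l < D.n)
    (hlam : lam ∈ D.I l) (hb : ∀ γ : G →* kˣ, lam (1, γ) = γ b) :
    (nilData hD hl hln hlam hb).C = D.gradedC b (fun i => i) (fun i => (i : ℤ) - D.n + l) := rfl

theorem v_mem_weightSpace_of_nil (hD : D.IsNilpotent) (hl : 1 ≤ l) (hln : l < D.n)
    (hlam : lam ∈ D.I l) (hb : ∀ γ : G →* kˣ, lam (1, γ) = γ b) (i : ℕ) :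
    D.v i ∈ weightSpace (nilData hD hl hln hlam hb) lam b i := by
  constructor
  · intro g
    rw [nilData_K, gradedK_v]
  · intro f
    rw [nilData_C, gradedC_v]

theorem u_mem_weightSpace_of_nil (hD : D.IsNilpotent) (hl : 1 ≤ l) (hln : l < D.n)
    (hlam : lam ∈ D.I l) (hb : ∀ γ : G →* kˣ, lam (1, γ) = γ b) (i : ℕ) :
    D.u i ∈ weightSpace (nilData hD hl hln hlam hb) lam b ((i : ℤ) - D.n + l) := by
  constructor
  · intro g
    rw [nilData_K, gradedK_u]
  · intro f
    rw [nilData_C, gradedC_u]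

theorem nonnilData_K (hD : ¬ D.IsNilpotent) (hα : D.α = 1) (hl : 1 ≤ l) (hln : l < D.n)
    (hlam : lam ∈ D.I l) (hb : ∀ γ : G →* kˣ, lam (1, γ) = γ b) :
    (nonnilData hD hα hl hln hlam hb).K =
      D.gradedK lam (fun i => (i : ℤ) - D.n + l) (fun i => i) := rfl

theorem nonnilData_C (hD : ¬ D.IsNilpotent) (hα : D.α = 1) (hl : 1 ≤ l) (hln : l < D.n)
    (hlam : lam ∈ D.I l) (hb : ∀ γ : G →* kˣ, lam (1, γ) = γ b) :
    (nonnilData hD hα hl hln hlam hb).C =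
      D.gradedC b (fun i => (i : ℤ) - D.n + l) (fun i => i) := rfl

theorem v_mem_weightSpace_of_nonnil (hD : ¬ D.IsNilpotent) (hα : D.α = 1) (hl : 1 ≤ l)
    (hln : l < D.n) (hlam : lam ∈ D.I l) (hb : ∀ γ : G →* kˣ, lam (1, γ) = γ b) (i : ℕ) :
    D.v i ∈ weightSpace (nonnilData hD hα hl hln hlam hb) lam b ((i : ℤ) - D.n + l) := by
  constructor
  · intro g
    rw [nonnilData_K, gradedK_v]
  · intro f
    rw [nonnilData_C, gradedC_v]

theorem u_mem_weightSpace_of_nonnil (hD : ¬ D.IsNilpotent) (hα : D.α = 1) (hl : 1 ≤ l)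
    (hln : l < D.n) (hlam : lam ∈ D.I l) (hb : ∀ γ : G →* kˣ, lam (1, γ) = γ b) (i : ℕ) :
    D.u i ∈ weightSpace (nonnilData hD hα hl hln hlam hb) lam b i := by
  constructor
  · intro g
    rw [nonnilData_K, gradedK_u]
  · intro f
    rw [nonnilData_C, gradedC_u]

theorem phi_zpow_zero_mul (lam : Weight k G) : D.φ ^ (0 : ℤ) * lam = lam :=
  MonoidHom.ext fun p => by rw [MonoidHom.mul_apply, zpow_apply', zpow_zero, one_mul]

theorem alphaCoeff_sigmaInv_ne (hl : 1 ≤ l) (hln : l < D.n) (hlam : lam ∈ D.I l) {i : ℕ}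
    (hi : i < D.n) (h0 : i ≠ 0) (h1 : i ≠ D.n - l) : D.alphaCoeff i (D.σInv l lam) ≠ 0 := by
  rcases lt_or_ge i (D.n - l) with h | h
  · exact alphaCoeff_sigmaInv_ne_zero hl hlam (by omega) h
  · rw [← alphaCoeff_sub_n_sub_l hl hln hlam h]
    exact alphaCoeff_lam_ne_zero hl hln hlam (by omega) (by omega)

/-- In weight λ the roots c_j are the negatives of the α_j(σ⁻¹(λ)), so for j < n the value 0 occurs
exactly at j = 0 and j = n - l. -/
theorem descCoeff_zero_eq (hl : 1 ≤ l) (hln : l < D.n) (hlam : lam ∈ D.I l) (j : ℕ) :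
    D.descCoeff lam 0 j = -D.alphaCoeff j (D.σInv l lam) := by
  apply cancel_rho D (by omega) j
  rw [descCoeff_closed hl hlam, mul_neg, alphaCoeff_sigmaInv hl hlam]
  simp
  ring

/-! ### Maps out of P(l, λ) in nilpotent type -/

section Nilpotent

variable {M : Type*} [AddCommGroup M] [Module k M] {E : D.DoubleData (Module.End k M)} {m : M}

theorem X_pow_eq_zero_of_nil (hD : D.IsNilpotent) {i : ℕ} (hi : D.n ≤ i) : E.X ^ i = 0 := by
  obtain ⟨j, rfl⟩ := Nat.exists_eq_add_of_le hi
  rw [pow_add, E.X_pow_n_of_nil hD, zero_mul]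

/-- The formulas force v_i ↦ xⁱ m and u_{n-l-1} ↦ ξm, so u_0 must map to a multiple of ξⁿ⁻ˡ m. The
descent lemmas give ξⁿ⁻ˡ⁺¹ m = 0 and ξxξm = 0, which make this choice consistent. -/
theorem exists_intertwines_of_nil (hD : D.IsNilpotent) (hl : 1 ≤ l) (hln : l < D.n)
    (hlam : lam ∈ D.I l) (hb : ∀ γ : G →* kˣ, lam (1, γ) = γ b)
    (hm : m ∈ genSpace E lam b 0 0) :
    ∃ F : D.PSpace →ₗ[k] M, F (D.v 0) = m ∧ Intertwines (nilData hD hl hln hlam hb) E F := by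
  have hn : 1 < D.n := by omega
  have hw : m ∈ weightSpace E lam b 0 := (mem_genSpace.1 hm).1
  have hc : ∀ j < D.n, j ≠ 0 → j ≠ D.n - l → D.descCoeff lam 0 j ≠ 0 := by
    intro j hj h0 h1
    rw [descCoeff_zero_eq hl hln hlam, neg_ne_zero]
    exact alphaCoeff_sigmaInv_ne hl hln hlam hj h0 h1
  have hcn : D.descCoeff lam 0 (D.n - l) = 0 := by
    rw [descCoeff_zero_eq hl hln hlam, alphaCoeff_n_sub_l hl hln hlam, neg_zero]
  have hY : (E.Y ^ (D.n - l + 1)) m = 0 :=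
    Y_pow_eq_zero_of_genSpace hb hn (by omega) (fun j h1 h2 => hc j h2 (by omega) (by omega)) hm
  have hYT : E.Y ((E.X * E.Y) m) = 0 := by
    have h := Y_pow_sub_eq_zero_of_genSpace hb hn (p := 1) (q := D.n - l) (by omega) (by omega) hcn
      (fun j h1 h2 => hc j (by omega) (by omega) (by omega))
      (fun j h1 h2 => hc j h2 (by omega) (by omega)) hm
    rwa [pow_one, zero_smul, sub_zero] at h
  let κ : ℕ → k := fun i => ∏ j ∈ Finset.range i, D.alphaCoeff (D.n - l - 1 - j) (D.σInv l lam)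
  -- Since ξxξm = 0, x acts on the string ξʲm, 2 ≤ j ≤ n - l, by the scalars α_{j-1}(σ⁻¹(λ)), which
  -- are nonzero.
  have chain : ∀ i, i + 1 ≤ D.n - l →
      (E.X ^ i) ((E.Y ^ (D.n - l)) m) = κ i • (E.Y ^ (D.n - l - i)) m := by
    intro i
    induction i with
    | zero => simp [κ]
    | succ i ih =>
      intro hi
      obtain ⟨j, hj⟩ : ∃ j, D.n - l - i = j + 1 + 1 := ⟨D.n - l - i - 2, by omega⟩
      rw [pow_succ', Module.End.mul_apply, ih (by omega), map_smul, hj, X_Y_pow_apply hb hw,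
        map_sub, pow_succ, Module.End.mul_apply, hYT, map_zero, zero_sub, ← pow_succ, map_smul,
        descCoeff_zero_eq hl hln hlam, neg_smul, neg_neg, smul_smul,
        show D.n - l - (i + 1) = j + 1 by omega]
      simp only [κ]
      rw [Finset.prod_range_succ, show D.n - l - 1 - i = j + 1 by omega]
  have hκ : κ (D.n - l - 1) ≠ 0 := by
    refine Finset.prod_ne_zero_iff.2 fun j hj => ?_
    have := Finset.mem_range.1 hj
    exact alphaCoeff_sigmaInv_ne_zero hl hlam (by omega) (by omega)
  -- Normalizes the image q ξⁿ⁻ˡ m of u_0 so that xⁿ⁻ˡ⁻¹ carries it to ξm.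
  set q := (κ (D.n - l - 1))⁻¹
  set w := (E.Y ^ (D.n - l)) m
  have hwY : E.Y w = 0 := by
    rw [← Module.End.mul_apply, ← pow_succ', hY]
  have hww : w ∈ weightSpace E lam b ((l : ℤ) - D.n) := by
    have := Y_pow_mem_weightSpace hw (D.n - l)
    rwa [Nat.cast_sub hln.le, zero_sub, neg_sub] at this
  have hYm : q • (E.X ^ (D.n - l - 1)) w = E.Y m := by
    rw [chain _ (by omega), smul_smul, inv_mul_cancel₀ hκ, one_smul,
      show D.n - l - (D.n - l - 1) = 1 by omega, pow_one]
  let F := D.basisMap (fun i => (E.X ^ i) m) (fun i => q • (E.X ^ i) w)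
  have Fv : ∀ i, F (D.v i) = (E.X ^ i) m := by
    intro i
    by_cases hi : i < D.n
    · exact basisMap_v _ _ hi
    · rw [D.v_of_ge (by omega), map_zero, X_pow_eq_zero_of_nil hD (by omega)]
      rfl
  have Fu : ∀ i, F (D.u i) = q • (E.X ^ i) w := by
    intro i
    by_cases hi : i < D.n
    · exact basisMap_u _ _ hi
    · rw [D.u_of_ge (by omega), map_zero, X_pow_eq_zero_of_nil hD (by omega), LinearMap.zero_apply,
        smul_zero]
  have wv : ∀ i : ℕ, (E.X ^ i) m ∈ weightSpace E lam b i := by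
    intro i
    simpa using X_pow_mem_weightSpace_of_nil hD hw i
  have wu : ∀ i : ℕ, (E.X ^ i) w ∈ weightSpace E lam b ((i : ℤ) - D.n + l) := by
    intro i
    have e : (i : ℤ) - D.n + l = l - D.n + i := by ring
    rw [e]
    exact X_pow_mem_weightSpace_of_nil hD hww i
  refine ⟨F, by simp [Fv], intertwines_of_basis (v_mem_weightSpace_of_nil hD hl hln hlam hb)
    (u_mem_weightSpace_of_nil hD hl hln hlam hb) ?_ ?_ ?_ ?_ ?_ ?_⟩ <;> intro i _
  · rw [Fv]
    exact wv i
  · rw [Fu]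
    exact Submodule.smul_mem _ _ (wu i)
  · change F (D.nilX (D.v i)) = E.X (F (D.v i))
    rw [nilX_v, Fv, Fv, pow_succ', Module.End.mul_apply]
  · change F (D.nilX (D.u i)) = E.X (F (D.u i))
    rw [nilX_u, Fu, Fu, pow_succ', Module.End.mul_apply, map_smul]
  · change F (D.nilXi l lam (D.v i)) = E.Y (F (D.v i))
    rw [nilXi_v hl hln hlam, map_add, map_smul, Fv, Fv, Fu, Y_X_pow_apply hb hw, ← hYm,
      phi_zpow_zero_mul, map_smul, ← Module.End.mul_apply (E.X ^ i), ← pow_add, add_comm i, add_comm]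
  · change F (D.nilXi l lam (D.u i)) = E.Y (F (D.u i))
    rw [nilXi_u hl hln hlam, map_smul, Fu, Fu, map_smul, Y_X_pow_apply hb hww, hwY, map_zero,
      zero_add, σInv, mul_comm lam, smul_comm]

end Nilpotent

/-! ### Maps out of P(l, λ) in non-nilpotent type -/

section NonNilpotent

theorem rho_pow_two_mul {j : ℕ} (hj : j < D.n) :
    (D.ρ : k) ^ (D.n - 1 - j) * (D.ρ : k) ^ (j + 1) = 1 := by
  rw [← pow_add, show D.n - 1 - j + (j + 1) = D.n by omega, rho_pow_n]

theorem alphaCoeff_sigmaInv_last (hl : 1 ≤ l) (hln : l < D.n) (hlam : lam ∈ D.I l) :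
    D.alphaCoeff (D.n - 1) (D.σInv l lam) = (1 - (D.ρ : k) ^ (l - 1)) * lam (1, D.χ) := by
  have hn : 1 < D.n := by omega
  apply cancel_rho D hn (D.n - 1)
  rw [alphaCoeff_sigmaInv hl hlam]
  have h := rho_pow_two_mul (D := D) (j := 0) (by omega)
  have e : l + (D.n - 1) = l - 1 + D.n := by omega
  rw [e, pow_add _ (l - 1), rho_pow_n]
  simp only [Nat.sub_zero, zero_add, pow_one] at h
  linear_combination ((1 - (D.ρ : k) ^ (l - 1)) * lam (1, D.χ)) * (-h)

/-- Locates the double root in weight λφˡ⁻¹: the difference vanishes for n - 1 - j = 0 and n - 1 - j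
= n - l, that is for j = n - 1 and j = l - 1. -/
theorem sub_descCoeff_eq (hl : 1 ≤ l) (hln : l < D.n) (hlam : lam ∈ D.I l) {j : ℕ}
    (hj : j < D.n) : D.alphaCoeff (D.n - 1) (D.σInv l lam) - D.descCoeff lam ((l : ℤ) - 1) j =
      D.alphaCoeff (D.n - 1 - j) (D.σInv l lam) := by
  have hn : 1 < D.n := by omega
  have hρ : (D.ρ : k) ≠ 0 := D.ρ.ne_zero
  obtain ⟨L, rfl⟩ := Nat.exists_eq_add_of_le' hl
  have h1 := descCoeff_closed hl hlam ((L + 1 : ℕ) - 1) j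
  have h2 := alphaCoeff_sigmaInv hl hlam (D.n - 1 - j)
  have h := rho_pow_two_mul hj
  have e1 : (((L + 1 : ℕ) : ℤ) - 1) = (L : ℤ) := by push_cast; ring
  have e2 : (D.ρ : k) ^ (L + 1 + j) * (D.ρ : k) ^ (-(L : ℤ)) = (D.ρ : k) ^ (j + 1) := by
    rw [← zpow_natCast, ← zpow_add₀ hρ, ← zpow_natCast]
    congr 1
    push_cast
    ring
  have e3 : (D.ρ : k) ^ (L + 1 + (D.n - 1 - j)) =
      (D.ρ : k) ^ L * D.ρ * (D.ρ : k) ^ (D.n - 1 - j) := by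
    rw [pow_add, pow_succ]
  rw [e1, e2, zpow_natCast] at h1
  rw [e3] at h2
  rw [e1, alphaCoeff_sigmaInv_last hl hln hlam, Nat.add_sub_cancel]
  apply cancel_rho D hn j
  rw [mul_sub, h1]
  generalize (D.ρ : k) ^ (D.n - 1 - j) = R at h h2
  rw [pow_succ] at *
  linear_combination (-((D.ρ : k) ^ j) ^ 2 * D.ρ) * h2 +
    ((D.ρ : k) ^ j * (D.ρ - 1) * D.alphaCoeff (D.n - 1 - j) (D.σInv (L + 1) lam) -
      lam (1, D.χ) * ((D.ρ : k) ^ L * (1 + R * (D.ρ : k) ^ j * D.ρ) - (D.ρ : k) ^ j -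
        (D.ρ : k) ^ j * D.ρ * (D.ρ : k) ^ L)) * h

/-- The counterpart of `sub_descCoeff_eq` for powers of x; it puts ξ xʲ⁺¹ m into the form required
by the descent lemmas. -/
theorem add_alphaCoeff_eq (hl : 1 ≤ l) (hln : l < D.n) (hlam : lam ∈ D.I l) (j : ℕ) :
    D.alphaCoeff (D.n - 1) (D.σInv l lam) + D.alphaCoeff (j + 1) (D.φ ^ ((l : ℤ) - 1) * lam) =
      D.alphaCoeff j (D.σInv l lam) := by
  have hn : 1 < D.n := by omega
  have hρ : (D.ρ : k) ≠ 0 := D.ρ.ne_zero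
  have h1 := D.alphaCoeff_closed (j + 1) (D.φ ^ ((l : ℤ) - 1) * lam)
  have h2 := alphaCoeff_sigmaInv hl hlam j
  have h := weight_a_one hlam
  obtain ⟨L, rfl⟩ := Nat.exists_eq_add_of_le' hl
  have e1 : (((L + 1 : ℕ) : ℤ) - 1) = (L : ℤ) := by push_cast; ring
  have h3 : ((D.ρ : k) ^ L)⁻¹ * (D.ρ : k) ^ L = 1 := inv_mul_cancel₀ (pow_ne_zero _ hρ)
  rw [e1] at h1 ⊢
  rw [Nat.add_sub_cancel] at h
  rw [MonoidHom.mul_apply, MonoidHom.mul_apply, zpow_apply', zpow_apply', zpow_natCast,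
    zpow_natCast, phi_one_chi, phi_a_one, Units.val_mul, Units.val_mul,
    Units.val_pow_eq_pow_val, Units.val_pow_eq_pow_val, Units.val_inv_eq_inv_val, h, inv_pow,
    ← mul_assoc ((D.ρ : k) ^ L)⁻¹, h3, one_mul] at h1
  rw [alphaCoeff_sigmaInv_last hl hln hlam, Nat.add_sub_cancel]
  apply cancel_rho D hn (j + 1)
  rw [mul_add, h1]
  have e3 : (D.ρ : k) ^ (L + 1 + j) = (D.ρ : k) ^ L * D.ρ * (D.ρ : k) ^ j := by
    rw [pow_add, pow_succ]
  rw [e3] at h2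
  rw [pow_succ] at *
  linear_combination (-D.ρ : k) * h2

variable {M : Type*} [AddCommGroup M] [Module k M] {E : D.DoubleData (Module.End k M)} {m : M}

variable (D) in
/-- The generalized eigenvalue of `x ξ` on the generators of weight `λ φˡ⁻¹`. -/
noncomputable def topCoeff (l : ℕ) (lam : Weight k G) : k := D.alphaCoeff (D.n - 1) (D.σInv l lam)

theorem topCoeff_sub_descCoeff (hl : 1 ≤ l) (hln : l < D.n) (hlam : lam ∈ D.I l) {j : ℕ}
    (hj : j < D.n) : D.topCoeff l lam - D.descCoeff lam ((l : ℤ) - 1) j =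
      D.alphaCoeff (D.n - 1 - j) (D.σInv l lam) := sub_descCoeff_eq hl hln hlam hj

theorem descCoeff_ne_topCoeff (hl : 1 ≤ l) (hln : l < D.n) (hlam : lam ∈ D.I l) {j : ℕ}
    (hj : j < D.n) (h0 : j ≠ l - 1) (h1 : j ≠ D.n - 1) :
    D.descCoeff lam ((l : ℤ) - 1) j ≠ D.topCoeff l lam := by
  intro h
  have h2 := topCoeff_sub_descCoeff hl hln hlam hj
  rw [h, sub_self] at h2
  exact alphaCoeff_sigmaInv_ne hl hln hlam (by omega) (by omega) (by omega) h2.symm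

theorem descCoeff_sub_one_eq (hl : 1 ≤ l) (hln : l < D.n) (hlam : lam ∈ D.I l) :
    D.descCoeff lam ((l : ℤ) - 1) (l - 1) = D.topCoeff l lam := by
  have h2 := topCoeff_sub_descCoeff hl hln hlam (j := l - 1) (by omega)
  rw [show D.n - 1 - (l - 1) = D.n - l by omega, alphaCoeff_n_sub_l hl hln hlam] at h2
  exact (sub_eq_zero.1 h2).symm

theorem descCoeff_last_eq (hl : 1 ≤ l) (hln : l < D.n) (hlam : lam ∈ D.I l) :
    D.descCoeff lam ((l : ℤ) - 1) (D.n - 1) = D.topCoeff l lam := by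
  have h2 := topCoeff_sub_descCoeff hl hln hlam (j := D.n - 1) (by omega)
  rw [Nat.sub_self, alphaCoeff_zero] at h2
  exact (sub_eq_zero.1 h2).symm

theorem X_pow_n_apply (hD : ¬ D.IsNilpotent) (hlam : lam ∈ D.I l) {e : ℤ}
    (hm : m ∈ weightSpace E lam b e) : (E.X ^ D.n) m = 0 := by
  rw [E.sat.pow, LinearMap.smul_apply, LinearMap.sub_apply, hm.1, wtGrp_a_pow_n hD hlam, one_smul,
    Module.End.one_apply, sub_self, smul_zero]

/-- Has the form of `X_Y_pow_apply` with x and ξ exchanged but the same operator xξ. The descent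
lemmas thus also control powers of x, starting from xⁿ m = 0 (`X_pow_n_apply`). -/
theorem Y_X_pow_succ_apply (hl : 1 ≤ l) (hln : l < D.n) (hlam : lam ∈ D.I l)
    (hb : ∀ γ : G →* kˣ, lam (1, γ) = γ b) (hm : m ∈ weightSpace E lam b ((l : ℤ) - 1)) (j : ℕ) :
    E.Y ((E.X ^ (j + 1)) m) = (E.X ^ j) ((E.X * E.Y) m -
      (D.topCoeff l lam - D.alphaCoeff j (D.σInv l lam)) • m) := by
  rw [Y_X_pow_apply hb hm, Nat.add_sub_cancel, ← add_alphaCoeff_eq hl hln hlam j, ← topCoeff,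
    sub_add_cancel_left, neg_smul, sub_neg_eq_add, map_add, map_smul, pow_succ,
    Module.End.mul_apply, Module.End.mul_apply]

theorem topCoeff_sub_ne (hl : 1 ≤ l) (hln : l < D.n) (hlam : lam ∈ D.I l) {j : ℕ}
    (hj : j < D.n) (h0 : j ≠ 0) (h1 : j ≠ D.n - l) :
    D.topCoeff l lam - D.alphaCoeff j (D.σInv l lam) ≠ D.topCoeff l lam := by
  rw [Ne, sub_eq_self]
  exact alphaCoeff_sigmaInv_ne hl hln hlam hj h0 h1

theorem X_pow_eq_zero_of_genSpace (hD : ¬ D.IsNilpotent) (hl : 1 ≤ l) (hln : l < D.n)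
    (hlam : lam ∈ D.I l) (hb : ∀ γ : G →* kˣ, lam (1, γ) = γ b)
    (hm : m ∈ genSpace E lam b ((l : ℤ) - 1) (D.topCoeff l lam)) :
    (E.X ^ (D.n - l + 1)) m = 0 :=
  pow_eq_zero_of_descent (X := E.Y) (S := genSpace E lam b ((l : ℤ) - 1) (D.topCoeff l lam))
    (fun _ h => XY_mem_genSpace (by omega) h) (fun _ h => (mem_genSpace.1 h).2)
    (fun _ h => Y_X_pow_succ_apply hl hln hlam hb (mem_genSpace.1 h).1) (by omega)
    (fun j h1 h2 => topCoeff_sub_ne hl hln hlam h2 (by omega) (by omega))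
    (fun _ h => X_pow_n_apply hD hlam (mem_genSpace.1 h).1) m hm

/-- Corresponds to x u_{l-1} = 0 in P(l, λ); the second occurrence of the double root, for powers of
x, is at n - l. -/
theorem X_sub_eq_zero_of_genSpace (hD : ¬ D.IsNilpotent) (hl : 1 ≤ l) (hln : l < D.n)
    (hlam : lam ∈ D.I l) (hb : ∀ γ : G →* kˣ, lam (1, γ) = γ b)
    (hm : m ∈ genSpace E lam b ((l : ℤ) - 1) (D.topCoeff l lam)) :
    E.X ((E.X * E.Y) m - D.topCoeff l lam • m) = 0 := by
  have h := pow_sub_eq_zero_of_descent (X := E.Y) (Y := E.X) (p := 1) (q := D.n - l) (N := D.n)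
    (S := genSpace E lam b ((l : ℤ) - 1) (D.topCoeff l lam))
    (fun _ h => XY_mem_genSpace (by omega) h) (fun _ h => (mem_genSpace.1 h).2)
    (fun _ h => Y_X_pow_succ_apply hl hln hlam hb (mem_genSpace.1 h).1) (by omega) (by omega)
    (by rw [alphaCoeff_n_sub_l hl hln hlam, sub_zero])
    (fun j h1 h2 => topCoeff_sub_ne hl hln hlam (by omega) (by omega) (by omega))
    (fun j h1 h2 => topCoeff_sub_ne hl hln hlam h2 (by omega) (by omega))
    (fun _ h => X_pow_n_apply hD hlam (mem_genSpace.1 h).1) m hm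
  rwa [pow_one] at h

theorem Y_pow_l_sub_eq_zero (hl : 1 ≤ l) (hln : l < D.n) (hlam : lam ∈ D.I l)
    (hb : ∀ γ : G →* kˣ, lam (1, γ) = γ b)
    (hm : m ∈ genSpace E lam b ((l : ℤ) - 1) (D.topCoeff l lam)) :
    (E.Y ^ l) ((E.X * E.Y) m - D.topCoeff l lam • m) = 0 :=
  Y_pow_sub_eq_zero_of_genSpace hb (by omega) (by omega) (by omega)
    (descCoeff_last_eq hl hln hlam)
    (fun j h1 h2 => descCoeff_ne_topCoeff hl hln hlam (by omega) (by omega) (by omega))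
    (fun j h1 h2 => by omega) hm

/-- `x ξʲ⁺¹ m = ξʲ (x ξ - c) m + α_{n-1-j} ξʲ m`. -/
theorem X_Y_pow_succ_apply (hl : 1 ≤ l) (hln : l < D.n) (hlam : lam ∈ D.I l)
    (hb : ∀ γ : G →* kˣ, lam (1, γ) = γ b) (hm : m ∈ weightSpace E lam b ((l : ℤ) - 1)) {j : ℕ}
    (hj : j < D.n) : E.X ((E.Y ^ (j + 1)) m) =
      (E.Y ^ j) ((E.X * E.Y) m - D.topCoeff l lam • m) +
        D.alphaCoeff (D.n - 1 - j) (D.σInv l lam) • (E.Y ^ j) m := by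
  rw [X_Y_pow_apply hb hm, ← topCoeff_sub_descCoeff hl hln hlam hj, ← map_smul, ← map_add, sub_smul,
    sub_add_sub_cancel]

/-- `x m - y ξⁿ⁻¹ m` is a weight vector. -/
theorem X_sub_mem_weightSpace (hD : ¬ D.IsNilpotent) (hα : D.α = 1)
    (hb : ∀ γ : G →* kˣ, lam (1, γ) = γ b) (hn : 1 < D.n)
    (hm : m ∈ weightSpace E lam b ((l : ℤ) - 1)) :
    E.X m - D.yCoeff l lam • (E.Y ^ (D.n - 1)) m ∈ weightSpace E lam b l := by
  -- The vector ξⁿ⁻¹ m has weight λφˡ⁻ⁿ. As χⁿ = 1, G does not distinguish this weight from λφˡ, but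
  -- functions on G do; subtracting y ξⁿ⁻¹ m cancels the correction in `C_X`.
  have h1 := Y_pow_mem_weightSpace hm (D.n - 1)
  rw [show ((l : ℤ) - 1 - ((D.n - 1 : ℕ) : ℤ)) = l - D.n by omega] at h1
  constructor
  · intro g
    have h2 := K_X_apply hm g
    rw [sub_add_cancel] at h2
    rw [map_sub, map_smul, h2, h1.1, wtGrp_sub_n hD, smul_comm, smul_sub]
  · intro f
    have h2 := LinearMap.congr_fun (E.C_X f) m
    have e1 : b * D.a ^ (l : ℤ) * (D.a ^ D.n)⁻¹ = b * D.a ^ ((l : ℤ) - D.n) := by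
      rw [mul_assoc, zpow_sub, zpow_natCast D.a D.n]
    simp only [LinearMap.sub_apply, LinearMap.smul_apply, Module.End.mul_apply, hm.1, hm.2,
      map_smul, deg_mul_a, sub_add_cancel, e1, ← sub_smul, smul_smul] at h2
    rw [map_sub, map_smul, h1.2, h2, yCoeff_eq_weight hα hb, smul_sub, smul_smul, smul_smul,
      sub_sub, ← add_smul]
    congr 2
    ring

/-- By induction ξˡ⁺¹⁺ʲ kills xʲw. As long as l + 1 + j ≤ n - 1 no correction arises, so a further x
still yields a weight vector. -/
theorem X_pow_mem_weightSpace_of_top (hl : 1 ≤ l) (hln : l < D.n) (hlam : lam ∈ D.I l)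
    (hb : ∀ γ : G →* kˣ, lam (1, γ) = γ b) {w : M} (hw : w ∈ weightSpace E lam b l)
    (hX : E.X (E.Y w) = 0) (hY : (E.Y ^ l) (E.Y w) = 0) :
    (∀ j, E.Y ((E.X ^ (j + 1)) w) =
        D.alphaCoeff (j + 1) (D.σInv l lam) • (E.X ^ j) w) ∧
      ∀ j < D.n - l, (E.X ^ j) w ∈ weightSpace E lam b (l + j : ℕ) := by
  have h1 : ∀ j, E.Y ((E.X ^ (j + 1)) w) =
      D.alphaCoeff (j + 1) (D.σInv l lam) • (E.X ^ j) w := by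
    intro j
    have e : D.φ ^ (l : ℤ) * lam = D.σ l lam := by
      exact MonoidHom.ext fun p => by
        rw [σ, MonoidHom.mul_apply, MonoidHom.mul_apply, zpow_apply', zpow_natCast,
          MonoidHom.pow_apply, mul_comm]
    rw [Y_X_pow_apply hb hw, pow_succ, Module.End.mul_apply, hX, map_zero, zero_add, e,
      alphaCoeff_sigma_eq hl hln hlam, Nat.add_sub_cancel]
  have h2 : ∀ j, (E.Y ^ (l + 1 + j)) ((E.X ^ j) w) = 0 := by
    intro j
    induction j with
    | zero => rwa [add_zero, pow_zero, Module.End.one_apply, pow_succ]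
    | succ j ih => rw [← add_assoc, pow_succ, Module.End.mul_apply, h1, map_smul, ih, smul_zero]
  refine ⟨h1, fun j => ?_⟩
  induction j with
  | zero => intro _; simpa using hw
  | succ j ih =>
    intro hj
    have h3 : (E.Y ^ (D.n - 1)) ((E.X ^ j) w) = 0 := by
      rw [show D.n - 1 = (D.n - 1 - (l + 1 + j)) + (l + 1 + j) by omega, pow_add,
        Module.End.mul_apply, h2, map_zero]
    have := X_mem_weightSpace (ih (by omega)) (Or.inr h3)
    rwa [← Module.End.mul_apply, ← pow_succ'] at this

theorem X_pow_Y_pow_apply (hl : 1 ≤ l) (hln : l < D.n) (hlam : lam ∈ D.I l)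
    (hb : ∀ γ : G →* kˣ, lam (1, γ) = γ b) (hm : m ∈ weightSpace E lam b ((l : ℤ) - 1))
    (hY : (E.Y ^ l) ((E.X * E.Y) m - D.topCoeff l lam • m) = 0) {i : ℕ} (hi : i < D.n - l) :
    (E.X ^ i) ((E.Y ^ (D.n - 1)) m) =
      (∏ j ∈ Finset.range i, D.alphaCoeff (j + 1) (D.σInv l lam)) • (E.Y ^ (D.n - 1 - i)) m := by
  induction i with
  | zero => simp
  | succ i ih =>
    rw [pow_succ', Module.End.mul_apply, ih (by omega), map_smul,
      show D.n - 1 - i = (D.n - 1 - (i + 1) - l) + l + 1 by omega,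
      X_Y_pow_succ_apply hl hln hlam hb hm (by omega), pow_add E.Y _ l, Module.End.mul_apply, hY,
      map_zero, zero_add, ← pow_add, smul_smul, Finset.prod_range_succ,
      show D.n - 1 - (D.n - 1 - (i + 1) - l + l) = i + 1 by omega,
      show D.n - 1 - (i + 1) - l + l = D.n - 1 - (i + 1) by omega]

/-- With v_{n-1} ↦ m, applying ξ determines the v_i, and (xξ - c) m is the image of u_{l-1}. The
vector U = xm - y ξⁿ⁻¹ m is the image of u_l, and x continues from it up to u_{n-1}. The relations
left to check reduce to x and ξˡ killing (xξ - c) m, and to the value of xⁿ⁻ˡ U. -/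
theorem exists_intertwines_of_nonnil (hD : ¬ D.IsNilpotent) (hα : D.α = 1) (hl : 1 ≤ l)
    (hln : l < D.n) (hlam : lam ∈ D.I l) (hb : ∀ γ : G →* kˣ, lam (1, γ) = γ b)
    (hm : m ∈ genSpace E lam b ((l : ℤ) - 1) (D.topCoeff l lam)) :
    ∃ F : D.PSpace →ₗ[k] M, F (D.v (D.n - 1)) = m ∧
      Intertwines (nonnilData hD hα hl hln hlam hb) E F := by
  have hn : 1 < D.n := by omega
  have hw := (mem_genSpace.1 hm).1
  have hXY := fun {j} => X_Y_pow_succ_apply hl hln hlam hb hw (j := j)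
  have hXr := X_sub_eq_zero_of_genSpace hD hl hln hlam hb hm
  have hYr := Y_pow_l_sub_eq_zero hl hln hlam hb hm
  have hchain := fun {i} => X_pow_Y_pow_apply hl hln hlam hb hw hYr (i := i)
  have hrw := (mem_genSpace.1 (sub_mem_genSpace hn hm)).1
  have hrT := (mem_genSpace.1 hm).2
  set r := (E.X * E.Y) m - D.topCoeff l lam • m
  have hXYr := fun {j} => X_Y_pow_succ_apply hl hln hlam hb hrw (j := j)
  rw [hrT, sub_self] at hXYr
  have hU := X_sub_mem_weightSpace hD hα hb hn hw
  -- By ξⁿ = 0 the y-term drops out, and ξxm = (xξ - c) m is the case j = 0 of `Y_X_pow_succ_apply`.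
  have hYU : E.Y (E.X m - D.yCoeff l lam • (E.Y ^ (D.n - 1)) m) = r := by
    have h1 := Y_X_pow_succ_apply hl hln hlam hb hw 0
    rw [alphaCoeff_zero, sub_zero, zero_add, pow_one, pow_zero, Module.End.one_apply] at h1
    rw [map_sub, map_smul, ← Module.End.mul_apply, ← Module.End.mul_apply, ← pow_succ',
      Nat.sub_add_cancel hn.le, E.Y_pow, LinearMap.zero_apply, smul_zero, sub_zero]
    exact h1
  -- As xⁿ⁻ˡ⁺¹ m = 0, only the y-term remains. It climbs the string from ξⁿ⁻¹ m to ξˡ m, and the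
  -- last x gives ξˡ⁻¹ (xξ - c) m, since the coefficient α_{n-l}(σ⁻¹(λ)) of ξˡ⁻¹ m is zero.
  have hXU : (E.X ^ (D.n - l)) (E.X m - D.yCoeff l lam • (E.Y ^ (D.n - 1)) m) =
      -(D.yCoeff l lam * ∏ j ∈ Finset.range (D.n - 1 - l), D.alphaCoeff (j + 1) (D.σInv l lam)) •
        (E.Y ^ (l - 1)) r := by
    have e1 : D.n - l = D.n - 1 - l + 1 := by omega
    have h2 := hXY (j := l - 1) (by omega)
    rw [Nat.sub_add_cancel hl, show D.n - 1 - (l - 1) = D.n - l by omega,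
      alphaCoeff_n_sub_l hl hln hlam, zero_smul, add_zero] at h2
    rw [map_sub, map_smul, ← Module.End.mul_apply, ← pow_succ,
      X_pow_eq_zero_of_genSpace hD hl hln hlam hb hm, zero_sub, e1, pow_succ',
      Module.End.mul_apply, hchain (by omega), map_smul, show D.n - 1 - (D.n - 1 - l) = l by omega,
      h2, smul_smul, neg_smul]
  set U := E.X m - D.yCoeff l lam • (E.Y ^ (D.n - 1)) m with hUdef
  obtain ⟨hYX, hUw⟩ := X_pow_mem_weightSpace_of_top hl hln hlam hb hU (by rw [hYU, hXr])
    (by rw [hYU, hYr])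
  let p : ℕ → k := fun i => ∏ j ∈ Finset.range i, D.alphaCoeff (j + 1) (D.σInv l lam)
  have hp : ∀ i, p (i + 1) = p i * D.alphaCoeff (i + 1) (D.σInv l lam) :=
    fun i => Finset.prod_range_succ _ _
  have hp0 : p 0 = 1 := rfl
  have hpne : ∀ i < D.n - l, p i ≠ 0 := fun i hi => Finset.prod_ne_zero_iff.2 fun j hj =>
    alphaCoeff_sigmaInv_ne_zero hl hlam (by omega) (by have := Finset.mem_range.1 hj; omega)
  change (E.X ^ (D.n - l)) U = -(D.yCoeff l lam * p (D.n - 1 - l)) • (E.Y ^ (l - 1)) r at hXU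
  -- Dividing by the product p of α's turns the powers of x into the required x u_{l+j} =
  -- α_{j+1}(σ(λ)) u_{l+j+1}. The relation x u_{n-1} = z u_0 is then `hXU` with z = -y.
  let F := D.basisMap (fun i => (E.Y ^ (D.n - 1 - i)) m)
    (fun i => if i < l then (E.Y ^ (l - 1 - i)) r else (p (i - l))⁻¹ • (E.X ^ (i - l)) U)
  have Fv : ∀ {i}, i < D.n → F (D.v i) = (E.Y ^ (D.n - 1 - i)) m := fun h => basisMap_v _ _ h
  have Fu : ∀ {i}, i < l → F (D.u i) = (E.Y ^ (l - 1 - i)) r := fun h =>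
    (basisMap_u _ _ (by omega)).trans (if_pos h)
  have Fu' : ∀ {j}, j < D.n - l → F (D.u (l + j)) = (p j)⁻¹ • (E.X ^ j) U := fun {j} h =>
    (basisMap_u _ _ (by omega)).trans ((if_neg (by omega)).trans
      (by rw [Nat.add_sub_cancel_left]))
  refine ⟨F, by simp [Fv (show D.n - 1 < D.n by omega)],
    intertwines_of_basis (v_mem_weightSpace_of_nonnil hD hα hl hln hlam hb)
    (u_mem_weightSpace_of_nonnil hD hα hl hln hlam hb) ?_ ?_ ?_ ?_ ?_ ?_⟩ <;> intro i hi
  · have := Y_pow_mem_weightSpace hw (D.n - 1 - i)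
    rw [show ((l : ℤ) - 1 - ((D.n - 1 - i : ℕ) : ℤ)) = (i : ℤ) - D.n + l by omega] at this
    rwa [Fv hi]
  · by_cases h : i < l
    · have := Y_pow_mem_weightSpace hrw (l - 1 - i)
      rw [show ((l : ℤ) - 1 - ((l - 1 - i : ℕ) : ℤ)) = (i : ℤ) by omega] at this
      rwa [Fu h]
    · obtain ⟨j, rfl⟩ := Nat.exists_eq_add_of_le (not_lt.1 h)
      rw [Fu' (by omega)]
      exact Submodule.smul_mem _ _ (hUw j (by omega))
  · change F (D.nonnilX l lam (D.v i)) = E.X (F (D.v i))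
    rcases Nat.lt_or_ge (i + 1) D.n with h | h
    · rw [nonnilX_v hl hln hlam h, Fv hi, map_add, map_smul, Fv h,
        show D.n - 1 - i = D.n - 1 - (i + 1) + 1 by omega, hXY (by omega),
        show D.n - 1 - (D.n - 1 - (i + 1)) = i + 1 by omega, add_comm]
      congr 1
      split_ifs with h'
      · rw [Fu (by omega)]
        congr 2
        omega
      · rw [show D.n - 1 - (i + 1) = D.n - 1 - (i + 1) - l + l by omega, pow_add,
          Module.End.mul_apply, hYr, map_zero, map_zero]
    · have h' : i + 1 = D.n := by omega
      have := Fu' (j := 0) (by omega)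
      rw [add_zero, hp0, inv_one, one_smul, pow_zero, Module.End.one_apply] at this
      rw [nonnilX_v_last hl hln h', map_add, map_smul, Fv (by omega), Fv hi, this, hUdef,
        show D.n - 1 - i = 0 by omega, Nat.sub_zero, pow_zero, Module.End.one_apply,
        add_sub_cancel]
  · change F (D.nonnilX l lam (D.u i)) = E.X (F (D.u i))
    rcases Nat.lt_or_ge (i + 1) D.n with h | h
    · rw [nonnilX_u hl hln hlam h, map_smul]
      rcases Nat.lt_trichotomy (i + 1) l with h' | h' | h'
      · rw [Fu h', Fu (by omega), show l - 1 - i = l - 1 - (i + 1) + 1 by omega, hXYr (by omega),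
          map_zero, zero_add, ← alphaCoeff_sub_n_sub_l hl hln hlam (by omega),
          show D.n - 1 - (l - 1 - (i + 1)) - (D.n - l) = i + 1 by omega]
      · rw [h', alphaCoeff_l hl hln hlam, zero_smul, Fu (by omega),
          show l - 1 - i = 0 by omega, pow_zero, Module.End.one_apply, hXr]
      · obtain ⟨j, rfl⟩ := Nat.exists_eq_add_of_le (Nat.lt_succ_iff.1 h')
        rw [add_assoc] at h ⊢
        rw [Fu' (by omega), Fu' (by omega), map_smul, ← Module.End.mul_apply, ← pow_succ',
          ← alphaCoeff_sub_l hl hln hlam (by omega), Nat.add_sub_cancel_left,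
          alphaCoeff_sigma_eq hl hln hlam, hp, smul_smul]
        congr 1
        have h1 := hpne (j + 1) (by omega)
        rw [hp] at h1
        have h2 := left_ne_zero_of_mul h1
        have h3 := right_ne_zero_of_mul h1
        field_simp
    · have h' : i + 1 = D.n := by omega
      obtain ⟨j, rfl⟩ := Nat.exists_eq_add_of_le (show l ≤ i by omega)
      have e1 : D.n - l = j + 1 := by omega
      have e2 : D.n - 1 - l = j := by omega
      rw [e1, e2] at hXU
      rw [nonnilX_u_last hln h', map_smul, Fu (by omega), Fu' (by omega), map_smul,
        ← Module.End.mul_apply, ← pow_succ', hXU, smul_smul, zCoeff_eq hl hlam, Nat.sub_zero]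
      congr 1
      have h1 := hpne j (by omega)
      field_simp
  · change F (D.nonnilXi (D.v i)) = E.Y (F (D.v i))
    rw [nonnilXi_v hi, Fv hi]
    split_ifs with h
    · rw [map_zero, ← Module.End.mul_apply, ← pow_succ', show D.n - 1 - i + 1 = D.n by omega,
        E.Y_pow, LinearMap.zero_apply]
    · rw [Fv (by omega), ← Module.End.mul_apply, ← pow_succ',
        show D.n - 1 - i + 1 = D.n - 1 - (i - 1) by omega]
  · change F (D.nonnilXi (D.u i)) = E.Y (F (D.u i))
    rw [nonnilXi_u hi]
    rcases Nat.lt_trichotomy i l with h' | rfl | h'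
    · rw [Fu h', ← Module.End.mul_apply, ← pow_succ']
      split_ifs with h
      · rw [map_zero, show l - 1 - i + 1 = l by omega, hYr]
      · rw [Fu (by omega), show l - 1 - i + 1 = l - 1 - (i - 1) by omega]
    · have := Fu' (j := 0) (by omega)
      rw [add_zero, hp0, inv_one, one_smul, pow_zero, Module.End.one_apply] at this
      rw [if_neg (by omega), this, hYU, Fu (by omega), Nat.sub_self, pow_zero,
        Module.End.one_apply]
    · obtain ⟨j, rfl⟩ := Nat.exists_eq_add_of_le h'
      rw [Nat.succ_eq_add_one, add_assoc, add_comm 1 j, if_neg (by omega),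
        show l + (j + 1) - 1 = l + j by omega, Fu' (by omega), Fu' (by omega), map_smul, hYX, hp,
        smul_smul]
      congr 1
      have h1 := hpne (j + 1) (by omega)
      rw [hp] at h1
      have h2 := left_ne_zero_of_mul h1
      have h3 := right_ne_zero_of_mul h1
      field_simp

end NonNilpotent

end Lifting

end GroupDatum

/-! ### Properties of `P(l, λ)` that characterize it -/

namespace GroupDatum

section Characterization

universe u₁ u₂

variable {k : Type u₁} {G : Type u₂} [Field k] [CommGroup G] [Finite G] {D : GroupDatum k G}

/-- The properties of the action `E` on `P(l, λ)` which imply that it is a projective cover of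
`L(λ)`: it is universal for vectors of weight `λ φᵉ` which are killed by `(x ξ - c)²`, and the
vectors of weight `λ φᵉ` are spanned by the universal vector `w` and `w' = (x ξ - c) w`. -/
structure IsUniversal (E : D.DoubleData (Module.End k D.PSpace)) (lam : Weight k G) (b : G)
    (e : ℤ) (c : k) (w w' : D.PSpace) : Prop where
  mem : w ∈ genSpace E lam b e c
  sub_eq : (E.X * E.Y) w - c • w = w'
  mem_span : ∀ p ∈ weightSpace E lam b e, p ∈ Submodule.span k {w, w'}
  generates : ∀ N : Submodule k D.PSpace, (∀ p ∈ N, E.X p ∈ N) → (∀ p ∈ N, E.Y p ∈ N) → w ∈ N →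
    N = ⊤
  exists_singular : ∃ s ∈ weightSpace E lam b 0, E.Y s = 0 ∧ s ≠ 0
  -- The only modules to which this is applied are D(H_D) and Z(λ), which live in this universe.
  exists_intertwines : ∀ {M : Type (max u₁ u₂)} [AddCommGroup M] [Module k M]
    (E' : D.DoubleData (Module.End k M)), ∀ m ∈ genSpace E' lam b e c,
      ∃ F : D.PSpace →ₗ[k] M, F w = m ∧ Intertwines E E' F
  exists_mem_genSpace : ∀ {M : Type (max u₁ u₂)} [AddCommGroup M] [Module k M]
    (E' : D.DoubleData (Module.End k M)), ∀ z ∈ weightSpace E' lam b 0, E'.Y z = 0 →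
      ∃ m ∈ genSpace E' lam b e c, ∀ N : Submodule k M, (∀ p ∈ N, E'.Y p ∈ N) → m ∈ N → z ∈ N
  exists_descCoeff : ∃ j₀ j₁, j₀ < j₁ ∧ j₁ < D.n ∧ D.descCoeff lam e j₀ = c ∧
    D.descCoeff lam e j₁ = c ∧ ∀ j < D.n, j ≠ j₀ → j ≠ j₁ → D.descCoeff lam e j ≠ c

variable {l : ℕ} {lam : Weight k G} {b : G}

theorem u_ne_zero {i : ℕ} (hi : i < D.n) : D.u i ≠ 0 := by
  rw [u_of_lt D hi]
  exact Finsupp.single_ne_zero.2 one_ne_zero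

theorem eq_top_of_mem {N : Submodule k D.PSpace} (hv : ∀ i < D.n, D.v i ∈ N)
    (hu : ∀ i < D.n, D.u i ∈ N) : N = ⊤ := by
  have h : N.mkQ = 0 := pSpace_ext
    (fun i hi => by rw [LinearMap.zero_apply, Submodule.mkQ_apply,
      (Submodule.Quotient.mk_eq_zero N).2 (hv i hi)])
    (fun i hi => by rw [LinearMap.zero_apply, Submodule.mkQ_apply,
      (Submodule.Quotient.mk_eq_zero N).2 (hu i hi)])
  rw [← N.ker_mkQ, h, LinearMap.ker_zero]

theorem diagOp_apply_inl (wv wu : ℕ → k) (p : D.PSpace) (i : Fin D.n) :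
    D.diagOp wv wu p (Sum.inl i) = wv i * p (Sum.inl i) := by
  have h : Finsupp.lapply (Sum.inl i) ∘ₗ D.diagOp wv wu =
      wv i • (Finsupp.lapply (Sum.inl i) : D.PSpace →ₗ[k] k) := by
    apply pSpace_ext <;> intro j hj
    · rw [LinearMap.comp_apply, diagOp_v, map_smul, LinearMap.smul_apply, v_of_lt D hj,
        Finsupp.lapply_apply, Finsupp.single_apply]
      split_ifs with h
      · rw [← Sum.inl.inj h]
      · rw [smul_zero, smul_zero]
    · rw [LinearMap.comp_apply, diagOp_u, map_smul, LinearMap.smul_apply, u_of_lt D hj,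
        Finsupp.lapply_apply, Finsupp.single_apply, if_neg Sum.inr_ne_inl, smul_zero, smul_zero]
  exact LinearMap.congr_fun h p

theorem diagOp_apply_inr (wv wu : ℕ → k) (p : D.PSpace) (i : Fin D.n) :
    D.diagOp wv wu p (Sum.inr i) = wu i * p (Sum.inr i) := by
  have h : Finsupp.lapply (Sum.inr i) ∘ₗ D.diagOp wv wu =
      wu i • (Finsupp.lapply (Sum.inr i) : D.PSpace →ₗ[k] k) := by
    apply pSpace_ext <;> intro j hj
    · rw [LinearMap.comp_apply, diagOp_v, map_smul, LinearMap.smul_apply, v_of_lt D hj,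
        Finsupp.lapply_apply, Finsupp.single_apply, if_neg Sum.inl_ne_inr, smul_zero, smul_zero]
    · rw [LinearMap.comp_apply, diagOp_u, map_smul, LinearMap.smul_apply, u_of_lt D hj,
        Finsupp.lapply_apply, Finsupp.single_apply]
      split_ifs with h
      · rw [← Sum.inr.inj h]
      · rw [smul_zero, smul_zero]
  exact LinearMap.congr_fun h p

theorem wtGrp_a_injOn {e e' : ℤ} (h : D.wtGrp lam e D.a = D.wtGrp lam e' D.a) :
    (D.n : ℤ) ∣ e - e' := by
  rw [wtGrp_a, wtGrp_a] at h
  have h1 := mul_left_cancel₀ (lam (D.a, 1)).ne_zero h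
  rw [← Units.val_zpow_eq_zpow_val, ← Units.val_zpow_eq_zpow_val] at h1
  have h2 : D.ρ ^ (e - e') = 1 := by
    rw [zpow_sub, mul_inv_eq_one, ← inv_inj, ← zpow_neg, ← zpow_neg]
    exact Units.ext h1
  exact orderOf_dvd_iff_zpow_eq_one.2 h2

/-- The eigenvalue of a alone determines the exponent of φ modulo n, since ρ has order n. By
hypothesis at most one v_i and one u_i have the right residue. -/
theorem mem_span_of_gradedK {ev eu : ℕ → ℤ} {e : ℤ} {i₀ i₁ : ℕ} (h₀ : i₀ < D.n) (h₁ : i₁ < D.n)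
    (hv : ∀ i < D.n, (D.n : ℤ) ∣ ev i - e → i = i₀)
    (hu : ∀ i < D.n, (D.n : ℤ) ∣ eu i - e → i = i₁) {p : D.PSpace}
    (hp : D.gradedK lam ev eu D.a p = D.wtGrp lam e D.a • p) :
    p ∈ Submodule.span k {D.v i₀, D.u i₁} := by
  refine Submodule.mem_span_pair.2 ⟨p (Sum.inl ⟨i₀, h₀⟩), p (Sum.inr ⟨i₁, h₁⟩), ?_⟩
  rw [v_of_lt D h₀, u_of_lt D h₁, Finsupp.smul_single, Finsupp.smul_single, smul_eq_mul,
    smul_eq_mul, mul_one, mul_one]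
  ext i
  rw [Finsupp.add_apply, Finsupp.single_apply, Finsupp.single_apply]
  rcases i with i | i
  · have h := DFunLike.congr_fun hp (Sum.inl i)
    rw [gradedK, diagOp_apply_inl, Finsupp.smul_apply, smul_eq_mul, mul_eq_mul_right_iff] at h
    rw [if_neg Sum.inr_ne_inl, add_zero]
    split_ifs with hi
    · rw [hi]
    · refine (h.resolve_left fun h => hi ?_).symm
      have := hv i i.2 (wtGrp_a_injOn h)
      congr 1
      exact Fin.ext this.symm
  · have h := DFunLike.congr_fun hp (Sum.inr i)
    rw [gradedK, diagOp_apply_inr, Finsupp.smul_apply, smul_eq_mul, mul_eq_mul_right_iff] at h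
    rw [if_neg Sum.inl_ne_inr, zero_add]
    split_ifs with hi
    · rw [hi]
    · refine (h.resolve_left fun h => hi ?_).symm
      have := hu i i.2 (wtGrp_a_injOn h)
      congr 1
      exact Fin.ext this.symm

theorem eq_of_dvd_sub {n : ℕ} {i j : ℕ} (hi : i < n) (hj : j < n)
    (h : (n : ℤ) ∣ (i : ℤ) - j) : i = j := by
  have := Int.eq_zero_of_abs_lt_dvd h (by rw [abs_lt]; omega)
  omega

/-- Here w = v_0 and w' = xξv_0 = u_{n-l}. From v_0, x reaches every v_i, and ξ reaches u_{n-l-1}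
and descends to u_0 with nonzero coefficients; x then climbs the u-chain. The singular vector is
u_{n-l}. -/
theorem isUniversal_of_nil (hD : D.IsNilpotent) (hl : 1 ≤ l) (hln : l < D.n) (hlam : lam ∈ D.I l)
    (hb : ∀ γ : G →* kˣ, lam (1, γ) = γ b) :
    IsUniversal (nilData hD hl hln hlam hb) lam b 0 0 (D.v 0) (D.u (D.n - l)) := by
  have hT : ((nilData hD hl hln hlam hb).X * (nilData hD hl hln hlam hb).Y) (D.v 0) =
      D.u (D.n - l) := by
    change D.nilX (D.nilXi l lam (D.v 0)) = _
    rw [nilXi_v hl hln hlam, alphaCoeff_zero, zero_smul, zero_add, nilX_u, add_zero,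
      Nat.sub_add_cancel (by omega)]
  have hu0 : (nilData hD hl hln hlam hb).Y (D.u (D.n - l)) = 0 := by
    change D.nilXi l lam _ = _
    rw [nilXi_u hl hln hlam, alphaCoeff_n_sub_l hl hln hlam, zero_smul]
  constructor
  · refine mem_genSpace.2 ⟨v_mem_weightSpace_of_nil hD hl hln hlam hb 0, ?_⟩
    rw [zero_smul, zero_smul, sub_zero, hT, Module.End.mul_apply, hu0, map_zero]
  · rw [hT, zero_smul, sub_zero]
  · intro p hp
    have hp' := hp.1 D.a
    rw [nilData_K] at hp'
    refine mem_span_of_gradedK (by omega) (by omega)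
      (fun i hi h => eq_of_dvd_sub hi (by omega) (by simpa using h)) (fun i hi h => ?_) hp'
    refine eq_of_dvd_sub hi (by omega) ?_
    rwa [Nat.cast_sub hln.le, ← sub_add, ← sub_zero ((i : ℤ) - D.n + l)]
  · intro N hX hY hw
    have hv : ∀ i, D.v i ∈ N := by
      intro i
      induction i with
      | zero => exact hw
      | succ i ih =>
        have := hX _ ih
        change D.nilX _ ∈ N at this
        rwa [nilX_v] at this
    have hu : ∀ i ≤ D.n - l - 1, D.u i ∈ N := by
      intro i hi
      induction hi using Nat.decreasingInduction with
      | self =>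
        have := hY _ hw
        change D.nilXi l lam _ ∈ N at this
        rwa [nilXi_v hl hln hlam, alphaCoeff_zero, zero_smul, zero_add, add_zero] at this
      | of_succ i hi ih =>
        have := hY _ ih
        change D.nilXi l lam _ ∈ N at this
        rw [nilXi_u hl hln hlam, Nat.add_sub_cancel] at this
        exact (N.smul_mem_iff
          (alphaCoeff_sigmaInv_ne_zero hl hlam (by omega) (by omega))).1 this
    refine eq_top_of_mem (fun i _ => hv i) fun i _ => ?_
    induction i with
    | zero => exact hu 0 (by omega)
    | succ i ih =>
      have := hX _ (ih (by omega))
      change D.nilX _ ∈ N at this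
      rwa [nilX_u] at this
  · refine ⟨D.u (D.n - l), ?_, hu0, u_ne_zero (by omega)⟩
    have := u_mem_weightSpace_of_nil hD hl hln hlam hb (D.n - l)
    rwa [Nat.cast_sub hln.le, show (D.n : ℤ) - l - D.n + l = 0 by ring] at this
  · intro M _ _ E' m hm
    exact exists_intertwines_of_nil hD hl hln hlam hb hm
  -- With e = 0 and c = 0 the vector z itself works, as ξz = 0.
  · intro M _ _ E' z hz hYz
    refine ⟨z, mem_genSpace.2 ⟨hz, ?_⟩, fun N _ h => h⟩
    simp [hYz]
  · refine ⟨0, D.n - l, by omega, by omega, ?_, ?_, fun j hj h0 h1 => ?_⟩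
    · rw [descCoeff_zero_eq hl hln hlam, alphaCoeff_zero, neg_zero]
    · rw [descCoeff_zero_eq hl hln hlam, alphaCoeff_n_sub_l hl hln hlam, neg_zero]
    · rw [descCoeff_zero_eq hl hln hlam, neg_ne_zero]
      exact alphaCoeff_sigmaInv_ne hl hln hlam hj h0 h1

theorem topCoeff_eq (hl : 1 ≤ l) (hln : l < D.n) (hlam : lam ∈ D.I l) :
    D.topCoeff l lam = D.alphaCoeff (l - 1) lam := by
  rw [topCoeff, ← alphaCoeff_sub_n_sub_l hl hln hlam (by omega),
    show D.n - 1 - (D.n - l) = l - 1 by omega]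

theorem X_pow_mem_weightSpace_of_singular {M : Type*} [AddCommGroup M] [Module k M]
    {E : D.DoubleData (Module.End k M)} (hb : ∀ γ : G →* kˣ, lam (1, γ) = γ b) {z : M}
    (hz : z ∈ weightSpace E lam b 0) (hY : E.Y z = 0) :
    (∀ j, E.Y ((E.X ^ j) z) = D.alphaCoeff j lam • (E.X ^ (j - 1)) z) ∧
      ∀ j < D.n, (E.X ^ j) z ∈ weightSpace E lam b j := by
  have h1 : ∀ j, E.Y ((E.X ^ j) z) = D.alphaCoeff j lam • (E.X ^ (j - 1)) z := by
    intro j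
    rw [Y_X_pow_apply hb hz, hY, map_zero, zero_add, phi_zpow_zero_mul]
  have h2 : ∀ j, (E.Y ^ (j + 1)) ((E.X ^ j) z) = 0 := by
    intro j
    induction j with
    | zero => simpa using hY
    | succ j ih => rw [pow_succ, Module.End.mul_apply, h1, map_smul, Nat.add_sub_cancel, ih,
        smul_zero]
  refine ⟨h1, fun j => ?_⟩
  induction j with
  | zero => intro _; simpa using hz
  | succ j ih =>
    intro hj
    have h3 : (E.Y ^ (D.n - 1)) ((E.X ^ j) z) = 0 := by
      rw [show D.n - 1 = (D.n - 1 - (j + 1)) + (j + 1) by omega, pow_add,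
        Module.End.mul_apply, h2, map_zero]
    have := X_mem_weightSpace (ih (by omega)) (Or.inr h3)
    rwa [← Module.End.mul_apply, ← pow_succ', ← Nat.cast_succ] at this

/-- Here w = v_{n-1} and w' = u_{l-1}. From v_{n-1}, ξ reaches every v_i; x v_{n-1} yields u_l, from
which ξ descends to u_0 and x climbs to u_{n-1}. The singular vector is u_0. -/
theorem isUniversal_of_nonnil (hD : ¬ D.IsNilpotent) (hα : D.α = 1) (hl : 1 ≤ l) (hln : l < D.n)
    (hlam : lam ∈ D.I l) (hb : ∀ γ : G →* kˣ, lam (1, γ) = γ b) :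
    IsUniversal (nonnilData hD hα hl hln hlam hb) lam b ((l : ℤ) - 1) (D.topCoeff l lam)
      (D.v (D.n - 1)) (D.u (l - 1)) := by
  have hT : ((nonnilData hD hα hl hln hlam hb).X * (nonnilData hD hα hl hln hlam hb).Y)
      (D.v (D.n - 1)) - D.topCoeff l lam • D.v (D.n - 1) = D.u (l - 1) := by
    change D.nonnilX l lam (D.nonnilXi (D.v (D.n - 1))) - _ = _
    rw [nonnilXi_v (by omega), if_neg (by omega), nonnilX_v hl hln hlam (by omega),
      show D.n - 1 - 1 + 1 = D.n - 1 by omega, if_pos (by omega), topCoeff, add_sub_cancel_left,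
      show D.n - 1 - (D.n - l) = l - 1 by omega]
  have hu0 : ((nonnilData hD hα hl hln hlam hb).X * (nonnilData hD hα hl hln hlam hb).Y)
      (D.u (l - 1)) = D.topCoeff l lam • D.u (l - 1) := by
    change D.nonnilX l lam (D.nonnilXi (D.u (l - 1))) = _
    rw [nonnilXi_u (by omega), topCoeff_eq hl hln hlam]
    split_ifs with h
    · rw [h, alphaCoeff_zero, zero_smul, map_zero]
    · rw [nonnilX_u hl hln hlam (by omega), show l - 1 - 1 + 1 = l - 1 by omega]
  constructor
  · refine mem_genSpace.2 ⟨?_, ?_⟩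
    · have := v_mem_weightSpace_of_nonnil hD hα hl hln hlam hb (D.n - 1)
      rwa [show ((D.n - 1 : ℕ) : ℤ) - D.n + l = l - 1 by omega] at this
    · rw [hT, hu0]
  · exact hT
  · intro p hp
    have hp' := hp.1 D.a
    rw [nonnilData_K] at hp'
    refine mem_span_of_gradedK (by omega) (by omega) (fun i hi h => ?_) (fun i hi h => ?_) hp'
    · refine eq_of_dvd_sub hi (by omega) ?_
      rwa [show (i : ℤ) - D.n + l - (l - 1) = i - ((D.n - 1 : ℕ) : ℤ) by omega] at h
    · refine eq_of_dvd_sub hi (by omega) ?_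
      rwa [show (i : ℤ) - (l - 1) = i - ((l - 1 : ℕ) : ℤ) by omega] at h
  · intro N hX hY hw
    have hv : ∀ i ≤ D.n - 1, D.v i ∈ N := by
      intro i hi
      induction hi using Nat.decreasingInduction with
      | self => exact hw
      | of_succ i hi ih =>
        have := hY _ ih
        change D.nonnilXi _ ∈ N at this
        rwa [nonnilXi_v (by omega), if_neg (by omega), Nat.add_sub_cancel] at this
    have hul : D.u l ∈ N := by
      have := hX _ hw
      change D.nonnilX l lam _ ∈ N at this
      rw [nonnilX_v_last hl hln (by omega)] at this
      exact (N.add_mem_iff_right (N.smul_mem _ (hv 0 (by omega)))).1 this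
    have hu : ∀ i ≤ l, D.u i ∈ N := by
      intro i hi
      induction hi using Nat.decreasingInduction with
      | self => exact hul
      | of_succ i hi ih =>
        have := hY _ ih
        change D.nonnilXi _ ∈ N at this
        rwa [nonnilXi_u (by omega), if_neg (by omega), Nat.add_sub_cancel] at this
    have hu' : ∀ i, l ≤ i → i < D.n → D.u i ∈ N := by
      intro i hi
      induction i, hi using Nat.le_induction with
      | base => exact fun _ => hul
      | succ i hi ih =>
        intro hi'
        have := hX _ (ih (by omega))
        change D.nonnilX l lam _ ∈ N at this
        rw [nonnilX_u hl hln hlam hi', ← alphaCoeff_sub_l hl hln hlam (by omega),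
          alphaCoeff_sigma_eq hl hln hlam] at this
        exact (N.smul_mem_iff
          (alphaCoeff_sigmaInv_ne_zero hl hlam (by omega) (by omega))).1 this
    exact eq_top_of_mem (fun i _ => hv i (by omega)) fun i hi =>
      (le_total i l).elim (hu i) fun h => hu' i h hi
  · refine ⟨D.u 0, u_mem_weightSpace_of_nonnil hD hα hl hln hlam hb 0, ?_, u_ne_zero (by omega)⟩
    change D.nonnilXi _ = _
    rw [nonnilXi_u (by omega), if_pos rfl]
  · intro M _ _ E' m hm
    exact exists_intertwines_of_nonnil hD hα hl hln hlam hb hm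
  · intro M _ _ E' z hz hYz
    obtain ⟨h1, h2⟩ := X_pow_mem_weightSpace_of_singular hb hz hYz
    have h3 := h2 (l - 1) (by omega)
    rw [Nat.cast_sub hl, Nat.cast_one] at h3
    -- The vector xˡ⁻¹ z has weight λφˡ⁻¹ and is an eigenvector of xξ; ξ leads back from it to z
    -- through the nonzero α_j(λ), 0 < j < l.
    refine ⟨(E'.X ^ (l - 1)) z, mem_genSpace.2 ⟨h3, ?_⟩, fun N hY hm => ?_⟩
    · have h4 : (E'.X * E'.Y) ((E'.X ^ (l - 1)) z) = D.topCoeff l lam • (E'.X ^ (l - 1)) z := by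
        rw [Module.End.mul_apply, h1, topCoeff_eq hl hln hlam, map_smul, ← Module.End.mul_apply,
          ← pow_succ']
        rcases Nat.eq_zero_or_pos (l - 1) with h | h
        · rw [h, alphaCoeff_zero, zero_smul, zero_smul]
        · rw [Nat.sub_add_cancel h]
      rw [h4, sub_self, map_zero, smul_zero]
    · have : ∀ j ≤ l - 1, (E'.X ^ j) z ∈ N := by
        intro j hj
        induction hj using Nat.decreasingInduction with
        | self => exact hm
        | of_succ j hj ih =>
          have := hY _ ih
          rw [h1, Nat.add_sub_cancel] at this
          exact (N.smul_mem_iff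
            (alphaCoeff_lam_ne_zero hl hln hlam (by omega) (by omega))).1 this
      simpa using this 0 (by omega)
  · exact ⟨l - 1, D.n - 1, by omega, by omega, descCoeff_sub_one_eq hl hln hlam,
      descCoeff_last_eq hl hln hlam, fun j hj h0 h1 => descCoeff_ne_topCoeff hl hln hlam hj h0 h1⟩

end Characterization

end GroupDatum

/-! ### Projective covers -/

/-- Because f is onto, the range of h together with ker π spans Q. -/
theorem LinearMap.surjective_of_superfluous {A : Type*} [Ring A] {P Q M : Type*}
    [AddCommGroup P] [Module A P] [AddCommGroup Q] [Module A Q] [AddCommGroup M] [Module A M]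
    {f : P →ₗ[A] M} {π : Q →ₗ[A] M} (h : P →ₗ[A] Q) (hh : π ∘ₗ h = f)
    (hf : Function.Surjective f) (hπ : ∀ N : Submodule A Q, N ⊔ LinearMap.ker π = ⊤ → N = ⊤) :
    Function.Surjective h := by
  rw [← LinearMap.range_eq_top]
  refine hπ _ (eq_top_iff.2 fun q _ => ?_)
  obtain ⟨p, hp⟩ := hf (π q)
  rw [← hh, LinearMap.comp_apply] at hp
  refine Submodule.mem_sup.2 ⟨h p, ⟨p, rfl⟩, q - h p, ?_, add_sub_cancel _ _⟩
  rw [LinearMap.mem_ker, map_sub, hp, sub_self]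

/-- A lift h of f through π is surjective, so it splits as Q is projective. The section again lies
over M, hence is surjective too, and this makes h injective. -/
theorem IsProjectiveCover.nonempty_linearEquiv {A : Type*} [Ring A] {P Q M : Type*}
    [AddCommGroup P] [Module A P] [AddCommGroup Q] [Module A Q] [AddCommGroup M] [Module A M]
    {f : P →ₗ[A] M} {π : Q →ₗ[A] M} (hf : IsProjectiveCover f) (hπ : IsProjectiveCover π) :
    Nonempty (P ≃ₗ[A] Q) := by
  have := hf.projective
  have := hπ.projective
  obtain ⟨h, hh⟩ := Module.projective_lifting_property π f hπ.surjective
  have h1 := LinearMap.surjective_of_superfluous h hh hf.surjective hπ.superfluous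
  obtain ⟨s, hs⟩ := Module.projective_lifting_property h LinearMap.id h1
  have h2 : Function.Surjective s := by
    refine LinearMap.surjective_of_superfluous s ?_ hπ.surjective hf.superfluous
    rw [← hh, LinearMap.comp_assoc, hs, LinearMap.comp_id]
  refine ⟨LinearEquiv.ofBijective h ⟨fun p p' hp => ?_, h1⟩⟩
  obtain ⟨q, rfl⟩ := h2 p
  obtain ⟨q', rfl⟩ := h2 p'
  have e := LinearMap.congr_fun hs
  simp only [LinearMap.comp_apply, LinearMap.id_apply] at e
  rw [e, e] at hp
  rw [hp]

namespace GroupDatum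

section Modules

universe u₁ u₂

variable {k : Type u₁} {G : Type u₂} [Field k] [CommGroup G] [Finite G] {D : GroupDatum k G}

theorem dChar_one : D.dChar 1 = 1 := by
  rw [dChar_eq]
  exact map_one D.dFun

theorem dGrp_one : D.dGrp 1 = 1 := D.dGrp_satisfies.one

/-- The action of the generators on a `D(H_D)`-module. -/
noncomputable def moduleData (hn : 1 < D.n) (M : Type*) [AddCommGroup M] [Module k M]
    [Module D.Double M] [IsScalarTower k D.Double M] : D.DoubleData (Module.End k M) :=
  (D.univData hn).map (Algebra.lsmul k k M)

section ModuleData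

variable {hn : 1 < D.n} {M : Type*} [AddCommGroup M] [Module k M] [Module D.Double M]
  [IsScalarTower k D.Double M]

theorem moduleData_K (g : G) (m : M) : (moduleData hn M).K g m = D.dGrp g • m := rfl

theorem moduleData_C (f : G → k) (m : M) : (moduleData hn M).C f m = D.dFun f • m := rfl

/-- A map that commutes with the generators is `D(H_D)`-linear. -/
theorem Intertwines.map_toHom {V : Type*} [AddCommGroup V] [Module k V]
    {E : D.DoubleData (Module.End k V)} {F : V →ₗ[k] M}
    (hF : Intertwines E (moduleData hn M) F) (d : D.Double) (p : V) :
    F (E.toHom d p) = d • F p := by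
  let S : Subalgebra k D.Double :=
    { carrier := {d | ∀ p, F (E.toHom d p) = d • F p}
      mul_mem' := fun {d d'} h h' p => by
        rw [map_mul, Module.End.mul_apply, h, h', mul_smul]
      add_mem' := fun {d d'} h h' p => by
        rw [map_add, LinearMap.add_apply, map_add, h, h', add_smul]
      algebraMap_mem' := fun r p => by
        rw [AlgHom.commutes, Module.algebraMap_end_apply, map_smul, algebraMap_smul] }
  have h : S = ⊤ := by
    refine subalgebra_eq_top D (fun g p => ?_) (fun p => ?_) (fun p => ?_) (fun f p => ?_)
    · rw [DoubleData.toHom_dGrp]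
      exact LinearMap.congr_fun (hF.K g) p
    · rw [DoubleData.toHom_dX]
      exact LinearMap.congr_fun hF.X p
    · rw [DoubleData.toHom_dXi _ hn]
      exact LinearMap.congr_fun hF.Y p
    · rw [DoubleData.toHom_dFun]
      exact LinearMap.congr_fun (hF.C f) p
  have : d ∈ S := h ▸ Algebra.mem_top
  exact this p

/-- The `D(H_D)`-linear map given by a map that commutes with the generators. -/
noncomputable def Intertwines.toLinearMap {V : Type*} [AddCommGroup V] [Module k V]
    {E : D.DoubleData (Module.End k V)} {F : V →ₗ[k] M}
    (hF : Intertwines E (moduleData hn M) F) : RepModule E.toHom →ₗ[D.Double] M where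
  toFun := F
  map_add' := F.map_add
  map_smul' d p := hF.map_toHom d p

theorem Intertwines.toLinearMap_apply {V : Type*} [AddCommGroup V] [Module k V]
    {E : D.DoubleData (Module.End k V)} {F : V →ₗ[k] M}
    (hF : Intertwines E (moduleData hn M) F) (p : V) : hF.toLinearMap p = F p := rfl

end ModuleData

/-! ### Projection onto a weight space by an element of D(H_D) -/

section WeightProjection

variable [Fintype G] [DecidableEq G] [CharZero k]

variable (D) in
/-- The projection onto the vectors of weight `λ φᵉ`. -/
noncomputable def weightProj (lam : Weight k G) (b : G) (e : ℤ) : D.Double :=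
  (Fintype.card G : k)⁻¹ • ∑ g, D.wtGrp lam e g⁻¹ • (D.dGrp g * D.dFun (Pi.single (b * D.a ^ e) 1))

variable {lam : Weight k G} {b : G} {e : ℤ}

theorem dGrp_mul_weightProj (g : G) :
    D.dGrp g * D.weightProj lam b e = D.wtGrp lam e g • D.weightProj lam b e := by
  rw [weightProj, mul_smul_comm, smul_comm]
  congr 1
  rw [Finset.mul_sum, Finset.smul_sum, ← Equiv.sum_comp (Equiv.mulLeft g⁻¹)]
  refine Finset.sum_congr rfl fun h _ => ?_
  rw [Equiv.coe_mulLeft, mul_smul_comm, ← mul_assoc, ← D.dGrp_satisfies.mul, mul_inv_cancel_left,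
    mul_inv_rev, inv_inv, wtGrp_mul, smul_smul, mul_comm (D.wtGrp lam e h⁻¹)]

theorem dFun_mul_weightProj (f : G → k) :
    D.dFun f * D.weightProj lam b e = f (b * D.a ^ e) • D.weightProj lam b e := by
  have h1 : f * Pi.single (b * D.a ^ e) 1 = f (b * D.a ^ e) • Pi.single (b * D.a ^ e) (1 : k) := by
    ext h
    by_cases hh : h = b * D.a ^ e
    · subst hh
      simp
    · simp [Pi.single_eq_of_ne hh]
  rw [weightProj, mul_smul_comm, smul_comm]
  congr 1
  rw [Finset.mul_sum, Finset.smul_sum]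
  refine Finset.sum_congr rfl fun h _ => ?_
  rw [mul_smul_comm, ← mul_assoc, ← dGrp_mul_dFun, mul_assoc, ← map_mul, h1, map_smul,
    mul_smul_comm, smul_comm]

theorem weightProj_smul_mem {hn : 1 < D.n} {M : Type*} [AddCommGroup M] [Module k M]
    [Module D.Double M] [IsScalarTower k D.Double M] (m : M) :
    D.weightProj lam b e • m ∈ weightSpace (moduleData hn M) lam b e := by
  constructor
  · intro g
    rw [moduleData_K, smul_smul, dGrp_mul_weightProj, smul_assoc]
  · intro f
    rw [moduleData_C, smul_smul, dFun_mul_weightProj, smul_assoc]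

theorem toHom_weightProj_apply {V : Type*} [AddCommGroup V] [Module k V]
    {E : D.DoubleData (Module.End k V)} {p : V} (hp : p ∈ weightSpace E lam b e) :
    E.toHom (D.weightProj lam b e) p = p := by
  have h1 : ∀ g : G, E.toHom (D.wtGrp lam e g⁻¹ •
      (D.dGrp g * D.dFun (Pi.single (b * D.a ^ e) 1))) p = p := by
    intro g
    rw [map_smul, map_mul, DoubleData.toHom_dGrp, DoubleData.toHom_dFun, LinearMap.smul_apply,
      Module.End.mul_apply, hp.2, Pi.single_eq_same, one_smul, hp.1, smul_smul, ← wtGrp_mul,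
      inv_mul_cancel, wtGrp_one, one_smul]
  rw [weightProj, map_smul, map_sum, LinearMap.smul_apply, LinearMap.sum_apply,
    Finset.sum_congr rfl fun g _ => h1 g, Finset.sum_const, Finset.card_univ,
    ← Nat.cast_smul_eq_nsmul k, smul_smul,
    inv_mul_cancel₀ (Nat.cast_ne_zero.2 Fintype.card_ne_zero), one_smul]

theorem toHom_weightProj_mem {V : Type*} [AddCommGroup V] [Module k V]
    (E : D.DoubleData (Module.End k V)) (p : V) :
    E.toHom (D.weightProj lam b e) p ∈ weightSpace E lam b e := by
  constructor
  · intro g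
    rw [← E.toHom_dGrp, ← Module.End.mul_apply, ← map_mul, dGrp_mul_weightProj, map_smul,
      LinearMap.smul_apply]
  · intro f
    rw [← E.toHom_dFun, ← Module.End.mul_apply, ← map_mul, dFun_mul_weightProj, map_smul,
      LinearMap.smul_apply]

end WeightProjection

theorem aeval_XY_mem_weightSpace {M : Type*} [AddCommGroup M] [Module k M]
    {E : D.DoubleData (Module.End k M)} {lam : Weight k G} {b : G} {e : ℤ} (hn : 1 < D.n)
    (f : Polynomial k) {m : M} (hm : m ∈ weightSpace E lam b e) :
    Polynomial.aeval (E.X * E.Y) f m ∈ weightSpace E lam b e := by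
  induction f using Polynomial.induction_on' generalizing m with
  | add p q hp hq =>
    rw [map_add, LinearMap.add_apply]
    exact Submodule.add_mem _ (hp hm) (hq hm)
  | monomial i r =>
    rw [Polynomial.aeval_monomial, Module.End.mul_apply, Module.algebraMap_end_apply]
    refine Submodule.smul_mem _ _ ?_
    induction i with
    | zero => simpa using hm
    | succ i ih =>
      rw [pow_succ', Module.End.mul_apply]
      exact XY_mem_weightSpace hn ih

namespace IsUniversal

variable {E : D.DoubleData (Module.End k D.PSpace)} {lam : Weight k G} {b : G} {e : ℤ} {c : k}
  {w w' : D.PSpace}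

theorem exists_toHom_apply_eq (hE : IsUniversal E lam b e c w w') (hn : 1 < D.n) (p : D.PSpace) :
    ∃ d, E.toHom d w = p := by
  have h := hE.generates (LinearMap.range (LinearMap.applyₗ w ∘ₗ E.toHom.toLinearMap)) ?_ ?_ ?_
  · have : p ∈ LinearMap.range (LinearMap.applyₗ w ∘ₗ E.toHom.toLinearMap) := h ▸ trivial
    exact this
  · rintro _ ⟨d, rfl⟩
    exact ⟨D.dX * d, by simp [E.toHom_dX]⟩
  · rintro _ ⟨d, rfl⟩
    exact ⟨D.dXi * d, by simp [E.toHom_dXi hn]⟩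
  · exact ⟨1, by simp⟩

theorem eq_top_of_mem (hE : IsUniversal E lam b e c w w') (hn : 1 < D.n)
    {N : Submodule D.Double (RepModule E.toHom)}
    (hw : (show RepModule E.toHom from w) ∈ N) : N = ⊤ := by
  refine eq_top_iff.2 fun p _ => ?_
  obtain ⟨d, hd⟩ := hE.exists_toHom_apply_eq hn p
  rw [← hd]
  exact N.smul_mem d hw

/-- With ε the weight projection and f the polynomial from `exists_projection`, the element f(xξ) ε
of D(H_D) lies in `genSpace` and so is the image of w under a homomorphism. Following it by d ↦ d w
gives the identity, since f(xξ) ε w = w; P(l, λ) is a direct summand of D(H_D). -/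
theorem projective [CharZero k] (hE : IsUniversal E lam b e c w w') (hn : 1 < D.n)
    (hb : ∀ γ : G →* kˣ, lam (1, γ) = γ b) : Module.Projective D.Double (RepModule E.toHom) := by
  classical
  have := Fintype.ofFinite G
  obtain ⟨j₀, j₁, hj, hj₁, h₀, h₁, hc⟩ := hE.exists_descCoeff
  obtain ⟨f, g, hfg, hdvd⟩ := exists_projection hj hj₁ h₀ h₁ hc
  set E' := moduleData hn D.Double with hE'
  have hε : D.weightProj lam b e ∈ weightSpace E' lam b e := by
    simpa using weightProj_smul_mem (hn := hn) (lam := lam) (b := b) (e := e) (1 : D.Double)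
  have hm : Polynomial.aeval (E'.X * E'.Y) f (D.weightProj lam b e) ∈ genSpace E' lam b e c := by
    refine Submodule.mem_inf.2 ⟨aeval_XY_mem_weightSpace hn f hε, ?_⟩
    obtain ⟨q, hq⟩ := hdvd
    have h1 : (E'.X * E'.Y - c • 1) ^ 2 =
        Polynomial.aeval (E'.X * E'.Y) ((Polynomial.X - Polynomial.C c) ^ 2) := by
      rw [map_pow, map_sub, Polynomial.aeval_X, Polynomial.aeval_C, Algebra.algebraMap_eq_smul_one]
    rw [LinearMap.mem_ker, h1, ← Module.End.mul_apply, ← map_mul, hq, mul_comm, map_mul,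
      Module.End.mul_apply, aeval_prod_eq_zero hb hn hε, map_zero]
  obtain ⟨F, hF, hI⟩ := hE.exists_intertwines E' _ hm
  refine Module.Projective.of_split hI.toLinearMap
    (LinearMap.toSpanSingleton D.Double (RepModule E.toHom) w) ?_
  have hT : E'.X * E'.Y = Algebra.lsmul k k D.Double (D.dX * D.dXi) := (map_mul _ _ _).symm
  have hf : ∀ d : D.Double, E.toHom (Polynomial.aeval (E'.X * E'.Y) f d) =
      Polynomial.aeval (E.X * E.Y) f * E.toHom d := by
    intro d
    rw [hT, Polynomial.aeval_algHom_apply]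
    change E.toHom (Polynomial.aeval (D.dX * D.dXi) f * d) = _
    rw [map_mul, ← Polynomial.aeval_algHom_apply, map_mul, E.toHom_dX, E.toHom_dXi hn]
  -- The weight projection fixes w, and f = 1 - g (X - c)² acts as 1 because (xξ - c)² w = 0.
  have hw : E.toHom (Polynomial.aeval (E'.X * E'.Y) f (D.weightProj lam b e)) w = w := by
    rw [hf, Module.End.mul_apply, toHom_weightProj_apply (mem_genSpace.1 hE.mem).1]
    have h1 := LinearMap.congr_fun (congrArg (Polynomial.aeval (E.X * E.Y)) hfg) w
    have h2 := (Submodule.mem_inf.1 hE.mem).2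
    rw [map_add, map_mul, LinearMap.add_apply, Module.End.mul_apply, map_pow, map_sub,
      Polynomial.aeval_X, Polynomial.aeval_C, Algebra.algebraMap_eq_smul_one,
      LinearMap.mem_ker.1 h2, map_zero, add_zero, map_one, Module.End.one_apply] at h1
    exact h1
  ext p
  obtain ⟨d, hd⟩ := hE.exists_toHom_apply_eq hn p
  have hp : p = d • (show RepModule E.toHom from w) := hd.symm
  rw [hp, map_smul, map_smul]
  congr 1
  rw [LinearMap.comp_apply, hI.toLinearMap_apply, hF]
  exact hw

end IsUniversal

end Modules

end GroupDatum

/-! ### The projective cover of `L(λ)` -/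

/-- A submodule of `RepModule Φ`, as a subspace. -/
def Submodule.ofRepModule {k A V : Type*} [Field k] [Ring A] [Algebra k A] [AddCommGroup V]
    [Module k V] {Φ : A →ₐ[k] Module.End k V} (N : Submodule A (RepModule Φ)) :
    Submodule k V where
  carrier := N.carrier
  add_mem' h h' := N.add_mem' h h'
  zero_mem' := N.zero_mem'
  smul_mem' r p h := by
    have h1 : Φ (algebraMap k A r) p ∈ N.carrier := N.smul_mem' (algebraMap k A r) h
    rwa [AlgHom.commutes] at h1

theorem Submodule.apply_mem_ofRepModule {k A V : Type*} [Field k] [Ring A] [Algebra k A]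
    [AddCommGroup V] [Module k V] {Φ : A →ₐ[k] Module.End k V} {N : Submodule A (RepModule Φ)}
    (d : A) {p : V} (h : p ∈ N.ofRepModule) : Φ d p ∈ N.ofRepModule :=
  N.smul_mem' d h

namespace GroupDatum

section Cover

universe u₁ u₂

variable {k : Type u₁} {G : Type u₂} [Field k] [CommGroup G] [Finite G] {D : GroupDatum k G}
  {lam : Weight k G} {b : G}

/-- The generator of `Z(λ)`. -/
noncomputable def vermaGen (D : GroupDatum k G) (lam : Weight k G) : D.Z lam :=
  Submodule.Quotient.mk 1

theorem smul_vermaGen (d : D.Double) :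
    d • vermaGen D lam = (Submodule.Quotient.mk d : D.Z lam) := by
  rw [vermaGen, ← Submodule.Quotient.mk_smul, smul_eq_mul, mul_one]

theorem dXi_smul_vermaGen : D.dXi • vermaGen D lam = 0 := by
  rw [smul_vermaGen, Submodule.Quotient.mk_eq_zero]
  exact Submodule.subset_span (Or.inr rfl)

theorem dGrp_mul_dChar_smul_vermaGen (g : G) (γ : G →* kˣ) :
    (D.dGrp g * D.dChar γ) • vermaGen D lam = (lam (g, γ) : k) • vermaGen D lam := by
  rw [smul_vermaGen, ← algebraMap_smul D.Double (lam (g, γ) : k) (vermaGen D lam), smul_vermaGen,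
    Submodule.Quotient.eq]
  exact Submodule.subset_span (Or.inl ⟨g, γ, rfl⟩)

/-- The defining relations of Z(λ) concern characters only. As characters span the functions on G,
every function acts on the generator by its value at b. -/
theorem vermaGen_mem_weightSpace [IsAlgClosed k] [CharZero k] {hn : 1 < D.n}
    (hb : ∀ γ : G →* kˣ, lam (1, γ) = γ b) :
    vermaGen D lam ∈ weightSpace (moduleData hn (D.Z lam)) lam b 0 := by
  constructor
  · intro g
    have h := dGrp_mul_dChar_smul_vermaGen (D := D) (lam := lam) g 1
    rw [dChar_one, mul_one] at h
    rw [moduleData_K, h, wtGrp, neg_zero, zpow_zero, mul_one]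
  · intro f
    have h : (LinearMap.applyₗ (vermaGen D lam)) ∘ₗ (moduleData hn (D.Z lam)).C.toLinearMap =
        LinearMap.toSpanSingleton k (D.Z lam) (vermaGen D lam) ∘ₗ
          LinearMap.proj (b * D.a ^ (0 : ℤ)) := by
      refine linearMap_ext_of_characters fun γ => ?_
      have h := dGrp_mul_dChar_smul_vermaGen (D := D) (lam := lam) 1 γ
      rw [dGrp_one, one_mul, dChar_eq, hb] at h
      change D.dFun _ • vermaGen D lam = (γ (b * D.a ^ (0 : ℤ)) : k) • vermaGen D lam
      rw [zpow_zero, mul_one, h]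
    exact LinearMap.congr_fun h f

namespace IsUniversal

variable {E : D.DoubleData (Module.End k D.PSpace)} {e : ℤ} {c : k} {w w' : D.PSpace}

/-- A nonzero singular vector of weight λ in P(l, λ) is annihilated by the ideal defining Z(λ), so
this ideal is proper. -/
theorem nontrivial_Z (hE : IsUniversal E lam b e c w w') (hn : 1 < D.n)
    (hb : ∀ γ : G →* kˣ, lam (1, γ) = γ b) : Nontrivial (D.Z lam) := by
  obtain ⟨s, hs, hYs, hs0⟩ := hE.exists_singular
  have h : D.vermaIdeal lam ≤
      LinearMap.ker (LinearMap.toSpanSingleton D.Double (RepModule E.toHom) s) := by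
    refine Submodule.span_le.2 ?_
    rintro _ (⟨g, γ, rfl⟩ | rfl)
    · change E.toHom (D.dGrp g * D.dChar γ - algebraMap k D.Double (lam (g, γ))) s = 0
      rw [map_sub, map_mul, E.toHom_dGrp, dChar_eq, E.toHom_dFun, AlgHom.commutes,
        LinearMap.sub_apply, Module.End.mul_apply, hs.2, map_smul, hs.1,
        Module.algebraMap_end_apply, smul_smul, ← sub_smul, zpow_zero, mul_one, wtGrp, neg_zero,
        zpow_zero, mul_one, ← hb, weight_apply lam g γ, Units.val_mul, mul_comm, sub_self, zero_smul]
    · change E.toHom D.dXi s = 0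
      rw [E.toHom_dXi hn, hYs]
  rw [Submodule.Quotient.nontrivial_iff]
  intro htop
  have h1 : (1 : D.Double) ∈ D.vermaIdeal lam := htop ▸ trivial
  have h2 : E.toHom 1 s = 0 := h h1
  rw [map_one] at h2
  exact hs0 h2

theorem nontrivial_L (hE : IsUniversal E lam b e c w w') (hn : 1 < D.n)
    (hb : ∀ γ : G →* kˣ, lam (1, γ) = γ b) : Nontrivial (D.L lam) := by
  have := hE.nontrivial_Z hn hb
  exact Submodule.Quotient.nontrivial_iff.2 (Module.jacobson_lt_top D.Double (D.Z lam)).ne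

/-- The generator of Z(λ) is recovered by powers of ξ from a vector in `genSpace`, and w can be
mapped to that vector. -/
theorem exists_surjective [IsAlgClosed k] [CharZero k] (hE : IsUniversal E lam b e c w w')
    (hn : 1 < D.n) (hb : ∀ γ : G →* kˣ, lam (1, γ) = γ b) :
    ∃ f : RepModule E.toHom →ₗ[D.Double] D.Z lam, Function.Surjective f := by
  obtain ⟨m, hm, hmz⟩ := hE.exists_mem_genSpace (moduleData hn (D.Z lam)) _
    (vermaGen_mem_weightSpace hb) dXi_smul_vermaGen
  obtain ⟨F, hF, hI⟩ := hE.exists_intertwines (moduleData hn (D.Z lam)) m hm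
  refine ⟨hI.toLinearMap, LinearMap.range_eq_top.1 (eq_top_iff.2 fun z _ => ?_)⟩
  have h := hmz ((LinearMap.range hI.toLinearMap).restrictScalars k)
    (fun p hp => (LinearMap.range hI.toLinearMap).smul_mem D.dXi hp) ⟨w, hF⟩
  obtain ⟨d, rfl⟩ := Submodule.Quotient.mk_surjective _ z
  rw [← smul_vermaGen]
  exact Submodule.smul_mem _ d h

theorem sub_apply_eq_zero (hE : IsUniversal E lam b e c w w') :
    (E.X * E.Y) w' = c • w' := by
  rw [← hE.sub_eq]
  exact (mem_genSpace.1 hE.mem).2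

/-- Applying xξ - c to s w + s' w' gives s w', so N contains w', then w, which generates. -/
theorem eq_top_of_add_mem (hE : IsUniversal E lam b e c w w') (hn : 1 < D.n)
    {N : Submodule D.Double (RepModule E.toHom)} {s s' : k} (hs : s ≠ 0)
    (h : s • w + s' • w' ∈ N.ofRepModule) : N = ⊤ := by
  have h1 := N.ofRepModule.sub_mem (Submodule.apply_mem_ofRepModule (D.dX * D.dXi) h)
    (N.ofRepModule.smul_mem c h)
  have e1 : E.toHom (D.dX * D.dXi) (s • w + s' • w') - c • (s • w + s' • w') = s • w' := by
    rw [map_mul, E.toHom_dX, E.toHom_dXi hn, map_add, map_smul, map_smul, hE.sub_apply_eq_zero,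
      ← hE.sub_eq]
    module
  rw [e1, Submodule.smul_mem_iff _ hs] at h1
  have h2 := (N.ofRepModule.add_mem_iff_left (N.ofRepModule.smul_mem s' h1)).1 h
  rw [Submodule.smul_mem_iff _ hs] at h2
  exact hE.eq_top_of_mem hn h2

/-- Write w = p + q with p ∈ N and q ∈ ker f, and project to weight λφᵉ. One of the projections has
a nonzero w-coefficient, so N or ker f is everything; the latter is impossible since f is onto a
nonzero module. -/
theorem eq_top_of_sup_ker_eq_top [CharZero k] (hE : IsUniversal E lam b e c w w')
    (hn : 1 < D.n) {M : Type*} [AddCommGroup M] [Module D.Double M] [Nontrivial M]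
    {f : RepModule E.toHom →ₗ[D.Double] M} (hf : Function.Surjective f)
    (N : Submodule D.Double (RepModule E.toHom)) (hN : N ⊔ LinearMap.ker f = ⊤) : N = ⊤ := by
  classical
  have := Fintype.ofFinite G
  obtain ⟨p, q, hp, hq, hpq⟩ : ∃ p q : D.PSpace, p ∈ N.ofRepModule ∧
      q ∈ (LinearMap.ker f).ofRepModule ∧ p + q = w := by
    have hw : w ∈ (N ⊔ LinearMap.ker f).ofRepModule := by
      rw [hN]
      trivial
    obtain ⟨p, hp, q, hq, hpq⟩ :=
      (Submodule.mem_sup (p := N) (p' := LinearMap.ker f)).1 hw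
    exact ⟨p, q, hp, hq, hpq⟩
  have hp' := Submodule.apply_mem_ofRepModule (D.weightProj lam b e) hp
  have hq' := Submodule.apply_mem_ofRepModule (D.weightProj lam b e) hq
  have hsum := congrArg (E.toHom (D.weightProj lam b e)) hpq
  obtain ⟨r, r', hr⟩ := Submodule.mem_span_pair.1
    (hE.mem_span _ (toHom_weightProj_mem (lam := lam) (b := b) (e := e) E p))
  rw [map_add, toHom_weightProj_apply (mem_genSpace.1 hE.mem).1, ← hr] at hsum
  rw [← hr] at hp'
  by_cases hr0 : r = 0
  · exfalso
    rw [hr0, zero_smul, zero_add] at hsum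
    have e2 : E.toHom (D.weightProj lam b e) q = (1 : k) • w + -r' • w' := by
      rw [one_smul, neg_smul, ← sub_eq_add_neg, ← hsum, add_sub_cancel_left]
    rw [e2] at hq'
    have h4 := hE.eq_top_of_add_mem hn one_ne_zero hq'
    obtain ⟨m, hm⟩ := exists_ne (0 : M)
    obtain ⟨p, rfl⟩ := hf m
    have : p ∈ LinearMap.ker f := h4 ▸ trivial
    exact hm this
  · exact hE.eq_top_of_add_mem hn hr0 hp'

theorem exists_isProjectiveCover [IsAlgClosed k] [CharZero k]
    (hE : IsUniversal E lam b e c w w') (hn : 1 < D.n) (hb : ∀ γ : G →* kˣ, lam (1, γ) = γ b) :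
    ∃ f : RepModule E.toHom →ₗ[D.Double] D.L lam, IsProjectiveCover f := by
  have := hE.nontrivial_L hn hb
  obtain ⟨f, hf⟩ := hE.exists_surjective hn hb
  have hf' : Function.Surjective ((Module.jacobson D.Double (D.Z lam)).mkQ ∘ₗ f) :=
    (Submodule.mkQ_surjective _).comp hf
  exact ⟨_, hE.projective hn hb, hf', fun N hN => hE.eq_top_of_sup_ker_eq_top hn hf' N hN⟩

end IsUniversal

/-! ### Existence and uniqueness of the action -/

variable {l : ℕ}

/-- The prescribed action of all gγ determines the action of G and of Γ separately, hence of all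
functions on G, since characters span them. -/
theorem IsActionP.eq [IsAlgClosed k] [CharZero k] {Φ Φ' : D.Double →ₐ[k] Module.End k D.PSpace}
    (h : D.IsActionP l lam Φ) (h' : D.IsActionP l lam Φ') : Φ = Φ' := by
  have hgr : ∀ g γ, Φ (D.dGrp g * D.dChar γ) = Φ' (D.dGrp g * D.dChar γ) := fun g γ => by
    by_cases hD : D.IsNilpotent
    · rw [h.nil_grp hD, h'.nil_grp hD]
    · rw [h.nonnil_grp hD, h'.nonnil_grp hD]
  refine algHom_ext D (B := Module.End k D.PSpace) (fun g => ?_) ?_ ?_ fun f => ?_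
  · have := hgr g 1
    rwa [dChar_one, mul_one] at this
  · by_cases hD : D.IsNilpotent
    · rw [h.nil_x hD, h'.nil_x hD]
    · rw [h.nonnil_x hD, h'.nonnil_x hD]
  · by_cases hD : D.IsNilpotent
    · rw [h.nil_xi hD, h'.nil_xi hD]
    · rw [h.nonnil_xi hD, h'.nonnil_xi hD]
  · have h1 : Φ.toLinearMap ∘ₗ D.dFun.toLinearMap = Φ'.toLinearMap ∘ₗ D.dFun.toLinearMap := by
      apply linearMap_ext_of_characters (M := Module.End k D.PSpace)
      intro γ
      have := hgr 1 γ
      rwa [dGrp_one, one_mul, dChar_eq] at this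
    exact LinearMap.congr_fun h1 f

theorem isActionP_nilData (hD : D.IsNilpotent) (hl : 1 ≤ l) (hln : l < D.n) (hlam : lam ∈ D.I l)
    (hb : ∀ γ : G →* kˣ, lam (1, γ) = γ b) :
    D.IsActionP l lam (nilData hD hl hln hlam hb).toHom where
  nil_grp _ g γ := by
    rw [map_mul, DoubleData.toHom_dGrp, dChar_eq, DoubleData.toHom_dFun, nilData_K, nilData_C]
    apply pSpace_ext <;> intro i hi
    · rw [gradedK_mul_gradedC_v hb, nilGrp, basisOp_v _ _ hi, MonoidHom.mul_apply,
        MonoidHom.mul_apply, zpow_apply', zpow_natCast, MonoidHom.pow_apply]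
    · rw [gradedK_mul_gradedC_u hb, nilGrp, basisOp_u _ _ hi]
  nil_x _ := DoubleData.toHom_dX _
  nil_xi _ := DoubleData.toHom_dXi _ (by omega)
  nonnil_grp h := absurd hD h
  nonnil_x h := absurd hD h
  nonnil_xi h := absurd hD h

theorem isActionP_nonnilData (hD : ¬ D.IsNilpotent) (hα : D.α = 1) (hl : 1 ≤ l) (hln : l < D.n)
    (hlam : lam ∈ D.I l) (hb : ∀ γ : G →* kˣ, lam (1, γ) = γ b) :
    D.IsActionP l lam (nonnilData hD hα hl hln hlam hb).toHom where
  nil_grp h := absurd h hD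
  nil_x h := absurd h hD
  nil_xi h := absurd h hD
  nonnil_grp _ g γ := by
    rw [map_mul, DoubleData.toHom_dGrp, dChar_eq, DoubleData.toHom_dFun, nonnilData_K,
      nonnilData_C]
    apply pSpace_ext <;> intro i hi
    · rw [gradedK_mul_gradedC_v hb, nonnilGrp, basisOp_v _ _ hi]
    · rw [gradedK_mul_gradedC_u hb, nonnilGrp, basisOp_u _ _ hi, MonoidHom.mul_apply,
        MonoidHom.mul_apply, zpow_apply', zpow_natCast, MonoidHom.pow_apply]
  nonnil_x _ := DoubleData.toHom_dX _
  nonnil_xi _ := DoubleData.toHom_dXi _ (by omega)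

/-- Biduality of a finite abelian group: the restriction of λ to the dual group is evaluation at an
element of G. -/
theorem exists_eval_eq [IsAlgClosed k] [CharZero k] (lam : Weight k G) :
    ∃ b : G, ∀ γ : G →* kˣ, lam (1, γ) = γ b := by
  have : NeZero (Monoid.exponent G) := ⟨Monoid.exponent_ne_zero_of_finite⟩
  let ψ : (G →* kˣ) →* kˣ := lam.comp (MonoidHom.inr G (G →* kˣ))
  refine ⟨CommGroup.monoidHomMonoidHomEquiv G k ψ, fun γ => ?_⟩
  rw [CommGroup.apply_monoidHomMonoidHomEquiv]
  rfl

end Cover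

end GroupDatum

theorem proposition3p10 {k : Type*} [Field k] [IsAlgClosed k] [CharZero k] {G : Type*} [CommGroup G]
    [Finite G] (D : GroupDatum k G) (hα : ¬ D.IsNilpotent → D.α = 1) (l : ℕ) (hl : 1 ≤ l)
    (hln : l < D.n) (lam : GroupDatum.Weight k G) (hlam : lam ∈ D.I l) :
    ∃ Φ : D.Double →ₐ[k] Module.End k D.PSpace,
      D.IsActionP l lam Φ ∧
      (∀ Φ' : D.Double →ₐ[k] Module.End k D.PSpace, D.IsActionP l lam Φ' → Φ' = Φ) ∧
      (∃ f : RepModule Φ →ₗ[D.Double] D.L lam, IsProjectiveCover f) ∧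
      ∀ {Q : Type*} [AddCommGroup Q] [Module D.Double Q] (π : Q →ₗ[D.Double] D.L lam),
        IsProjectiveCover π → Nonempty (RepModule Φ ≃ₗ[D.Double] Q) := by
  obtain ⟨b, hb⟩ := GroupDatum.exists_eval_eq lam
  have hn : 1 < D.n := by omega
  obtain ⟨Φ, hΦ, f, hf⟩ : ∃ Φ : D.Double →ₐ[k] Module.End k D.PSpace, D.IsActionP l lam Φ ∧
      ∃ f : RepModule Φ →ₗ[D.Double] D.L lam, IsProjectiveCover f := by
    by_cases hD : D.IsNilpotent
    · exact ⟨_, GroupDatum.isActionP_nilData hD hl hln hlam hb,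
        (GroupDatum.isUniversal_of_nil hD hl hln hlam hb).exists_isProjectiveCover hn hb⟩
    · exact ⟨_, GroupDatum.isActionP_nonnilData hD (hα hD) hl hln hlam hb,
        (GroupDatum.isUniversal_of_nonnil hD (hα hD) hl hln hlam hb).exists_isProjectiveCover hn
          hb⟩
  exact ⟨Φ, hΦ, fun Φ' hΦ' => hΦ'.eq hΦ, ⟨f, hf⟩, fun π hπ => hf.nonempty_linearEquiv hπ⟩
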